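/- **Setting.** Let $0<\alpha<2$, $b=1-\alpha$, $\tfrac12<\delta<1$, $C_0>0$, $R_0,R^*,T>0$ with $2T\ge R_0^\alpha$, $x_0\in\mathbb R^2$. Let $(\theta,u)$ be a weak solution on $\mathbb R^2\times(0,\infty)$, with $\theta,u\in L^2((0,S)\times\mathbb R^2)$ for every $S>0$ and initial value $\theta_0\in L^2$, of $$(\partial_t+u\cdot\nabla+\Lambda^\alpha)\theta=0,\quad u=(-\partial_2\Psi,\partial_1\Psi),\quad \Lambda\Psi=-\theta,\quad \nabla\cdot u=0,$$ such that $\theta$ and $u$ are smooth on $B(x_0,2R_0)\times(0,2T)$; here $(\Lambda^\alpha f)^\wedge=|\xi|^\alpha\hat f$. Let $\theta^*(x,z,t)=\frac{\alpha}{2\pi}\int_{\mathbb R^2}\frac{z^\alpha}{(|x-y|^2+z^2)^{(2+\alpha)/2}}\theta(y,t)\,dy$ be the Poisson extension of $\theta(\cdot,t)$, which solves $\nabla\cdot(z^b\nabla\theta^*)=0$ for $z>0$ with trace $\theta$, and let $c_\alpha=2^{\alpha-1}\Gamma(\alpha/2)/\Gamma(1-\alpha/2)$, so that $\Lambda^\alpha\theta=\lim_{z\to0}(-c_\alpha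 z^b\partial_z\theta^*)$ (and $c_1=1$). **Cut-offs.** Let $\eta\in C_c^\infty(0,\infty)$ satisfy $0\le\eta\le1$, $\eta=0$ on $(0,T/3)\cup(5T/3,\infty)$, $\eta=1$ on $[2T/3,4T/3]$, $|\eta'|\le \frac{C_0}{T}\eta^{2\delta-1}$. Call a smooth $\psi:\mathbb R^2\to[0,1]$ *refined at scale $R$* if $|\partial_i\psi|\le\frac{C_0}{R}\psi^\delta$ and $|\partial_i\partial_j\psi|\le\frac{C_0}{R^2}\psi^{2\delta-1}$. Let $\psi_0$ be refined at scale $R_0$, equal to $1$ on $B(x_0,R_0)$, with compact support in $B(x_0,2R_0)$. Let $\psi^*\in C^\infty([0,\infty))$ be nonincreasing, equal to $1$ on $[0,R^*]$ and $0$ on $[R^*+R_0,\infty)$, with $|\psi^{*\prime}|\le\frac{C_0}{R_0}(\psi^*)^{\delta}$, $|\psi^{*\prime\prime}|\le\frac{C_0}{R_0^2}(\psi^*)^{2\delta-1}$. Put $\phi_0=\eta\psi_0$ and $\phi_0^*=\eta\psi_0\psi^*$. **Covers.** Let $K_1,K_2$ be positive integers. A $(K_1,K_2)$-cover at scale $R\in(0,R_0]$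 is a cover of $B(x_0,R_0)$ by balls $B(x_i,R)$, $1\le i\le n$, with $(R_0/R)^2\le n\le K_1(R_0/R)^2$, such that each point of $B(x_0,R_0)$ lies in at most $K_2$ of the balls. It is equipped with cut-offs $\phi_i=\eta\psi_i$, where each $\psi_i\le\psi_0$ is refined at scale $R$ and every point $x\in\mathbb R^2$ satisfies $\psi_i(x)\ne0$ for at most $K_2$ indices $i$. If $B(x_i,R)\subset B(x_0,R_0)$, then $\psi_i=1$ on $B(x_i,R)$ and $\psi_i=0$ outside $B(x_i,2R)$ (and $\psi_i=\psi_0$ if $B(x_i,R)=B(x_0,R_0)$). Otherwise, let $V_i(\rho)$ be the set of $x$ with $R_0\le|x-x_0|<2R_0$ such that the ray from $x_0$ through $x$ meets $\partial B(x_i,\rho)\setminus B(x_0,R_0)$; then $\psi_i=1$ on $B(x_i,R)\cap B(x_0,R_0)$, $\psi_i=\psi_0$ on $V_i(R)$, and $\psi_i=0$ outside $B(x_i,2R)\cup V_i(R)\cup V_i(2R)$. **Averages.** Let $$\vartheta_0=\frac1T\int_0^{2T}\frac1{R_0^2}\int\tfrac12\theta^2\phi_0^{2\delta-1}\,dx\,dt,\qquad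 \vartheta_0^*=\frac1T\int_0^{2T}\frac1{R_0^2}\int\int_0^\infty c_\alpha z^b\tfrac12(\theta^*)^2(\phi_0^*)^{2\delta-1}\,dz\,dx\,dt,$$ $$\varepsilon_0^*=\frac1T\int_0^{2T}\frac1{R_0^2}\int\int_0^\infty c_\alpha z^b|\nabla\theta^*|^2\phi_0^*\,dz\,dx\,dt,$$ assume $\varepsilon_0^*>0$, and put $\sigma_0=\max\{(\vartheta_0/\varepsilon_0^*)^{1/\alpha},(\vartheta_0^*/\varepsilon_0^*)^{1/2}\}$ and $\beta=\min\{(8C_0K_1K_2)^{-1/2},(8C_0K_1K_2)^{-1/\alpha}\}$. For a cover at scale $R$ let $$G_i=R^2F_i=\frac1T\int_0^{2T}\int\tfrac12\theta^2\,u\cdot\nabla\phi_i\,dx\,dt,\qquad \langle G\rangle_R=\frac1n\sum_{i=1}^nG_i .$$ **Corollary 3.** If $\sigma_0<\beta R_0$ and $\sigma_0/\beta\le r,R\le R_0$ with $r,R>0$, then for any $(K_1,K_2)$-covers at scales $r$ and $R$, with any such cut-offs, $$\frac1{16K_1K_2}\Big(\frac rR\Big)^2\le\frac{\langle G\rangle_r}{\langle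 G\rangle_R}\le16K_1K_2\Big(\frac rR\Big)^2 .$$ In particular, if $r=2^kR$ with $k\in\mathbb Z$, then $\frac1{16K_1K_2}2^{2k}\le\langle G\rangle_r/\langle G\rangle_R\le16K_1K_2\,2^{2k}$. -/

import Mathlib

open MeasureTheory Set Metric
open scoped FourierTransform ContDiff

namespace SQG

/-- The physical plane with its Euclidean norm. -/
abbrev Plane : Type := EuclideanSpace ℝ (Fin 2)

noncomputable section

/-- The partial derivative of `g` in the `i`-th coordinate direction. -/
def partialDeriv (i : Fin 2) (g : Plane → ℝ) (x : Plane) : ℝ :=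
  fderiv ℝ g x (EuclideanSpace.single i 1)

/-! ### The generalized SQG system -/

/-- The operator `Λ^α` on test functions, the Fourier multiplier with symbol (absolute value of
the frequency) to the power `α`. Mathlib's transform uses the character `exp (-2πi x·ξ)`, so the
angular frequency is `2πξ`. -/
def fracLaplacian (α : ℝ) (g : Plane → ℝ) (x : Plane) : ℝ :=
  (𝓕⁻ (fun ξ : Plane =>
    (((2 * Real.pi * ‖ξ‖) ^ α : ℝ) : ℂ) * 𝓕 (fun y : Plane => (g y : ℂ)) ξ) x).re

/-- The velocity `v` is `(-∂₂Ψ, ∂₁Ψ)` where the stream function satisfies `ΛΨ = -f`, for `f` and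
`v` square integrable. The stream function enters through its Fourier transform `Ψhat`, and the
transforms of `f` and of the components of `v` are taken in `L²`. -/
def IsVelocityOf (f : Plane → ℝ) (v : Plane → Plane) : Prop :=
  ∃ (hf : MemLp (fun x => (f x : ℂ)) 2 volume)
    (hv : ∀ j : Fin 2, MemLp (fun x => (v x j : ℂ)) 2 volume) (Ψhat : Plane → ℂ),
    (∀ᵐ ξ : Plane, ((2 * Real.pi * ‖ξ‖ : ℝ) : ℂ) * Ψhat ξ = -((𝓕 (hf.toLp _) : Lp ℂ 2 (volume : Measure Plane)) ξ)) ∧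
    (∀ᵐ ξ : Plane, (𝓕 ((hv 0).toLp _) : Lp ℂ 2 (volume : Measure Plane)) ξ =
      -(2 * Real.pi * Complex.I * (ξ 1 : ℂ) * Ψhat ξ)) ∧
    (∀ᵐ ξ : Plane, (𝓕 ((hv 1).toLp _) : Lp ℂ 2 (volume : Measure Plane)) ξ =
      2 * Real.pi * Complex.I * (ξ 0 : ℂ) * Ψhat ξ)

/-- `(θ, u)` is a weak solution on `ℝ² × (0, ∞)` of `(∂ₜ + u·∇ + Λ^α) θ = 0`,
`u = (-∂₂Ψ, ∂₁Ψ)`, `ΛΨ = -θ`, `∇·u = 0`, with `θ(·, 0) = θ₀`. -/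
structure IsWeakSolution (α : ℝ) (θ₀ : Plane → ℝ) (θ : ℝ → Plane → ℝ)
    (u : ℝ → Plane → Plane) : Prop where
  initial_memLp : MemLp θ₀ 2 volume
  temperature_memLp : ∀ S : ℝ, 0 < S →
    MemLp (fun p : ℝ × Plane => θ p.1 p.2) 2 ((volume.restrict (Ioo 0 S)).prod volume)
  velocity_memLp : ∀ S : ℝ, 0 < S →
    MemLp (fun p : ℝ × Plane => u p.1 p.2) 2 ((volume.restrict (Ioo 0 S)).prod volume)
  velocity_eq : ∀ᵐ t : ℝ, 0 < t → IsVelocityOf (θ t) (u t)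
  div_free : ∀ᵐ t : ℝ, 0 < t → ∀ g : Plane → ℝ, ContDiff ℝ ∞ g → HasCompactSupport g →
    ∫ x, inner ℝ (u t x) (gradient g x) = 0
  equation : ∀ φ : ℝ → Plane → ℝ, ContDiff ℝ ∞ (fun p : ℝ × Plane => φ p.1 p.2) →
    HasCompactSupport (fun p : ℝ × Plane => φ p.1 p.2) →
    (∫ t in Ioi (0 : ℝ), ∫ x, θ t x *
        (deriv (fun s => φ s x) t + inner ℝ (u t x) (gradient (φ t) x)
          - fracLaplacian α (φ t) x))
      + ∫ x, θ₀ x * φ 0 x = 0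

/-! ### The extension to the half space -/

/-- The Poisson kernel of the operator `∇·(z^(1-α) ∇)` on `ℝ² × (0, ∞)`. -/
def poissonKernel (α : ℝ) (x : Plane) (z : ℝ) : ℝ :=
  α / (2 * Real.pi) * z ^ α / (‖x‖ ^ 2 + z ^ 2) ^ ((2 + α) / 2)

/-- The extension `L f` of `f` to `ℝ² × (0, ∞)`, which solves `∇·(z^b ∇ L f) = 0`, `b = 1 - α`,
with trace `f`. -/
def extension (α : ℝ) (f : Plane → ℝ) (x : Plane) (z : ℝ) : ℝ :=
  ∫ y, poissonKernel α (x - y) z * f y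

/-- The normalized weight `c_α z^b`, `b = 1 - α`, with the constant `c_α` for which
`Λ^α f = lim_{z → 0} (- c_α z^b ∂_z (L f))`; in particular `c_1 = 1`. -/
def weight (α z : ℝ) : ℝ :=
  2 ^ (α - 1) * Real.Gamma (α / 2) / Real.Gamma (1 - α / 2) * z ^ (1 - α)

/-- The squared length of the full (three dimensional) gradient of `L f` at `(x, z)`. -/
def extensionGradSq (α : ℝ) (f : Plane → ℝ) (x : Plane) (z : ℝ) : ℝ :=
  ‖gradient (fun y => extension α f y z) x‖ ^ 2 + (deriv (fun w => extension α f x w) z) ^ 2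

/-! ### Refined cut-off functions -/

/-- Temporal refined cut-off functions. -/
structure IsTimeCutoff (δ C₀ T : ℝ) (η : ℝ → ℝ) : Prop where
  smooth : ContDiff ℝ ∞ η
  compact : HasCompactSupport η
  support_pos : tsupport η ⊆ Ioi 0
  nonneg : ∀ t, 0 ≤ η t
  le_one : ∀ t, η t ≤ 1
  eq_zero : ∀ t ∈ Ioo 0 (T / 3) ∪ Ioi (5 * T / 3), η t = 0
  eq_one : ∀ t ∈ Icc (2 * T / 3) (4 * T / 3), η t = 1
  deriv_le : ∀ t, |deriv η t| ≤ C₀ / T * η t ^ (2 * δ - 1)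

/-- The bounds common to all spatial refined cut-off functions at scale `R`. -/
structure IsRefined (δ C₀ R : ℝ) (ψ : Plane → ℝ) : Prop where
  smooth : ContDiff ℝ ∞ ψ
  nonneg : ∀ x, 0 ≤ ψ x
  le_one : ∀ x, ψ x ≤ 1
  deriv_le : ∀ x i, |partialDeriv i ψ x| ≤ C₀ / R * ψ x ^ δ
  deriv_deriv_le : ∀ x i j,
    |partialDeriv i (partialDeriv j ψ) x| ≤ C₀ / R ^ 2 * ψ x ^ (2 * δ - 1)

/-- The spatial component of the macro-scale cut-off function. -/
structure IsMacroCutoff (δ C₀ : ℝ) (x₀ : Plane) (R₀ : ℝ) (ψ₀ : Plane → ℝ) : Prop where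
  refined : IsRefined δ C₀ R₀ ψ₀
  eq_one : ∀ x ∈ ball x₀ R₀, ψ₀ x = 1
  support_subset : tsupport ψ₀ ⊆ ball x₀ (2 * R₀)

/-- The vertical cut-off function, equal to one on `[0, Rs]` and decreasing to zero across
`[Rs, Rs + R₀)`, with the gradient restrictions at scale `R₀`. -/
structure IsVerticalCutoff (δ C₀ R₀ Rs : ℝ) (χ : ℝ → ℝ) : Prop where
  smooth : ContDiffOn ℝ ∞ χ (Ici 0)
  eq_one : ∀ z ∈ Icc 0 Rs, χ z = 1
  antitone : AntitoneOn χ (Ici 0)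
  eq_zero : ∀ z, Rs + R₀ ≤ z → χ z = 0
  deriv_le : ∀ z, 0 < z → |deriv χ z| ≤ C₀ / R₀ * χ z ^ δ
  deriv_deriv_le : ∀ z, 0 < z → |deriv (deriv χ) z| ≤ C₀ / R₀ ^ 2 * χ z ^ (2 * δ - 1)

/-! ### Covers and the cut-off functions attached to them -/

/-- `(K₁, K₂)`-covers of `B(x₀, R₀)` at scale `R` by the balls `B(c i, R)`, `i < n`. -/
structure IsCover (K₁ K₂ : ℕ) (x₀ : Plane) (R₀ R : ℝ) (n : ℕ) (c : Fin n → Plane) : Prop where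
  scale_pos : 0 < R
  scale_le : R ≤ R₀
  covers : ball x₀ R₀ ⊆ ⋃ i, ball (c i) R
  le_card : (R₀ / R) ^ 2 ≤ n
  card_le : n ≤ K₁ * (R₀ / R) ^ 2
  multiplicity : ∀ x ∈ ball x₀ R₀, {i | x ∈ ball (c i) R}.ncard ≤ K₂

/-- The points of the annulus `R₀ ≤ |x - x₀| < 2 R₀` for which the ray from `x₀` through `x` meets
`∂B(y, ρ)` outside `B(x₀, R₀)`. -/
def sector (x₀ : Plane) (R₀ : ℝ) (y : Plane) (ρ : ℝ) : Set Plane :=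
  {x | R₀ ≤ dist x x₀ ∧ dist x x₀ < 2 * R₀ ∧
    ∃ s : ℝ, 0 ≤ s ∧ x₀ + s • (x - x₀) ∈ sphere y ρ ∩ (ball x₀ R₀)ᶜ}

/-- The set `S₀`. -/
def boundarySet₀ (x₀ : Plane) (R₀ : ℝ) (y : Plane) (R : ℝ) : Set Plane :=
  ball y R ∩ ball x₀ R₀

/-- The set `S₁`. -/
def boundarySet₁ (x₀ : Plane) (R₀ : ℝ) (y : Plane) (R : ℝ) : Set Plane :=
  sector x₀ R₀ y R

/-- The set `S₂`. -/
def boundarySet₂ (x₀ : Plane) (R₀ : ℝ) (y : Plane) (R : ℝ) : Set Plane :=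
  (ball y (2 * R) ∪ sector x₀ R₀ y (2 * R)) ∩
    (boundarySet₀ x₀ R₀ y R ∪ boundarySet₁ x₀ R₀ y R)ᶜ

/-- The spatial refined cut-off functions `ψ i` attached to the elements `B(c i, R)` of a cover.
The cut-off function of the macro-scale ball itself is the macro-scale cut-off function, and the
local multiplicity `K₂` is respected by the cut-off functions. -/
structure IsCutoffFamily (δ C₀ : ℝ) (x₀ : Plane) (R₀ : ℝ) (ψ₀ : Plane → ℝ) (K₂ : ℕ) (R : ℝ)
    (n : ℕ) (c : Fin n → Plane) (ψ : Fin n → Plane → ℝ) : Prop where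
  refined : ∀ i, IsRefined δ C₀ R (ψ i)
  le_macro : ∀ i x, ψ i x ≤ ψ₀ x
  interior_eq_one : ∀ i, ball (c i) R ⊆ ball x₀ R₀ → ∀ x ∈ ball (c i) R, ψ i x = 1
  interior_support : ∀ i, ball (c i) R ⊆ ball x₀ R₀ → Function.support (ψ i) ⊆ ball (c i) (2 * R)
  boundary_eq_one : ∀ i, ¬ ball (c i) R ⊆ ball x₀ R₀ →
    ∀ x ∈ boundarySet₀ x₀ R₀ (c i) R, ψ i x = 1
  boundary_eq_macro : ∀ i, ¬ ball (c i) R ⊆ ball x₀ R₀ →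
    ∀ x ∈ boundarySet₁ x₀ R₀ (c i) R, ψ i x = ψ₀ x
  boundary_support : ∀ i, ¬ ball (c i) R ⊆ ball x₀ R₀ → Function.support (ψ i) ⊆
    boundarySet₀ x₀ R₀ (c i) R ∪ boundarySet₁ x₀ R₀ (c i) R ∪ boundarySet₂ x₀ R₀ (c i) R
  macro_eq : ∀ i, c i = x₀ → R = R₀ → ψ i = ψ₀
  multiplicity : ∀ x, {i | ψ i x ≠ 0}.ncard ≤ K₂

/-! ### Macro-scale averages, length scale and fluxes -/

/-- The macro-scale average `ϑ₀`. -/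
def varianceAvg (δ R₀ T : ℝ) (θ : ℝ → Plane → ℝ) (η : ℝ → ℝ) (ψ₀ : Plane → ℝ) : ℝ :=
  1 / T * ∫ t in (0 : ℝ)..(2 * T), 1 / R₀ ^ 2 *
    ∫ x, 1 / 2 * θ t x ^ 2 * (η t * ψ₀ x) ^ (2 * δ - 1)

/-- The macro-scale average `ϑ₀*`. -/
def extVarianceAvg (α δ R₀ T : ℝ) (θ : ℝ → Plane → ℝ) (η : ℝ → ℝ) (ψ₀ : Plane → ℝ)
    (χ : ℝ → ℝ) : ℝ :=
  1 / T * ∫ t in (0 : ℝ)..(2 * T), 1 / R₀ ^ 2 *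
    ∫ x, ∫ z in Ioi (0 : ℝ), weight α z * (1 / 2 * extension α (θ t) x z ^ 2) *
      (η t * ψ₀ x * χ z) ^ (2 * δ - 1)

/-- The macro-scale average `ε₀*`. -/
def dissipationAvg (α R₀ T : ℝ) (θ : ℝ → Plane → ℝ) (η : ℝ → ℝ) (ψ₀ : Plane → ℝ)
    (χ : ℝ → ℝ) : ℝ :=
  1 / T * ∫ t in (0 : ℝ)..(2 * T), 1 / R₀ ^ 2 *
    ∫ x, ∫ z in Ioi (0 : ℝ), weight α z * extensionGradSq α (θ t) x z * (η t * ψ₀ x * χ z)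

/-- The length scale `σ₀`, as a function of `ϑ₀`, `ϑ₀*` and `ε₀*`. -/
def lengthScale (α v vs e : ℝ) : ℝ :=
  max ((v / e) ^ (1 / α)) ((vs / e) ^ (1 / 2 : ℝ))

/-- The parameter `β`. -/
def cascadeParam (α C₀ : ℝ) (K₁ K₂ : ℕ) : ℝ :=
  min ((8 * C₀ * K₁ * K₂) ^ (-1 / 2 : ℝ)) ((8 * C₀ * K₁ * K₂) ^ (-1 / α))

/-- The time averaged localized temperature variance flux for the cut-off function
`φ(x, t) = η(t) ψ(x)`. -/
def localFlux (T : ℝ) (θ : ℝ → Plane → ℝ) (u : ℝ → Plane → Plane) (η : ℝ → ℝ)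
    (ψ : Plane → ℝ) : ℝ :=
  1 / T * ∫ t in (0 : ℝ)..(2 * T), ∫ x,
    1 / 2 * θ t x ^ 2 * inner ℝ (u t x) (gradient (fun y => η t * ψ y) x)

/-- The ensemble average of the localized fluxes over a cover with `n` elements. -/
def ensembleFlux (T : ℝ) (θ : ℝ → Plane → ℝ) (u : ℝ → Plane → Plane) (η : ℝ → ℝ) {n : ℕ}
    (ψ : Fin n → Plane → ℝ) : ℝ :=
  1 / (n : ℝ) * ∑ i, localFlux T θ u η (ψ i)

end

end SQG

open Filter Topology

/-! ### Convolutions with powers of |x|² + z²: domination, continuity, differentiation under the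
integral -/

namespace SQG

/-! The sum of the localized fluxes over a cover is pinned down independently of the scale: for
every cover at a scale `R ≥ σ₀/β` it lies between `Y` and `16 K₂ Y`, where `Y = R₀² ε₀* / 8`
(`sum_localFlux_mem_Icc`). The ensemble average divides this sum by the number of balls, which is
`(R₀/R)²` up to the factor `K₁`, so the quotient of two averages is `(r/R)²` up to `16 K₁ K₂`
(`ratio_bounds`).

The bounds on the sum come from testing the equation with `η ψᵢ θ`, which is admissible because `θ`
is smooth on the cylinder (`energy_balance`). The flux for `φᵢ` equals the localized dissipation,
minus an error from the spatial cut-offs, minus an error from `η'`. Since `ψ₀ ≤ ∑ ψᵢ ≤ K₂ ψ₀`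
(`IsCutoffFamily.parent_le_sum`, `IsCutoffFamily.sum_le`), the time averaged dissipation terms add
up to something between `R₀² ε₀*` and `K₂ R₀² ε₀*`. Up to the same factor `R₀²` the errors are at
most `5 C₀ K₂ ϑ₀* / R²` and `C₀ K₂ ϑ₀ / T`, and the choice of `σ₀` and `β` makes these at most 5/8
and 1/4 of `ε₀*`. One eighth of the dissipation survives.

The analytic core is `integral_dissipationDensity`, which turns the nonlocal quantity `∫ f Λ^α(ψ f)`
into a weighted Dirichlet integral of the extension. Let `N = c_α z^b ∂_z f*`. The extension
equation expresses the `z`-derivative of `∫ N f* ψ dx` as localized energy minus an error containing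
the Laplacian of `ψ`; multiplying by the vertical cut-off and integrating from 0 gives the identity,
once the limit of `∫ N f* ψ dx` at `z = 0` is known to be `-∫ f Λ^α(ψ f)`. As `f` is only square
integrable globally and smooth locally, this limit is found by duality
(`tendsto_integral_conormal`). The kernel of `f ↦ N` is symmetric, so `N` can be moved onto `ψ f`,
which is smooth with compact support; for such functions the Fourier symbol of `N`
(`integral_conormal_symbol`) gives `N → -Λ^α`. Replacing `f* ψ` by `f ψ` costs nothing in the limit,
because `N` stays bounded over the support of `ψ`: by `exists_local_split`, `f` is a nice function
plus one vanishing near that support.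

The vertical error contains `z^(-α) χ'`, one power of `z` worse than the weight. Two comparison
arguments for `χ` give `|χ'| ≤ 2 C₀ R₀⁻² z χ^(2δ-1)` (`IsVerticalCutoff.abs_deriv_le`), linear in
`C₀` as the form of `β` demands. -/

lemma finrank_plane : Module.finrank ℝ Plane = 2 := by simp

/-- Kernels are dominated, locally uniformly in their parameters, by multiples of this weight. It is
square integrable because 4 exceeds the dimension 2, so its product with any `L²` function is
integrable. -/
lemma memLp_decay : MemLp (fun y : Plane => (1 + ‖y‖ ^ 2)⁻¹) 2 volume := by
  have hm : AEStronglyMeasurable (fun y : Plane => (1 + ‖y‖ ^ 2)⁻¹) volume :=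
    (Continuous.inv₀ (by fun_prop) (fun y => by positivity)).aestronglyMeasurable
  rw [memLp_two_iff_integrable_sq hm]
  have := integrable_rpow_neg_one_add_norm_sq (E := Plane) (μ := volume) (r := 4)
    (by rw [finrank_plane]; norm_num)
  refine this.congr (ae_of_all _ fun y => ?_)
  have h : (0 : ℝ) ≤ 1 + ‖y‖ ^ 2 := by positivity
  show (1 + ‖y‖ ^ 2) ^ (-4 / 2 : ℝ) = _
  rw [show (-4 / 2 : ℝ) = -(2 : ℕ) by norm_num, Real.rpow_neg h, Real.rpow_natCast, ← inv_pow]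

lemma integrable_decay_mul {f : Plane → ℝ} (hf : MemLp f 2 volume) :
    Integrable (fun y : Plane => (1 + ‖y‖ ^ 2)⁻¹ * |f y|) volume := by
  exact memLp_decay.integrable_mul hf.norm

lemma integrable_kernel_mul {f : Plane → ℝ} (hf : MemLp f 2 volume) {k : Plane → ℝ}
    (hk : AEStronglyMeasurable k volume) {C : ℝ} (hb : ∀ y, |k y| ≤ C * (1 + ‖y‖ ^ 2)⁻¹) :
    Integrable (fun y => k y * f y) volume := by
  refine ((integrable_decay_mul hf).const_mul C).mono' (hk.mul hf.1) (ae_of_all _ fun y => ?_)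
  rw [norm_mul, Real.norm_eq_abs, Real.norm_eq_abs, ← mul_assoc]
  exact mul_le_mul_of_nonneg_right (hb y) (abs_nonneg _)

/-- Dominated differentiation: the derivative kernels need a common bound near `p₀`, the kernel
itself only a bound at `p₀`. Integrability of the derivative is returned as well, so that directions
can be inserted under the integral sign. -/
lemma hasFDerivAt_integral_kernel {P : Type*} [NormedAddCommGroup P] [NormedSpace ℝ P]
    {f : Plane → ℝ} (hf : MemLp f 2 volume) {k : P → Plane → ℝ} {k' : P → Plane → P →L[ℝ] ℝ}
    {p₀ : P} {C : ℝ} (hk : ∀ᶠ p in 𝓝 p₀, Continuous (k p)) (hk' : Continuous (k' p₀))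
    (hb : ∀ y, |k p₀ y| ≤ C * (1 + ‖y‖ ^ 2)⁻¹)
    (hb' : ∀ᶠ p in 𝓝 p₀, ∀ y, ‖k' p y‖ ≤ C * (1 + ‖y‖ ^ 2)⁻¹)
    (hd : ∀ᶠ p in 𝓝 p₀, ∀ y, HasFDerivAt (fun p => k p y) (k' p y) p) :
    Integrable (fun y => f y • k' p₀ y) volume ∧
      HasFDerivAt (fun p => ∫ y, k p y * f y) (∫ y, f y • k' p₀ y) p₀ := by
  have hs := hb'.and hd
  have hle : ∀ p y, (∀ y, ‖k' p y‖ ≤ C * (1 + ‖y‖ ^ 2)⁻¹) →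
      ‖f y • k' p y‖ ≤ C * ((1 + ‖y‖ ^ 2)⁻¹ * |f y|) := fun p y hp => by
    rw [norm_smul, Real.norm_eq_abs, mul_comm, ← mul_assoc]
    exact mul_le_mul_of_nonneg_right (hp y) (abs_nonneg _)
  refine ⟨((integrable_decay_mul hf).const_mul C).mono' (hf.1.smul hk'.aestronglyMeasurable)
    (ae_of_all _ fun y => hle p₀ y hb'.self_of_nhds), ?_⟩
  refine hasFDerivAt_integral_of_dominated_of_fderiv_le (F' := fun p y => f y • k' p y)
    (bound := fun y => C * ((1 + ‖y‖ ^ 2)⁻¹ * |f y|)) hs ?_ ?_ ?_ ?_ ?_ ?_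
  · filter_upwards [hk] with p hp using hp.aestronglyMeasurable.mul hf.1
  · exact integrable_kernel_mul hf hk.self_of_nhds.aestronglyMeasurable hb
  · exact hf.1.smul hk'.aestronglyMeasurable
  · exact ae_of_all _ fun y p hp => hle p y hp.1
  · exact (integrable_decay_mul hf).const_mul C
  · refine ae_of_all _ fun y p hp => ?_
    have := (hp.2 y).mul_const (f y)
    exact this

lemma continuousAt_integral_kernel {P : Type*} [TopologicalSpace P] [FirstCountableTopology P]
    {f : Plane → ℝ} (hf : MemLp f 2 volume) {k : P → Plane → ℝ}
    {p₀ : P} {C : ℝ} (hk : ∀ᶠ p in 𝓝 p₀, Continuous (k p))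
    (hb : ∀ᶠ p in 𝓝 p₀, ∀ y, |k p y| ≤ C * (1 + ‖y‖ ^ 2)⁻¹)
    (hd : ∀ y, ContinuousAt (fun p => k p y) p₀) :
    ContinuousAt (fun p => ∫ y, k p y * f y) p₀ := by
  refine continuousAt_of_dominated (bound := fun y => C * ((1 + ‖y‖ ^ 2)⁻¹ * |f y|)) ?_ ?_ ?_ ?_
  · filter_upwards [hk] with p hp using hp.aestronglyMeasurable.mul hf.1
  · filter_upwards [hb] with p hp
    refine ae_of_all _ fun y => ?_
    rw [norm_mul, Real.norm_eq_abs, Real.norm_eq_abs, ← mul_assoc]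
    exact mul_le_mul_of_nonneg_right (hp y) (abs_nonneg _)
  · exact (integrable_decay_mul hf).const_mul C
  · exact ae_of_all _ fun y => (hd y).mul continuousAt_const

/-- The kernel `(|x - y|² + z²)^(-s)` at `p = (x, z)`. -/
noncomputable def rieszKernel (s : ℝ) (p : Plane × ℝ) (y : Plane) : ℝ :=
  (‖p.1 - y‖ ^ 2 + p.2 ^ 2) ^ (-s)

/-- The convolution of `f` with `m(x) (|x|² + z²)^(-s)` at `p = (x, z)`. -/
noncomputable def rieszInt (m : Plane → ℝ) (f : Plane → ℝ) (s : ℝ) (p : Plane × ℝ) : ℝ :=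
  ∫ y, m (p.1 - y) * rieszKernel s p y * f y

lemma base_pos {p : Plane × ℝ} (hp : 0 < p.2) (y : Plane) : 0 < ‖p.1 - y‖ ^ 2 + p.2 ^ 2 := by
  positivity

lemma rieszKernel_pos {s : ℝ} {p : Plane × ℝ} (hp : 0 < p.2) (y : Plane) :
    0 < rieszKernel s p y := Real.rpow_pos_of_pos (base_pos hp y) _

lemma eventually_snd_pos {p₀ : Plane × ℝ} (hp : 0 < p₀.2) : ∀ᶠ p : Plane × ℝ in 𝓝 p₀, 0 < p.2 :=
  continuous_snd.continuousAt.eventually (lt_mem_nhds hp)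

/-- Near a point of positive height `x` stays bounded and `z` stays away from 0, so `|x - y|² + z²`
dominates a multiple of `1 + |y|²`. -/
lemma eventually_base_inv_le {p₀ : Plane × ℝ} (hp : 0 < p₀.2) :
    ∃ C : ℝ, 0 < C ∧ ∀ᶠ p in 𝓝 p₀, ∀ y : Plane,
      (‖p.1 - y‖ ^ 2 + p.2 ^ 2)⁻¹ ≤ C * (1 + ‖y‖ ^ 2)⁻¹ := by
  -- From `|y|² ≤ 2|x - y|² + 2|x|²` one gets `1 + |y|² ≤ A + 2|x - y|²`; since `z ≥ z₀/2`, the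
  -- constant `A` is paid for by `A (4/z₀²) z²`.
  set A : ℝ := 1 + 2 * (‖p₀.1‖ + 1) ^ 2 with hA
  have hApos : 0 < A := by positivity
  refine ⟨2 + A * (4 / p₀.2 ^ 2), by positivity, ?_⟩
  have h1 : ∀ᶠ p : Plane × ℝ in 𝓝 p₀, p₀.2 / 2 < p.2 :=
    continuous_snd.continuousAt.eventually (lt_mem_nhds (by linarith))
  have h2 : ∀ᶠ p : Plane × ℝ in 𝓝 p₀, ‖p.1‖ < ‖p₀.1‖ + 1 :=
    (continuous_fst.norm.continuousAt (x := p₀)).eventually (gt_mem_nhds (by simp))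
  filter_upwards [h1, h2] with p hp1 hp2 y
  have hp3 : 0 < p.2 := by linarith
  have hq : 0 < ‖p.1 - y‖ ^ 2 + p.2 ^ 2 := base_pos hp3 y
  rw [← div_eq_mul_inv, inv_eq_one_div, div_le_div_iff₀ hq (by positivity), one_mul]
  have h3 : ‖y‖ ≤ ‖p.1 - y‖ + ‖p.1‖ := by
    have := norm_sub_le p.1 (p.1 - y)
    simp at this
    linarith
  have h4 : ‖y‖ ^ 2 ≤ 2 * ‖p.1 - y‖ ^ 2 + 2 * (‖p₀.1‖ + 1) ^ 2 := by
    have h5 : ‖y‖ ≤ ‖p.1 - y‖ + (‖p₀.1‖ + 1) := by linarith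
    have h6 := pow_le_pow_left₀ (norm_nonneg y) h5 2
    nlinarith [sq_nonneg (‖p.1 - y‖ - (‖p₀.1‖ + 1))]
  have h7 : A ≤ A * (4 / p₀.2 ^ 2) * p.2 ^ 2 := by
    have : 1 ≤ 4 / p₀.2 ^ 2 * p.2 ^ 2 := by
      rw [div_mul_eq_mul_div, le_div_iff₀ (by positivity)]
      nlinarith
    nlinarith
  have h8 : 0 ≤ A * (4 / p₀.2 ^ 2) * ‖p.1 - y‖ ^ 2 := by positivity
  nlinarith [sq_nonneg p.2]

lemma eventually_rieszKernel_le {s : ℝ} (hs : 1 ≤ s) {p₀ : Plane × ℝ} (hp : 0 < p₀.2) :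
    ∃ C : ℝ, 0 < C ∧ ∀ᶠ p in 𝓝 p₀, ∀ y : Plane,
      rieszKernel s p y ≤ C * (1 + ‖y‖ ^ 2)⁻¹ := by
  obtain ⟨C, hC, h⟩ := eventually_base_inv_le hp
  refine ⟨C ^ s, by positivity, ?_⟩
  filter_upwards [h, eventually_snd_pos hp] with p hp1 hp2 y
  have h1 : (0 : ℝ) ≤ (1 + ‖y‖ ^ 2)⁻¹ := by positivity
  have h2 : (1 + ‖y‖ ^ 2)⁻¹ ≤ 1 := inv_le_one_of_one_le₀ (by nlinarith [sq_nonneg ‖y‖])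
  rw [rieszKernel, Real.rpow_neg (base_pos hp2 y).le, ← Real.inv_rpow (base_pos hp2 y).le]
  calc ((‖p.1 - y‖ ^ 2 + p.2 ^ 2)⁻¹) ^ s ≤ (C * (1 + ‖y‖ ^ 2)⁻¹) ^ s := by
        apply Real.rpow_le_rpow (inv_nonneg.2 (base_pos hp2 y).le) (hp1 y) (by linarith)
    _ = C ^ s * ((1 + ‖y‖ ^ 2)⁻¹) ^ s := Real.mul_rpow hC.le h1
    _ ≤ C ^ s * (1 + ‖y‖ ^ 2)⁻¹ := by
        gcongr
        exact Real.rpow_le_self_of_le_one h1 h2 hs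

/-- The distance `|x - y|` is at most the square root of the base, so a factor of degree `d` lowers
the exponent by `d/2`. This is the origin of the recurring condition `d / 2 + 1 ≤ s`. -/
lemma norm_pow_mul_rieszKernel_le {s : ℝ} (d : ℕ) {p : Plane × ℝ} (hp : 0 < p.2) (y : Plane) :
    ‖p.1 - y‖ ^ d * rieszKernel s p y ≤ rieszKernel (s - d / 2) p y := by
  have hq := base_pos hp y
  have h1 : ‖p.1 - y‖ ^ d ≤ (‖p.1 - y‖ ^ 2 + p.2 ^ 2) ^ ((d : ℝ) / 2) := by
    calc ‖p.1 - y‖ ^ d = (‖p.1 - y‖ ^ 2) ^ ((d : ℝ) / 2) := by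
          rw [← Real.rpow_natCast, ← Real.rpow_natCast (n := 2), ← Real.rpow_mul (norm_nonneg _)]
          congr 1; push_cast; ring
      _ ≤ _ := by
          apply Real.rpow_le_rpow (by positivity) (by nlinarith [sq_nonneg p.2]) (by positivity)
  calc ‖p.1 - y‖ ^ d * rieszKernel s p y
      ≤ (‖p.1 - y‖ ^ 2 + p.2 ^ 2) ^ ((d : ℝ) / 2) * rieszKernel s p y :=
        mul_le_mul_of_nonneg_right h1 (rieszKernel_pos hp y).le
    _ = _ := by
        rw [rieszKernel, rieszKernel, ← Real.rpow_add hq]; congr 1; ring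

lemma continuous_rieszKernel {s : ℝ} {p : Plane × ℝ} (hp : 0 < p.2) :
    Continuous (rieszKernel s p) := by
  unfold rieszKernel
  refine Continuous.rpow_const (by fun_prop) fun y => Or.inl (base_pos hp y).ne'

lemma eventually_moment_le {m : Plane → ℝ} {d : ℕ} (hmd : ∀ v, |m v| ≤ ‖v‖ ^ d) {s : ℝ}
    (hs : d / 2 + 1 ≤ s) {p₀ : Plane × ℝ} (hp : 0 < p₀.2) :
    ∃ C : ℝ, 0 < C ∧ ∀ᶠ p in 𝓝 p₀, ∀ y : Plane,
      |m (p.1 - y) * rieszKernel s p y| ≤ C * (1 + ‖y‖ ^ 2)⁻¹ := by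
  obtain ⟨C, hC, h⟩ := eventually_rieszKernel_le (s := s - d / 2) (by linarith) hp
  refine ⟨C, hC, ?_⟩
  filter_upwards [h, eventually_snd_pos hp] with p hp1 hp2 y
  rw [abs_mul, abs_of_pos (rieszKernel_pos hp2 y)]
  exact ((mul_le_mul_of_nonneg_right (hmd _) (rieszKernel_pos hp2 y).le).trans
    (norm_pow_mul_rieszKernel_le d hp2 y)).trans (hp1 y)

lemma integrable_rieszInt {f : Plane → ℝ} (hf : MemLp f 2 volume) {m : Plane → ℝ}
    (hm : Continuous m) {d : ℕ} (hmd : ∀ v, |m v| ≤ ‖v‖ ^ d) {s : ℝ} (hs : d / 2 + 1 ≤ s)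
    {p : Plane × ℝ} (hp : 0 < p.2) :
    Integrable (fun y => m (p.1 - y) * rieszKernel s p y * f y) volume := by
  obtain ⟨C, -, h⟩ := eventually_moment_le hmd hs hp
  exact integrable_kernel_mul hf (Continuous.mul (by fun_prop)
    (continuous_rieszKernel hp)).aestronglyMeasurable h.self_of_nhds

lemma continuousAt_rieszInt {f : Plane → ℝ} (hf : MemLp f 2 volume) {m : Plane → ℝ}
    (hm : Continuous m) {d : ℕ} (hmd : ∀ v, |m v| ≤ ‖v‖ ^ d) {s : ℝ} (hs : d / 2 + 1 ≤ s)
    {p : Plane × ℝ} (hp : 0 < p.2) : ContinuousAt (rieszInt m f s) p := by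
  obtain ⟨C, -, h⟩ := eventually_moment_le hmd hs hp
  refine continuousAt_integral_kernel hf ?_ h fun y => ?_
  · filter_upwards [eventually_snd_pos hp] with q hq
    exact Continuous.mul (by fun_prop) (continuous_rieszKernel hq)
  · refine ContinuousAt.mul (by fun_prop) ?_
    unfold rieszKernel
    exact ContinuousAt.rpow_const (by fun_prop) (Or.inl (base_pos hp y).ne')

lemma hasFDerivAt_rieszKernel {s : ℝ} {p : Plane × ℝ} (hp : 0 < p.2) (y : Plane) :
    HasFDerivAt (fun p => rieszKernel s p y)
      ((-(2 * s) * rieszKernel (s + 1) p y) •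
        ((innerSL ℝ (p.1 - y)).comp (ContinuousLinearMap.fst ℝ Plane ℝ) +
          p.2 • ContinuousLinearMap.snd ℝ Plane ℝ)) p := by
  have h1 : HasFDerivAt (fun p : Plane × ℝ => ‖p.1 - y‖ ^ 2 + p.2 ^ 2)
      ((2 : ℝ) • ((innerSL ℝ (p.1 - y)).comp (ContinuousLinearMap.fst ℝ Plane ℝ)) +
        (2 * p.2) • ContinuousLinearMap.snd ℝ Plane ℝ) p := by
    refine HasFDerivAt.add ?_ ?_
    · have := ((hasFDerivAt_fst (𝕜 := ℝ) (p := p)).sub_const y).norm_sq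
      refine this.congr_fderiv ?_
      ext v <;> simp
    · have := (hasFDerivAt_snd (𝕜 := ℝ) (p := p)).pow 2
      refine this.congr_fderiv ?_
      ext v <;> simp
  have h2 := h1.rpow_const (p := -s) (Or.inl (base_pos hp y).ne')
  refine h2.congr_fderiv ?_
  rw [rieszKernel, show -s - 1 = -(s + 1) by ring]
  ext v <;> simp <;> ring

/-- Both components of `(x - y, z)` are at most the square root of the base, which turns the
exponent `s + 1` into `s + 1/2`. Adding the two bounds instead of taking the Euclidean length
accounts for `4 s` in place of `2 s`. -/
lemma norm_fderiv_le {s : ℝ} (hs : 0 ≤ s) {p : Plane × ℝ} (hp : 0 < p.2) (y : Plane) :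
    ‖(-(2 * s) * rieszKernel (s + 1) p y) •
        ((innerSL ℝ (p.1 - y)).comp (ContinuousLinearMap.fst ℝ Plane ℝ) +
          p.2 • ContinuousLinearMap.snd ℝ Plane ℝ)‖ ≤ 4 * s * rieszKernel (s + 1 / 2) p y := by
  have hq := base_pos hp y
  have hk := rieszKernel_pos (s := s + 1) hp y
  have hroot : ‖(innerSL ℝ (p.1 - y)).comp (ContinuousLinearMap.fst ℝ Plane ℝ) +
          p.2 • ContinuousLinearMap.snd ℝ Plane ℝ‖ ≤
          2 * (‖p.1 - y‖ ^ 2 + p.2 ^ 2) ^ (1 / 2 : ℝ) := by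
    rw [← Real.sqrt_eq_rpow]
    have h1 : ‖p.1 - y‖ ≤ √(‖p.1 - y‖ ^ 2 + p.2 ^ 2) :=
      Real.le_sqrt_of_sq_le (by nlinarith [sq_nonneg p.2])
    have h2 : p.2 ≤ √(‖p.1 - y‖ ^ 2 + p.2 ^ 2) :=
      Real.le_sqrt_of_sq_le (by nlinarith [sq_nonneg ‖p.1 - y‖])
    refine (norm_add_le _ _).trans ?_
    have h3 : ‖(innerSL ℝ (p.1 - y)).comp (ContinuousLinearMap.fst ℝ Plane ℝ)‖ ≤ ‖p.1 - y‖ := by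
      refine (ContinuousLinearMap.opNorm_comp_le _ _).trans ?_
      rw [innerSL_apply_norm]
      exact mul_le_of_le_one_right (norm_nonneg _) (ContinuousLinearMap.norm_fst_le _ _ _)
    have h4 : ‖p.2 • ContinuousLinearMap.snd ℝ Plane ℝ‖ ≤ p.2 := by
      rw [norm_smul, Real.norm_eq_abs, abs_of_pos hp]
      exact mul_le_of_le_one_right hp.le (ContinuousLinearMap.norm_snd_le _ _ _)
    linarith
  rw [norm_smul, Real.norm_eq_abs, abs_mul, abs_neg, abs_of_nonneg (by positivity : 0 ≤ 2 * s),
    abs_of_pos hk]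
  calc _ ≤ 2 * s * rieszKernel (s + 1) p y * (2 * (‖p.1 - y‖ ^ 2 + p.2 ^ 2) ^ (1 / 2 : ℝ)) := by
        gcongr
    _ = 4 * s * (rieszKernel (s + 1) p y * (‖p.1 - y‖ ^ 2 + p.2 ^ 2) ^ (1 / 2 : ℝ)) := by ring
    _ = _ := by
        rw [rieszKernel, rieszKernel, ← Real.rpow_add hq]; congr 2; ring

/-- The condition `‖m'‖ ≤ 1` covers constants and coordinate functions, the only weights that get
differentiated. The two terms of the product rule are dominated separately. -/
lemma hasFDerivAt_rieszInt {f : Plane → ℝ} (hf : MemLp f 2 volume) {m : Plane → ℝ}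
    {m' : Plane → Plane →L[ℝ] ℝ} (hm : ∀ v, HasFDerivAt m (m' v) v) (hm'c : Continuous m')
    {d : ℕ} (hmd : ∀ v, |m v| ≤ ‖v‖ ^ d) (hmd' : ∀ v, ‖m' v‖ ≤ 1) {s : ℝ} (hs : d / 2 + 1 ≤ s)
    {p : Plane × ℝ} (hp : 0 < p.2) :
    let k' := fun y => m (p.1 - y) • ((-(2 * s) * rieszKernel (s + 1) p y) •
        ((innerSL ℝ (p.1 - y)).comp (ContinuousLinearMap.fst ℝ Plane ℝ) +
          p.2 • ContinuousLinearMap.snd ℝ Plane ℝ)) +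
        rieszKernel s p y • (m' (p.1 - y)).comp (ContinuousLinearMap.fst ℝ Plane ℝ)
    Integrable (fun y => f y • k' y) volume ∧
    HasFDerivAt (rieszInt m f s)
      (∫ y, f y • k' y) p := by
  have hs0 : 0 ≤ s := by have : (0 : ℝ) ≤ d / 2 := by positivity
                         linarith
  have hs1 : 1 ≤ s := by have : (0 : ℝ) ≤ d / 2 := by positivity
                         linarith
  have hmc : Continuous m := continuous_iff_continuousAt.2 fun v => (hm v).continuousAt
  obtain ⟨C₁, hC₁, h₁⟩ := eventually_moment_le hmd hs hp
  -- This exponent is what is left of the kernel's derivative after multiplication by a weight of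
  -- degree `d`.
  obtain ⟨C₂, hC₂, h₂⟩ := eventually_rieszKernel_le (s := s + 1 / 2 - d / 2) (by linarith) hp
  obtain ⟨C₃, hC₃, h₃⟩ := eventually_rieszKernel_le (s := s) hs1 hp
  have hpos : ∀ y : Plane, (0 : ℝ) ≤ (1 + ‖y‖ ^ 2)⁻¹ := fun y => by positivity
  refine hasFDerivAt_integral_kernel (C := C₁ + (4 * s * C₂ + C₃)) hf ?_ ?_ ?_ ?_ ?_
    (k := fun p y => m (p.1 - y) * rieszKernel s p y)
    (k' := fun p y => m (p.1 - y) • ((-(2 * s) * rieszKernel (s + 1) p y) •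
        ((innerSL ℝ (p.1 - y)).comp (ContinuousLinearMap.fst ℝ Plane ℝ) +
          p.2 • ContinuousLinearMap.snd ℝ Plane ℝ)) +
        rieszKernel s p y • (m' (p.1 - y)).comp (ContinuousLinearMap.fst ℝ Plane ℝ))
  · filter_upwards [eventually_snd_pos hp] with q hq
    exact Continuous.mul (by fun_prop) (continuous_rieszKernel hq)
  · have := continuous_rieszKernel (s := s) hp
    have := continuous_rieszKernel (s := s + 1) hp
    have : Continuous fun y => innerSL ℝ (p.1 - y) := (innerSL ℝ).continuous.comp (by fun_prop)
    fun_prop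
  · intro y
    refine (h₁.self_of_nhds y).trans ?_
    gcongr
    have : 0 ≤ 4 * s * C₂ := by positivity
    linarith
  · filter_upwards [h₂, h₃, eventually_snd_pos hp] with q hq2 hq3 hq y
    refine (norm_add_le _ _).trans ?_
    have e1 : ‖m (q.1 - y) • ((-(2 * s) * rieszKernel (s + 1) q y) •
        ((innerSL ℝ (q.1 - y)).comp (ContinuousLinearMap.fst ℝ Plane ℝ) +
          q.2 • ContinuousLinearMap.snd ℝ Plane ℝ))‖ ≤ 4 * s * C₂ * (1 + ‖y‖ ^ 2)⁻¹ := by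
      rw [norm_smul, Real.norm_eq_abs]
      calc _ ≤ ‖q.1 - y‖ ^ d * (4 * s * rieszKernel (s + 1 / 2) q y) :=
            mul_le_mul (hmd _) (norm_fderiv_le hs0 hq y) (norm_nonneg _) (by positivity)
        _ = 4 * s * (‖q.1 - y‖ ^ d * rieszKernel (s + 1 / 2) q y) := by ring
        _ ≤ 4 * s * rieszKernel (s + 1 / 2 - d / 2) q y := by
            gcongr; exact norm_pow_mul_rieszKernel_le d hq y
        _ ≤ 4 * s * (C₂ * (1 + ‖y‖ ^ 2)⁻¹) := by gcongr; exact hq2 y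
        _ = _ := by ring
    have e2 : ‖rieszKernel s q y • (m' (q.1 - y)).comp (ContinuousLinearMap.fst ℝ Plane ℝ)‖ ≤
        C₃ * (1 + ‖y‖ ^ 2)⁻¹ := by
      rw [norm_smul, Real.norm_eq_abs, abs_of_pos (rieszKernel_pos hq y)]
      refine (mul_le_of_le_one_right (rieszKernel_pos hq y).le ?_).trans (hq3 y)
      refine (ContinuousLinearMap.opNorm_comp_le _ _).trans ?_
      exact mul_le_one₀ (hmd' _) (norm_nonneg _) (ContinuousLinearMap.norm_fst_le _ _ _)
    have := mul_nonneg hC₁.le (hpos y)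
    nlinarith
  · filter_upwards [eventually_snd_pos hp] with q hq y
    have e1 : HasFDerivAt (fun q : Plane × ℝ => m (q.1 - y))
        ((m' (q.1 - y)).comp (ContinuousLinearMap.fst ℝ Plane ℝ)) q :=
      (hm (q.1 - y)).comp q ((hasFDerivAt_fst (𝕜 := ℝ) (p := q)).sub_const y)
    exact e1.mul (hasFDerivAt_rieszKernel hq y)

end SQG

/-! ### Derivatives of the Riesz integrals -/

namespace SQG

/-- The integral `∫ (|x - y|² + z²)^(-s) f(y) dy`. -/
noncomputable abbrev rieszH (f : Plane → ℝ) (s : ℝ) (p : Plane × ℝ) : ℝ :=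
  rieszInt (fun _ => 1) f s p

/-- The integral `∫ (x i - y i) (|x - y|² + z²)^(-s) f(y) dy`. -/
noncomputable abbrev rieszD (i : Fin 2) (f : Plane → ℝ) (s : ℝ) (p : Plane × ℝ) : ℝ :=
  rieszInt (fun v => v i) f s p

/-- The integral `∫ (x i - y i)² (|x - y|² + z²)^(-s) f(y) dy`. -/
noncomputable abbrev rieszDD (i : Fin 2) (f : Plane → ℝ) (s : ℝ) (p : Plane × ℝ) : ℝ :=
  rieszInt (fun v => v i ^ 2) f s p

lemma abs_coord_le (i : Fin 2) (v : Plane) : |v i| ≤ ‖v‖ := by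
  simpa using PiLp.norm_apply_le v i

lemma abs_sq_coord_le (i : Fin 2) (v : Plane) : |v i ^ 2| ≤ ‖v‖ ^ 2 := by
  rw [abs_pow]
  exact pow_le_pow_left₀ (abs_nonneg _) (abs_coord_le i v) 2

lemma norm_proj_le (i : Fin 2) : ‖(EuclideanSpace.proj i : Plane →L[ℝ] ℝ)‖ ≤ 1 :=
  ContinuousLinearMap.opNorm_le_bound _ zero_le_one fun v => by
    simpa using abs_coord_le i v

variable {f : Plane → ℝ} {s : ℝ} {x : Plane} {z : ℝ}

lemma continuousAt_rieszH (hf : MemLp f 2 volume) (hz : 0 < z) (hs : 1 ≤ s) :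
    ContinuousAt (rieszH f s) (x, z) :=
  continuousAt_rieszInt hf continuous_const (d := 0) (by simp) (by simpa using hs) hz

lemma continuousAt_rieszD (hf : MemLp f 2 volume) (hz : 0 < z) (i : Fin 2) (hs : 3 / 2 ≤ s) :
    ContinuousAt (rieszD i f s) (x, z) :=
  continuousAt_rieszInt hf (by fun_prop) (d := 1) (fun v => by simpa using abs_coord_le i v)
    (by norm_num; linarith) hz

lemma continuousAt_rieszDD (hf : MemLp f 2 volume) (hz : 0 < z) (i : Fin 2) (hs : 2 ≤ s) :
    ContinuousAt (rieszDD i f s) (x, z) :=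
  continuousAt_rieszInt hf (by fun_prop) (d := 2) (abs_sq_coord_le i)
    (by norm_num; linarith) hz

/-- Evaluating the derivative on coordinate directions under the integral yields moments with
exponent `s + 1`. Hence every derivative of the extension that is needed has a closed form in
`rieszH`, `rieszD`, `rieszDD`. -/
lemma exists_hasFDerivAt_rieszH (hf : MemLp f 2 volume) (hz : 0 < z) (hs : 1 ≤ s) :
    ∃ L : Plane × ℝ →L[ℝ] ℝ, HasFDerivAt (rieszH f s) L (x, z) ∧
      (∀ i, L (EuclideanSpace.single i 1, 0) = -(2 * s) * rieszD i f (s + 1) (x, z)) ∧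
      L (0, 1) = -(2 * s) * z * rieszH f (s + 1) (x, z) := by
  obtain ⟨h1, h2⟩ := hasFDerivAt_rieszInt (p := (x, z)) hf (m := fun _ => 1) (m' := fun _ => 0)
    (fun v => hasFDerivAt_const _ _) continuous_const (d := 0) (by simp) (by simp)
    (s := s) (by simpa using hs) hz
  refine ⟨_, h2, fun i => ?_, ?_⟩
  · rw [ContinuousLinearMap.integral_apply h1, rieszD, rieszInt, ← integral_const_mul]
    refine integral_congr_ae (ae_of_all _ fun y => ?_)
    simp [EuclideanSpace.inner_single_right]
    ring
  · rw [ContinuousLinearMap.integral_apply h1, rieszH, rieszInt, ← integral_const_mul]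
    refine integral_congr_ae (ae_of_all _ fun y => ?_)
    simp
    ring

lemma exists_hasFDerivAt_rieszD (hf : MemLp f 2 volume) (hz : 0 < z) (i : Fin 2)
    (hs : 3 / 2 ≤ s) :
    ∃ L : Plane × ℝ →L[ℝ] ℝ, HasFDerivAt (rieszD i f s) L (x, z) ∧
      L (EuclideanSpace.single i 1, 0) =
        rieszH f s (x, z) - 2 * s * rieszDD i f (s + 1) (x, z) := by
  obtain ⟨h1, h2⟩ := hasFDerivAt_rieszInt (p := (x, z)) hf (m := fun v => v i)
    (m' := fun _ => EuclideanSpace.proj i)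
    (fun v => (EuclideanSpace.proj i : Plane →L[ℝ] ℝ).hasFDerivAt) continuous_const (d := 1)
    (fun v => by simpa using abs_coord_le i v) (fun _ => norm_proj_le i)
    (s := s) (by norm_num; linarith) hz
  refine ⟨_, h2, ?_⟩
  rw [ContinuousLinearMap.integral_apply h1, rieszDD, rieszInt, ← integral_const_mul, rieszH,
    rieszInt, ← integral_sub]
  · refine integral_congr_ae (ae_of_all _ fun y => ?_)
    simp [EuclideanSpace.inner_single_right]
    ring
  · exact integrable_rieszInt hf continuous_const (d := 0) (by simp) (by simp; linarith) hz
  · exact (integrable_rieszInt hf (by fun_prop) (d := 2) (abs_sq_coord_le i)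
      (by norm_num; linarith) hz).const_mul _

/-- The squares of the coordinates add up to `|x - y|²`, which is the base minus `z²`. This is the
algebra by which the extension satisfies its differential equation. -/
lemma sum_rieszDD (hf : MemLp f 2 volume) (hz : 0 < z) (hs : 1 ≤ s) :
    ∑ i, rieszDD i f (s + 1) (x, z) = rieszH f s (x, z) - z ^ 2 * rieszH f (s + 1) (x, z) := by
  have hI : ∀ i : Fin 2, Integrable (fun y => (x - y) i ^ 2 * rieszKernel (s + 1) (x, z) y * f y)
      volume := fun i => integrable_rieszInt (m := fun v => v i ^ 2) (p := (x, z)) hf (by fun_prop)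
    (d := 2) (abs_sq_coord_le i) (by norm_num; linarith) hz
  simp only [rieszDD, rieszInt, rieszH]
  rw [← integral_finsetSum _ fun i _ => hI i, ← integral_const_mul, ← integral_sub]
  · refine integral_congr_ae (ae_of_all _ fun y => ?_)
    have h0 := base_pos (p := (x, z)) hz y
    have h1 : rieszKernel s (x, z) y = (‖x - y‖ ^ 2 + z ^ 2) * rieszKernel (s + 1) (x, z) y := by
      rw [rieszKernel, rieszKernel, show -s = 1 + -(s + 1) by ring, Real.rpow_add h0,
        Real.rpow_one]
    have h2 := EuclideanSpace.real_norm_sq_eq (x - y)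
    simp only [← Finset.sum_mul]
    rw [← h2, h1]
    ring
  · exact integrable_rieszInt hf continuous_const (d := 0) (by simp) (by simpa using hs) hz
  · exact (integrable_rieszInt hf continuous_const (d := 0) (by simp)
      (by simp; linarith) hz).const_mul _

lemma hasDerivAt_rieszH (hf : MemLp f 2 volume) (hz : 0 < z) (hs : 1 ≤ s) :
    HasDerivAt (fun z => rieszH f s (x, z)) (-(2 * s) * z * rieszH f (s + 1) (x, z)) z := by
  obtain ⟨L, h1, -, h2⟩ := exists_hasFDerivAt_rieszH (x := x) hf hz hs
  rw [← h2]
  have h3 : HasDerivAt (fun z : ℝ => ((x, z) : Plane × ℝ)) (0, 1) z :=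
    (hasDerivAt_const z x).prodMk (hasDerivAt_id z)
  exact h1.comp_hasDerivAt z h3

lemma hasFDerivAt_slice {g : Plane × ℝ → ℝ} {L : Plane × ℝ →L[ℝ] ℝ}
    (h : HasFDerivAt g L (x, z)) :
    HasFDerivAt (fun y => g (y, z)) (L.comp (ContinuousLinearMap.inl ℝ Plane ℝ)) x :=
  h.comp x (hasFDerivAt_prodMk_left x z)

lemma differentiableAt_rieszH (hf : MemLp f 2 volume) (hz : 0 < z) (hs : 1 ≤ s) :
    DifferentiableAt ℝ (fun y => rieszH f s (y, z)) x := by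
  obtain ⟨L, h1, -, -⟩ := exists_hasFDerivAt_rieszH (x := x) hf hz hs
  exact (hasFDerivAt_slice h1).differentiableAt

lemma partialDeriv_rieszH (hf : MemLp f 2 volume) (hz : 0 < z) (hs : 1 ≤ s) (i : Fin 2) :
    partialDeriv i (fun y => rieszH f s (y, z)) x = -(2 * s) * rieszD i f (s + 1) (x, z) := by
  obtain ⟨L, h1, h2, -⟩ := exists_hasFDerivAt_rieszH (x := x) hf hz hs
  rw [partialDeriv, (hasFDerivAt_slice h1).fderiv, ← h2]
  simp

lemma differentiableAt_rieszD (hf : MemLp f 2 volume) (hz : 0 < z) (hs : 3 / 2 ≤ s) (i : Fin 2) :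
    DifferentiableAt ℝ (fun y => rieszD i f s (y, z)) x := by
  obtain ⟨L, h1, -⟩ := exists_hasFDerivAt_rieszD (x := x) hf hz i hs
  exact (hasFDerivAt_slice h1).differentiableAt

lemma partialDeriv_rieszD (hf : MemLp f 2 volume) (hz : 0 < z) (hs : 3 / 2 ≤ s) (i : Fin 2) :
    partialDeriv i (fun y => rieszD i f s (y, z)) x =
      rieszH f s (x, z) - 2 * s * rieszDD i f (s + 1) (x, z) := by
  obtain ⟨L, h1, h2⟩ := exists_hasFDerivAt_rieszD (x := x) hf hz i hs
  rw [partialDeriv, (hasFDerivAt_slice h1).fderiv, ← h2]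
  simp

/-- The extension is a multiple of a Riesz type integral. -/
lemma extension_eq (α : ℝ) (f : Plane → ℝ) (x : Plane) (z : ℝ) :
    extension α f x z =
      α / (2 * Real.pi) * z ^ α * rieszH f (1 + α / 2) (x, z) := by
  rw [extension, rieszH, rieszInt, ← integral_const_mul]
  refine integral_congr_ae (ae_of_all _ fun y => ?_)
  simp only [poissonKernel, rieszKernel]
  rw [Real.rpow_neg (by positivity), show (2 + α) / 2 = 1 + α / 2 by ring]
  ring

end SQG

namespace SQG

/-! ### Superpositions of Gaussians as Fourier multipliers -/

/-- This is the multiplication formula `∫ φ̂ g = ∫ φ ĝ` for a modulated Gaussian `φ`, whose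
transform is a Gaussian centred at `x`. -/
lemma integral_gaussian_mul_eq {t : ℝ} (ht : 0 < t) (x : Plane) {g : Plane → ℂ}
    (hg : Integrable g volume) :
    ∫ y, (Real.exp (-(t * ‖x - y‖ ^ 2)) : ℂ) * g y =
      ∫ ξ, ((Real.pi / t * Real.exp (-(Real.pi ^ 2 * ‖ξ‖ ^ 2 / t)) : ℝ) : ℂ) *
        (Complex.exp (2 * Real.pi * Complex.I * (inner ℝ x ξ : ℝ)) * 𝓕 g ξ) := by
  have hpi := Real.pi_pos
  -- With this rate the transform of `φ` is `(t/π) exp(-t|x - w|²)`; the prefactor is then divided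
  -- out.
  set b : ℝ := Real.pi ^ 2 / t with hb
  have hbpos : 0 < b := by positivity
  have hbre : 0 < (b : ℂ).re := by simpa using hbpos
  set φ : Plane → ℂ := fun v =>
    Complex.exp (-(b : ℂ) * ‖v‖ ^ 2 + 2 * Real.pi * Complex.I * (inner ℝ x v : ℝ)) with hφ
  have hφi : Integrable φ volume :=
    GaussianFourier.integrable_cexp_neg_mul_sq_norm_add hbre _ x
  have key := VectorFourier.integral_fourierIntegral_smul_eq_flip (μ := volume) (ν := volume)
    (e := Real.fourierChar) (L := innerₗ Plane) (f := φ) (g := g)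
    Real.continuous_fourierChar (by exact continuous_inner) hφi hg
  have h1 : ∀ w, VectorFourier.fourierIntegral Real.fourierChar volume (innerₗ Plane) φ w =
      ((t / Real.pi : ℝ) : ℂ) * (Real.exp (-(t * ‖x - w‖ ^ 2)) : ℂ) := fun w => by
    have h2 := fourier_gaussian_innerProductSpace' (V := Plane) hbre x w
    have h3 : VectorFourier.fourierIntegral Real.fourierChar volume (innerₗ Plane) φ w =
      𝓕 φ w := rfl
    rw [h3, hφ, h2, finrank_plane]
    have hpi' : (Real.pi : ℂ) ≠ 0 := by exact_mod_cast hpi.ne'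
    have ht' : (t : ℂ) ≠ 0 := by exact_mod_cast ht.ne'
    congr 1
    · norm_num
      rw [hb]; push_cast; field_simp
    · rw [Complex.ofReal_exp]
      congr 1
      rw [hb]; push_cast; field_simp
  have h4 : ∀ ξ, VectorFourier.fourierIntegral Real.fourierChar volume (innerₗ Plane).flip g ξ =
      𝓕 g ξ := fun ξ => by
    rw [flip_innerₗ]; rfl
  simp only [h1, h4, smul_eq_mul, mul_assoc] at key
  rw [integral_const_mul] at key
  have h5 : ((Real.pi / t : ℝ) : ℂ) * ((t / Real.pi : ℝ) : ℂ) = 1 := by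
    rw [← Complex.ofReal_mul]; field_simp; simp
  calc _ = ((Real.pi / t : ℝ) : ℂ) * (((t / Real.pi : ℝ) : ℂ) *
        ∫ y, (Real.exp (-(t * ‖x - y‖ ^ 2)) : ℂ) * g y) := by rw [← mul_assoc, h5, one_mul]
    _ = _ := by
        rw [key, ← integral_const_mul]
        refine integral_congr_ae (ae_of_all _ fun ξ => ?_)
        simp only [hφ, Complex.exp_add, hb]
        push_cast
        rw [show -((Real.pi : ℂ) ^ 2 / t) * ‖ξ‖ ^ 2 = -(Real.pi ^ 2 * ‖ξ‖ ^ 2 / t) by ring]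
        ring

lemma norm_fourier_le (g : Plane → ℂ) (ξ : Plane) : ‖𝓕 g ξ‖ ≤ ∫ y, ‖g y‖ :=
  VectorFourier.norm_fourierIntegral_le_integral_norm Real.fourierChar volume (innerₗ Plane) g ξ

lemma continuous_fourier {g : Plane → ℂ} (hg : Integrable g volume) : Continuous (𝓕 g) :=
  VectorFourier.fourierIntegral_continuous Real.continuous_fourierChar
    (by exact continuous_inner) hg

lemma norm_cexp_two_pi_I (r : ℝ) : ‖Complex.exp (2 * Real.pi * Complex.I * r)‖ = 1 := by
  rw [show 2 * Real.pi * Complex.I * r = ((2 * Real.pi * r : ℝ) : ℂ) * Complex.I by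
    push_cast; ring, Complex.norm_exp_ofReal_mul_I]

/-- Fubini on both sides of the Gaussian formula. On the frequency side `(π/t) exp(-π²|ξ|²/t)` has
integral 1 in `ξ` for every `t`, so integrability of `a` suffices, the transform of `g` being
bounded. -/
lemma integral_superposition_mul_eq {a : ℝ → ℝ} (ham : Measurable a)
    (ha : IntegrableOn a (Ioi 0) volume) (x : Plane) {g : Plane → ℂ} (hg : Integrable g volume) :
    ∫ y, ((∫ t in Ioi (0 : ℝ), a t * Real.exp (-(t * ‖x - y‖ ^ 2)) : ℝ) : ℂ) * g y =
      ∫ ξ, ((∫ t in Ioi (0 : ℝ), a t * (Real.pi / t *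
          Real.exp (-(Real.pi ^ 2 * ‖ξ‖ ^ 2 / t))) : ℝ) : ℂ) *
        (Complex.exp (2 * Real.pi * Complex.I * (inner ℝ x ξ : ℝ)) * 𝓕 g ξ) := by
  have hpi := Real.pi_pos
  have hI1 : Integrable (Function.uncurry fun (y : Plane) (t : ℝ) =>
      ((a t * Real.exp (-(t * ‖x - y‖ ^ 2)) : ℝ) : ℂ) * g y)
      (volume.prod (volume.restrict (Ioi 0))) := by
    have h0 : Integrable (fun p : Plane × ℝ => g p.1 * ((a p.2 : ℝ) : ℂ))
        (volume.prod (volume.restrict (Ioi 0))) := hg.mul_prod ha.ofReal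
    refine h0.mono ?_ ?_
    · refine AEStronglyMeasurable.mul ?_ hg.1.comp_fst
      refine Measurable.aestronglyMeasurable ?_
      fun_prop
    · have : ∀ᵐ p : Plane × ℝ ∂(volume.prod (volume.restrict (Ioi (0:ℝ)))), 0 < p.2 := by
        refine Measure.ae_prod_iff_ae_ae ?_ |>.2 (ae_of_all _ fun y => ?_)
        · exact measurableSet_lt measurable_const measurable_snd
        · exact ae_restrict_mem measurableSet_Ioi
      filter_upwards [this] with p hp
      simp only [Function.uncurry, norm_mul, Complex.norm_real, Real.norm_eq_abs, Real.abs_exp]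
      have : Real.exp (-(p.2 * ‖x - p.1‖ ^ 2)) ≤ 1 := Real.exp_le_one_iff.2 (by
        have : 0 ≤ p.2 * ‖x - p.1‖ ^ 2 := by positivity
        linarith)
      rw [mul_comm ‖g p.1‖]
      gcongr
      exact mul_le_of_le_one_right (abs_nonneg _) this
  have hI2 : Integrable (Function.uncurry fun (ξ : Plane) (t : ℝ) =>
      ((a t * (Real.pi / t * Real.exp (-(Real.pi ^ 2 * ‖ξ‖ ^ 2 / t))) : ℝ) : ℂ) *
        (Complex.exp (2 * Real.pi * Complex.I * (inner ℝ x ξ : ℝ)) * 𝓕 g ξ))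
      (volume.prod (volume.restrict (Ioi 0))) := by
    have hgc := continuous_fourier hg
    have hG : Integrable (fun p : Plane × ℝ => a p.2 * (Real.pi / p.2 *
        Real.exp (-(Real.pi ^ 2 * ‖p.1‖ ^ 2 / p.2)))) (volume.prod (volume.restrict (Ioi 0))) := by
      have hgauss : ∀ t : ℝ, 0 < t → ∀ ξ : Plane, Real.exp (-(Real.pi ^ 2 * ‖ξ‖ ^ 2 / t)) =
          Real.exp (-(Real.pi ^ 2 / t) * ‖ξ‖ ^ 2) := fun t ht ξ => by congr 1; ring
      rw [integrable_prod_iff']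
      · constructor
        · filter_upwards [ae_restrict_mem measurableSet_Ioi] with t (ht : 0 < t)
          refine Integrable.const_mul (Integrable.const_mul ?_ _) _
          simp only [hgauss t ht]
          have hb : 0 < ((Real.pi ^ 2 / t : ℝ) : ℂ).re := by
            rw [Complex.ofReal_re]; positivity
          have := (GaussianFourier.integrable_cexp_neg_mul_sq_norm_add hb 0 (0 : Plane)).re
          refine this.congr (ae_of_all _ fun ξ => ?_)
          simp only [zero_mul, add_zero]
          rw [← Complex.ofReal_pow, ← Complex.ofReal_neg, ← Complex.ofReal_mul,
            ← Complex.ofReal_exp]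
          exact Complex.ofReal_re _
        · refine (ha.norm).congr ?_
          filter_upwards [ae_restrict_mem measurableSet_Ioi] with t (ht : 0 < t)
          simp only [norm_mul, Real.norm_eq_abs, Real.abs_exp]
          rw [integral_const_mul, integral_const_mul]
          simp only [hgauss t ht]
          rw [GaussianFourier.integral_rexp_neg_mul_sq_norm (by positivity), finrank_plane,
            abs_of_pos (by positivity : 0 < Real.pi / t)]
          norm_num
          field_simp
      · exact Measurable.aestronglyMeasurable (by fun_prop)
    refine (hG.norm.const_mul (∫ y, ‖g y‖)).mono' ?_ (ae_of_all _ fun p => ?_)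
    · refine Measurable.aestronglyMeasurable ?_
      have := hgc.measurable
      refine Measurable.mul (by fun_prop) (Measurable.mul ?_ (by fun_prop))
      exact Continuous.measurable (by fun_prop)
    · simp only [Function.uncurry, norm_mul, norm_cexp_two_pi_I, one_mul, Complex.norm_real]
      rw [mul_comm]
      gcongr
      exact norm_fourier_le g p.1
  calc _ = ∫ y, ∫ t in Ioi (0 : ℝ),
          ((a t * Real.exp (-(t * ‖x - y‖ ^ 2)) : ℝ) : ℂ) * g y := by
        refine integral_congr_ae (ae_of_all _ fun y => ?_)
        simp only
        rw [integral_mul_const, integral_complex_ofReal]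
    _ = ∫ t in Ioi (0 : ℝ), ∫ y, ((a t * Real.exp (-(t * ‖x - y‖ ^ 2)) : ℝ) : ℂ) * g y :=
        integral_integral_swap hI1
    _ = ∫ t in Ioi (0 : ℝ), ∫ ξ, ((a t * (Real.pi / t *
          Real.exp (-(Real.pi ^ 2 * ‖ξ‖ ^ 2 / t))) : ℝ) : ℂ) *
        (Complex.exp (2 * Real.pi * Complex.I * (inner ℝ x ξ : ℝ)) * 𝓕 g ξ) := by
        refine setIntegral_congr_fun measurableSet_Ioi fun t ht => ?_
        simp only [Complex.ofReal_mul (a t), mul_assoc (a t : ℂ)]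
        rw [integral_const_mul, integral_const_mul, integral_gaussian_mul_eq ht x hg]
    _ = _ := by
        rw [← integral_integral_swap hI2]
        refine integral_congr_ae (ae_of_all _ fun ξ => ?_)
        simp only
        rw [integral_mul_const, integral_complex_ofReal]

end SQG

namespace SQG

/-! ### The symbols of the Poisson kernel and of its conormal derivative -/

/-- The normalized Bessel type integral `Γ(ν)⁻¹ ∫₀^∞ t^(ν-1) exp(-t - r/t) dt`. -/
noncomputable def besselSymbol (ν r : ℝ) : ℝ :=
  (Real.Gamma ν)⁻¹ * ∫ t in Ioi (0 : ℝ), t ^ (ν - 1) * Real.exp (-t - r / t)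

lemma integrableOn_rpow_mul_exp {ν : ℝ} (hν : 0 < ν) {w : ℝ} (hw : 0 < w) :
    IntegrableOn (fun t : ℝ => t ^ (ν - 1) * Real.exp (-(w * t))) (Ioi 0) volume := by
  have := integrableOn_rpow_mul_exp_neg_mul_rpow (p := 1) (s := ν - 1) (b := w)
    (by linarith) one_pos hw
  refine this.congr_fun (fun t _ => ?_) measurableSet_Ioi
  simp [Real.rpow_one]

lemma exp_sub_div_le {r t : ℝ} (hr : 0 ≤ r) (ht : 0 < t) :
    Real.exp (-t - r / t) ≤ Real.exp (-(1 * t)) := by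
  apply Real.exp_le_exp.2
  have : 0 ≤ r / t := by positivity
  linarith

lemma besselSymbol_nonneg {ν : ℝ} (hν : 0 < ν) (r : ℝ) : 0 ≤ besselSymbol ν r := by
  refine mul_nonneg (inv_nonneg.2 (Real.Gamma_pos_of_pos hν).le) ?_
  refine setIntegral_nonneg measurableSet_Ioi fun t (ht : 0 < t) => ?_
  positivity

lemma integral_rpow_mul_exp_neg {ν : ℝ} (hν : 0 < ν) {w : ℝ} (hw : 0 < w) :
    ∫ t in Ioi (0 : ℝ), t ^ (ν - 1) * Real.exp (-(w * t)) = w ^ (-ν) * Real.Gamma ν := by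
  rw [Real.integral_rpow_mul_exp_neg_mul_Ioi hν hw, one_div, Real.inv_rpow hw.le,
    Real.rpow_neg hw.le]

lemma besselSymbol_le_one {ν : ℝ} (hν : 0 < ν) {r : ℝ} (hr : 0 ≤ r) : besselSymbol ν r ≤ 1 := by
  have hG := Real.Gamma_pos_of_pos hν
  rw [besselSymbol, inv_mul_le_iff₀ hG, mul_one]
  calc _ ≤ ∫ t in Ioi (0 : ℝ), t ^ (ν - 1) * Real.exp (-(1 * t)) := by
        refine setIntegral_mono_on₀ ?_ (integrableOn_rpow_mul_exp hν one_pos)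
          measurableSet_Ioi.nullMeasurableSet fun t (ht : 0 < t) => ?_
        · refine (integrableOn_rpow_mul_exp hν one_pos).mono' (by
            refine Measurable.aestronglyMeasurable ?_
            fun_prop) ?_
          filter_upwards [ae_restrict_mem measurableSet_Ioi] with t (ht : 0 < t)
          rw [Real.norm_of_nonneg (by positivity)]
          exact mul_le_mul_of_nonneg_left (exp_sub_div_le hr ht) (by positivity)
        · exact mul_le_mul_of_nonneg_left (exp_sub_div_le hr ht) (by positivity)
    _ = _ := by rw [integral_rpow_mul_exp_neg hν one_pos]; simp

lemma tendsto_besselSymbol {ν : ℝ} (hν : 0 < ν) :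
    Tendsto (besselSymbol ν) (𝓝[≥] 0) (𝓝 1) := by
  have hG := Real.Gamma_pos_of_pos hν
  have h1 : Tendsto (fun r => ∫ t in Ioi (0 : ℝ), t ^ (ν - 1) * Real.exp (-t - r / t)) (𝓝[≥] 0)
      (𝓝 (∫ t in Ioi (0 : ℝ), t ^ (ν - 1) * Real.exp (-(1 * t)))) := by
    refine tendsto_integral_filter_of_dominated_convergence
      (fun t => t ^ (ν - 1) * Real.exp (-(1 * t))) ?_ ?_ (integrableOn_rpow_mul_exp hν one_pos) ?_
    · exact Eventually.of_forall fun r => Measurable.aestronglyMeasurable (by fun_prop)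
    · filter_upwards [self_mem_nhdsWithin] with r hr
      filter_upwards [ae_restrict_mem measurableSet_Ioi] with t (ht : 0 < t)
      rw [Real.norm_of_nonneg (by positivity)]
      exact mul_le_mul_of_nonneg_left (exp_sub_div_le hr ht) (by positivity)
    · refine ae_of_all _ fun t => ?_
      have : Continuous fun r : ℝ => t ^ (ν - 1) * Real.exp (-t - r / t) := by fun_prop
      have h := (this.tendsto 0).mono_left (nhdsWithin_le_nhds (s := Ici 0))
      simpa using h
  rw [integral_rpow_mul_exp_neg hν one_pos, Real.one_rpow, one_mul] at h1
  have := h1.const_mul (Real.Gamma ν)⁻¹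
  rwa [inv_mul_cancel₀ hG.ne'] at this

lemma measurable_besselSymbol (ν : ℝ) : Measurable (besselSymbol ν) := by
  unfold besselSymbol
  refine Measurable.const_mul ?_ _
  have : StronglyMeasurable (fun p : ℝ × ℝ => p.2 ^ (ν - 1) * Real.exp (-p.2 - p.1 / p.2)) :=
    Measurable.stronglyMeasurable (by fun_prop)
  exact (this.integral_prod_right' (ν := volume.restrict (Ioi 0))).measurable

/-- The Gamma integral with rate `|v|² + z²`: splitting the exponential displays the kernel as a
superposition of Gaussians in `v`. -/
lemma rpow_neg_eq_integral {s : ℝ} (hs : 0 < s) {z : ℝ} (hz : 0 < z) (v : Plane) :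
    (‖v‖ ^ 2 + z ^ 2) ^ (-s) = ∫ t in Ioi (0 : ℝ),
      (Real.Gamma s)⁻¹ * (t ^ (s - 1) * Real.exp (-(z ^ 2 * t))) * Real.exp (-(t * ‖v‖ ^ 2)) := by
  have hG := Real.Gamma_pos_of_pos hs
  have hq : 0 < ‖v‖ ^ 2 + z ^ 2 := by positivity
  have := integral_rpow_mul_exp_neg hs hq
  calc _ = (Real.Gamma s)⁻¹ * ((‖v‖ ^ 2 + z ^ 2) ^ (-s) * Real.Gamma s) := by
        field_simp
    _ = _ := by
        rw [← this, ← integral_const_mul]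
        refine integral_congr_ae (ae_of_all _ fun t => ?_)
        simp only
        rw [show -((‖v‖ ^ 2 + z ^ 2) * t) = -(z ^ 2 * t) + -(t * ‖v‖ ^ 2) by ring, Real.exp_add]
        ring

/-- The symbol of the Poisson kernel. -/
lemma integral_poisson_symbol {α : ℝ} (hα : 0 < α) {z : ℝ} (hz : 0 < z) (κ : ℝ) :
    ∫ t in Ioi (0 : ℝ), (α / (2 * Real.pi) * z ^ α * ((Real.Gamma (1 + α / 2))⁻¹ *
      (t ^ (1 + α / 2 - 1) * Real.exp (-(z ^ 2 * t))))) * (Real.pi / t * Real.exp (-(κ / t))) =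
      besselSymbol (α / 2) (κ * z ^ 2) := by
  have hpi := Real.pi_pos
  have hG := Real.Gamma_pos_of_pos (half_pos hα)
  have hG1 : Real.Gamma (1 + α / 2) = α / 2 * Real.Gamma (α / 2) := by
    rw [add_comm, Real.Gamma_add_one (by positivity)]
  set g : ℝ → ℝ := fun t => t ^ (α / 2 - 1) * Real.exp (-t - κ * z ^ 2 / t)
  have hz2 : 0 < z ^ 2 := by positivity
  have h1 := integral_comp_mul_left_Ioi g 0 hz2
  rw [mul_zero] at h1
  -- The scaling `t ↦ z² t` moves all dependence on `z` into the argument `κ z²` of the Bessel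
  -- integral.
  have h2 : ∫ t in Ioi (0 : ℝ), g t = z ^ 2 * ∫ t in Ioi (0 : ℝ), g (z ^ 2 * t) := by
    rw [h1, smul_eq_mul]; field_simp
  rw [besselSymbol, h2, ← integral_const_mul, ← integral_const_mul]
  refine setIntegral_congr_fun measurableSet_Ioi fun t (ht : 0 < t) => ?_
  simp only [g]
  have e1 : -(z ^ 2 * t) - κ * z ^ 2 / (z ^ 2 * t) = -(z ^ 2 * t) + -(κ / t) := by
    field_simp; ring
  have e2 : (z ^ 2 * t) ^ (α / 2 - 1) = z ^ α * (z ^ 2)⁻¹ * (t ^ (α / 2) * t⁻¹) := by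
    rw [Real.mul_rpow hz2.le ht.le, Real.rpow_sub_one hz2.ne', Real.rpow_sub_one ht.ne',
      ← Real.rpow_natCast, ← Real.rpow_mul hz.le]
    norm_num
    rw [show 2 * (α / 2) = α by ring]
    ring
  rw [e1, e2, hG1, Real.exp_add, show 1 + α / 2 - 1 = α / 2 by ring]
  field_simp

/-- This is the substitution `t ↦ κ/t`, carried out as an inversion followed by a scaling. It
exchanges the roles of the two exponentials and produces the order `1 - α/2`. -/
lemma integral_bessel_inversion {α : ℝ} {z κ : ℝ} (hκ : 0 < κ) :
    ∫ t in Ioi (0 : ℝ), t ^ (α / 2) * Real.exp (-(z ^ 2 * t)) *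
      (κ / t ^ 2 * Real.exp (-(κ / t))) =
      κ ^ (α / 2) * ∫ t in Ioi (0 : ℝ), t ^ (1 - α / 2 - 1) * Real.exp (-t - κ * z ^ 2 / t) := by
  set g : ℝ → ℝ := fun t => t ^ (α / 2) * Real.exp (-(z ^ 2 * t)) *
      (κ / t ^ 2 * Real.exp (-(κ / t)))
  set h : ℝ → ℝ := fun t => t ^ (1 - α / 2 - 1) * Real.exp (-t - κ * z ^ 2 / t)
  have h1 := integral_comp_rpow_Ioi g (p := -1) (by norm_num)
  have h2 := integral_comp_mul_left_Ioi h 0 hκ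
  rw [mul_zero] at h2
  have h3 : ∫ t in Ioi (0 : ℝ), h t = κ * ∫ t in Ioi (0 : ℝ), h (κ * t) := by
    rw [h2, smul_eq_mul]; field_simp
  rw [← h1, h3, ← mul_assoc, ← integral_const_mul]
  refine setIntegral_congr_fun measurableSet_Ioi fun t (ht : 0 < t) => ?_
  simp only [g, h, smul_eq_mul, Real.rpow_neg_one]
  have e1 : -(κ * t) - κ * z ^ 2 / (κ * t) = -(z ^ 2 * t⁻¹) + -(κ / t⁻¹) := by
    field_simp; ring
  have e2 : (κ * t) ^ (1 - α / 2 - 1) = (κ ^ (α / 2))⁻¹ * t⁻¹ ^ (α / 2) := by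
    rw [Real.mul_rpow hκ.le ht.le, show 1 - α / 2 - 1 = -(α / 2) by ring, Real.rpow_neg hκ.le,
      Real.rpow_neg ht.le, Real.inv_rpow ht.le]
  have e3 : t ^ (-1 - 1 : ℝ) = (t ^ 2)⁻¹ := by
    rw [show (-1 - 1 : ℝ) = -(2 : ℕ) by norm_num, Real.rpow_neg ht.le, Real.rpow_natCast]
  have e4 : κ ^ (α / 2) ≠ 0 := (Real.rpow_pos_of_pos hκ _).ne'
  rw [e1, e2, e3, Real.exp_add]
  norm_num
  field_simp

/-- The symbol of the conormal derivative of the Poisson kernel. -/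
lemma integral_conormal_symbol {α : ℝ} (hα : 0 < α) (hα2 : α < 2) {z : ℝ} (hz : 0 < z) {κ : ℝ}
    (hκ : 0 ≤ κ) :
    ∫ t in Ioi (0 : ℝ), (2 ^ (α - 1) * Real.Gamma (α / 2) / Real.Gamma (1 - α / 2) *
      (α / (2 * Real.pi)) * (Real.Gamma (1 + α / 2))⁻¹ *
      ((α * t ^ (α / 2) - 2 * z ^ 2 * t ^ (1 + α / 2)) * Real.exp (-(z ^ 2 * t)))) *
        (Real.pi / t * Real.exp (-(κ / t))) =
      -((4 * κ) ^ (α / 2) * besselSymbol (1 - α / 2) (κ * z ^ 2)) := by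
  have hpi := Real.pi_pos
  have hG := Real.Gamma_pos_of_pos (half_pos hα)
  have hG2 : 0 < Real.Gamma (1 - α / 2) := Real.Gamma_pos_of_pos (by linarith)
  have hG1 : Real.Gamma (1 + α / 2) = α / 2 * Real.Gamma (α / 2) := by
    rw [add_comm, Real.Gamma_add_one (by positivity)]
  have hz2 : 0 < z ^ 2 := by positivity
  -- Up to a constant the integrand is `u v'`: differentiating `t^(α/2) exp(-z² t)` reproduces the
  -- difference of powers. Integration by parts moves the derivative to `exp(-κ/t)`, after which the
  -- inversion formula applies.
  set u : ℝ → ℝ := fun t => Real.exp (-(κ / t))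
  set u' : ℝ → ℝ := fun t => κ / t ^ 2 * Real.exp (-(κ / t))
  set v : ℝ → ℝ := fun t => t ^ (α / 2) * Real.exp (-(z ^ 2 * t))
  set v' : ℝ → ℝ := fun t => (α / 2 * t ^ (α / 2 - 1) - z ^ 2 * t ^ (α / 2)) *
    Real.exp (-(z ^ 2 * t))
  have hu : ∀ t ∈ Ioi (0 : ℝ), HasDerivAt u (u' t) t := fun t (ht : 0 < t) => by
    have h1 : HasDerivAt (fun t : ℝ => -(κ / t)) (κ / t ^ 2) t := by
      have h0 : HasDerivAt (fun t : ℝ => -(κ * t⁻¹)) (-(κ * -(t ^ 2)⁻¹)) t :=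
        ((hasDerivAt_inv ht.ne').const_mul κ).neg
      simpa [div_eq_mul_inv] using h0
    have := h1.exp
    rwa [mul_comm] at this
  have hv : ∀ t ∈ Ioi (0 : ℝ), HasDerivAt v (v' t) t := fun t (ht : 0 < t) => by
    have h1 : HasDerivAt (fun t : ℝ => -(z ^ 2 * t)) (-(z ^ 2)) t := by
      have h0 : HasDerivAt (fun t : ℝ => -(z ^ 2 * t)) (-(z ^ 2 * 1)) t :=
        ((hasDerivAt_id t).const_mul (z ^ 2)).neg
      simpa using h0
    refine ((Real.hasDerivAt_rpow_const (p := α / 2) (Or.inl ht.ne')).mul h1.exp).congr_deriv ?_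
    simp only [v']; ring
  have hu1 : ∀ t : ℝ, 0 < t → u t ≤ 1 := fun t ht => Real.exp_le_one_iff.2 (by
    have : 0 ≤ κ / t := by positivity
    linarith)
  have hv'i : IntegrableOn v' (Ioi 0) volume := by
    have h1 := ((integrableOn_rpow_mul_exp (half_pos hα) hz2).const_mul (α / 2)).sub
      ((integrableOn_rpow_mul_exp (ν := α / 2 + 1) (by linarith) hz2).const_mul (z ^ 2))
    refine Integrable.congr h1 (ae_of_all _ fun t => ?_)
    simp only [v', Pi.sub_apply, add_sub_cancel_right]
    ring
  have huv' : IntegrableOn (u * v') (Ioi 0) volume := by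
    refine Integrable.mono' hv'i.norm ?_ ?_
    · exact Measurable.aestronglyMeasurable (by fun_prop)
    · filter_upwards [ae_restrict_mem measurableSet_Ioi] with t (ht : 0 < t)
      rw [Pi.mul_apply, norm_mul]
      refine mul_le_of_le_one_left (norm_nonneg _) ?_
      rw [Real.norm_of_nonneg (Real.exp_pos _).le]
      exact hu1 t ht
  have hu'v : IntegrableOn (u' * v) (Ioi 0) volume := by
    -- At frequency zero `u'` vanishes identically, and the bound by a multiple of `1/κ` is not
    -- available.
    rcases hκ.eq_or_lt with h0 | h0
    · have : u' * v = fun _ => 0 := by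
        ext t; simp [u', ← h0]
      rw [this]; exact integrableOn_zero
    · have hI : IntegrableOn (fun t : ℝ => 4 / κ * (t ^ (α / 2 + 1 - 1) *
          Real.exp (-(z ^ 2 * t)))) (Ioi 0) volume :=
        (integrableOn_rpow_mul_exp (by linarith) hz2).const_mul _
      refine Integrable.mono' hI ?_ ?_
      · exact Measurable.aestronglyMeasurable (by fun_prop)
      · filter_upwards [ae_restrict_mem measurableSet_Ioi] with t (ht : 0 < t)
        simp only [Pi.mul_apply, u', v, add_sub_cancel_right]
        rw [Real.norm_of_nonneg (by positivity)]
        refine mul_le_mul_of_nonneg_right ?_ (by positivity)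
        -- The bound `(κ/t²) exp(-κ/t) ≤ 4/κ` follows from `exp y ≥ y²/2` at `y = κ/t`.
        rw [Real.exp_neg, ← div_eq_mul_inv, div_div, div_le_div_iff₀ (by positivity) h0]
        have h2 := Real.quadratic_le_exp_of_nonneg (x := κ / t) (by positivity)
        have h3 : (κ / t) ^ 2 / 2 ≤ Real.exp (κ / t) := by
          have : 0 ≤ κ / t := by positivity
          linarith
        calc κ * κ = 2 * t ^ 2 * ((κ / t) ^ 2 / 2) := by field_simp
          _ ≤ 2 * t ^ 2 * Real.exp (κ / t) := by gcongr
          _ ≤ 4 * (t ^ 2 * Real.exp (κ / t)) := by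
            have : 0 ≤ t ^ 2 * Real.exp (κ / t) := by positivity
            linarith
  have hbd : ∀ᶠ t : ℝ in 𝓝[>] 0, ‖(u * v) t‖ ≤ t ^ (α / 2) := by
    filter_upwards [self_mem_nhdsWithin] with t (ht : 0 < t)
    rw [Pi.mul_apply, Real.norm_of_nonneg (by positivity)]
    have h1 : Real.exp (-(z ^ 2 * t)) ≤ 1 := Real.exp_le_one_iff.2 (by
      have : 0 ≤ z ^ 2 * t := by positivity
      linarith)
    calc u t * v t ≤ 1 * (t ^ (α / 2) * 1) := by
          apply mul_le_mul (hu1 t ht) _ (by positivity) zero_le_one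
          exact mul_le_mul_of_nonneg_left h1 (by positivity)
      _ = _ := by ring
  have hz0 : Tendsto (u * v) (𝓝[>] 0) (𝓝 0) := by
    refine squeeze_zero_norm' hbd ?_
    have := (Real.continuousAt_rpow_const 0 (α / 2) (Or.inr (by positivity))).tendsto
    rw [Real.zero_rpow (by positivity)] at this
    exact this.mono_left nhdsWithin_le_nhds
  have hzt : Tendsto (u * v) atTop (𝓝 0) := by
    have h1 := tendsto_rpow_mul_exp_neg_mul_atTop_nhds_zero (α / 2) (z ^ 2) hz2
    refine squeeze_zero_norm' ?_ h1
    filter_upwards [eventually_gt_atTop 0] with t ht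
    rw [Pi.mul_apply, Real.norm_of_nonneg (by positivity), neg_mul]
    exact mul_le_of_le_one_left (by positivity) (hu1 t ht)
  have hibp := integral_Ioi_mul_deriv_eq_deriv_mul hu hv huv' hu'v hz0 hzt
  have hmain : ∫ t in Ioi (0 : ℝ), u' t * v t = κ ^ (α / 2) * Real.Gamma (1 - α / 2) *
      besselSymbol (1 - α / 2) (κ * z ^ 2) := by
    rcases hκ.eq_or_lt with h0 | h0
    · simp [u', ← h0, Real.zero_rpow (by positivity : α / 2 ≠ 0)]
    · have := integral_bessel_inversion (α := α) (z := z) h0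
      rw [besselSymbol]
      rw [mul_assoc, mul_inv_cancel_left₀ hG2.ne', ← this]
      refine integral_congr_ae (ae_of_all _ fun t => ?_)
      simp only [u', v]; ring
  have h4 : (4 * κ) ^ (α / 2) = 2 ^ α * κ ^ (α / 2) := by
    rw [Real.mul_rpow (by norm_num) hκ, show (4 : ℝ) = 2 ^ (2 : ℕ) by norm_num,
      ← Real.rpow_natCast, ← Real.rpow_mul (by norm_num)]
    congr 2; push_cast; ring
  have h2 : (2 : ℝ) ^ α = 2 * 2 ^ (α - 1) := by
    rw [Real.rpow_sub_one two_ne_zero]; ring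
  calc _ = ∫ t in Ioi (0 : ℝ), (2 ^ α / Real.Gamma (1 - α / 2)) * (u t * v' t) := by
        refine setIntegral_congr_fun measurableSet_Ioi fun t (ht : 0 < t) => ?_
        simp only [u, v']
        rw [hG1, h2, Real.rpow_sub_one ht.ne', Real.rpow_add ht, Real.rpow_one]
        field_simp
    _ = _ := by
        rw [integral_const_mul, hibp, hmain, h4]
        generalize Real.Gamma (1 - α / 2) = G at hG2 ⊢
        field_simp
        ring

end SQG

namespace SQG

/-! ### The conormal derivative of the extension -/

/-- The normalizing constant `c_α`. -/
noncomputable def normConst (α : ℝ) : ℝ :=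
  2 ^ (α - 1) * Real.Gamma (α / 2) / Real.Gamma (1 - α / 2)

lemma normConst_pos {α : ℝ} (hα : 0 < α) (hα2 : α < 2) : 0 < normConst α := by
  have h1 := Real.Gamma_pos_of_pos (half_pos hα)
  have h2 : 0 < Real.Gamma (1 - α / 2) := Real.Gamma_pos_of_pos (by linarith)
  unfold normConst; positivity

lemma weight_eq (α z : ℝ) : weight α z = normConst α * z ^ (1 - α) := rfl

lemma weight_pos {α z : ℝ} (hα : 0 < α) (hα2 : α < 2) (hz : 0 < z) : 0 < weight α z :=
  mul_pos (normConst_pos hα hα2) (Real.rpow_pos_of_pos hz _)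

/-- The conormal derivative `c_α z^b ∂_z (L f)` in closed form. -/
noncomputable def conormal (α : ℝ) (f : Plane → ℝ) (p : Plane × ℝ) : ℝ :=
  normConst α * (α / (2 * Real.pi)) *
    (α * rieszH f (1 + α / 2) p - (2 + α) * p.2 ^ 2 * rieszH f (2 + α / 2) p)

lemma conormal_eq_integral {α : ℝ} (hα : 0 < α) {f : Plane → ℝ} (hf : MemLp f 2 volume)
    {x : Plane} {z : ℝ} (hz : 0 < z) :
    conormal α f (x, z) = ∫ y, (normConst α * (α / (2 * Real.pi)) *
      (α * rieszKernel (1 + α / 2) (x, z) y -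
        (2 + α) * z ^ 2 * rieszKernel (2 + α / 2) (x, z) y)) * f y := by
  have h1 := integrable_rieszInt hf (m := fun _ => 1) (p := (x, z)) continuous_const (d := 0)
    (by simp) (s := 1 + α / 2) (by simp; linarith) hz
  have h2 := integrable_rieszInt hf (m := fun _ => 1) (p := (x, z)) continuous_const (d := 0)
    (by simp) (s := 2 + α / 2) (by simp; linarith) hz
  rw [conormal, rieszH, rieszH, rieszInt, rieszInt, ← integral_const_mul, ← integral_const_mul,
    ← integral_sub (h1.const_mul _) (h2.const_mul _), ← integral_const_mul]
  refine integral_congr_ae (ae_of_all _ fun y => ?_)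
  simp only
  ring

/-- Justifies the closed form of `conormal`: the factor `z^(1-α)` cancels the fractional powers
produced by differentiating `z^α`, leaving only an even power of `z`. -/
lemma hasDerivAt_extension {α : ℝ} (hα : 0 < α) (hα2 : α < 2) {f : Plane → ℝ}
    (hf : MemLp f 2 volume) {x : Plane} {z : ℝ} (hz : 0 < z) :
    HasDerivAt (fun w => extension α f x w) (conormal α f (x, z) / weight α z) z := by
  have hc := normConst_pos hα hα2
  have h1 : HasDerivAt (fun w : ℝ => α / (2 * Real.pi) * w ^ α * rieszH f (1 + α / 2) (x, w))
      _ z := (((Real.hasDerivAt_rpow_const (p := α) (Or.inl hz.ne')).const_mul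
        (α / (2 * Real.pi))).mul
      (hasDerivAt_rieszH (x := x) hf hz (s := 1 + α / 2) (by linarith)))
  simp only [← extension_eq] at h1
  refine h1.congr_deriv ?_
  have hza : 0 < z ^ α := Real.rpow_pos_of_pos hz _
  rw [conormal, weight_eq, Real.rpow_sub hz, Real.rpow_sub hz, Real.rpow_one,
    show (1 : ℝ) + α / 2 + 1 = 2 + α / 2 by ring]
  field_simp
  ring

lemma hasDerivAt_conormal {α : ℝ} (hα : 0 < α) {f : Plane → ℝ}
    (hf : MemLp f 2 volume) {x : Plane} {z : ℝ} (hz : 0 < z) :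
    HasDerivAt (fun w => conormal α f (x, w))
      (-(normConst α * (α / (2 * Real.pi)) * z *
        ((2 + α) ^ 2 * rieszH f (2 + α / 2) (x, z) -
          (2 + α) * (4 + α) * z ^ 2 * rieszH f (3 + α / 2) (x, z)))) z := by
  have h1 := hasDerivAt_rieszH (x := x) hf hz (s := 1 + α / 2) (by linarith)
  have h2 := hasDerivAt_rieszH (x := x) hf hz (s := 2 + α / 2) (by linarith)
  have h3 := (hasDerivAt_pow 2 z).const_mul (2 + α)
  have h4 := ((h1.const_mul α).sub (h3.mul h2)).const_mul (normConst α * (α / (2 * Real.pi)))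
  refine h4.congr_deriv ?_
  rw [show (1 : ℝ) + α / 2 + 1 = 2 + α / 2 by ring, show (2 : ℝ) + α / 2 + 1 = 3 + α / 2 by ring]
  push_cast
  ring

/-! ### Fourier representation for nice functions -/

lemma rpow_symbol (α : ℝ) (ξ : Plane) :
    (4 * (Real.pi ^ 2 * ‖ξ‖ ^ 2)) ^ (α / 2) = (2 * Real.pi * ‖ξ‖) ^ α := by
  have hpi := Real.pi_pos
  rw [show 4 * (Real.pi ^ 2 * ‖ξ‖ ^ 2) = (2 * Real.pi * ‖ξ‖) ^ (2 : ℕ) by ring,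
    ← Real.rpow_natCast, ← Real.rpow_mul (by positivity)]
  congr 1; push_cast; ring

/-- Both kernels in the closed form are superpositions of Gaussians, and `Γ(2 + α/2) = (1 + α/2) Γ(1
+ α/2)` combines them into the single density `a`. Its transform is the conormal symbol at `κ =
π²|ξ|²`. -/
lemma conormal_fourier {α : ℝ} (hα : 0 < α) (hα2 : α < 2) {g : Plane → ℝ}
    (hg2 : MemLp g 2 volume) (hg : Integrable g volume) (x : Plane) {z : ℝ} (hz : 0 < z) :
    ((conormal α g (x, z) : ℝ) : ℂ) =
      ∫ ξ, ((-((2 * Real.pi * ‖ξ‖) ^ α *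
        besselSymbol (1 - α / 2) (Real.pi ^ 2 * ‖ξ‖ ^ 2 * z ^ 2)) : ℝ) : ℂ) *
        (Complex.exp (2 * Real.pi * Complex.I * (inner ℝ x ξ : ℝ)) *
          𝓕 (fun y => (g y : ℂ)) ξ) := by
  have hz2 : 0 < z ^ 2 := by positivity
  set C : ℝ := normConst α * (α / (2 * Real.pi)) * (Real.Gamma (1 + α / 2))⁻¹ with hC
  set a : ℝ → ℝ := fun t => C * ((α * t ^ (α / 2) - 2 * z ^ 2 * t ^ (1 + α / 2)) *
    Real.exp (-(z ^ 2 * t))) with ha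
  have ham : Measurable a := by fun_prop
  have hai : IntegrableOn a (Ioi 0) volume := by
    refine Integrable.const_mul ?_ C
    have h1 := ((integrableOn_rpow_mul_exp (ν := α / 2 + 1) (by linarith) hz2).const_mul α).sub
      ((integrableOn_rpow_mul_exp (ν := 1 + α / 2 + 1) (by linarith) hz2).const_mul (2 * z ^ 2))
    refine Integrable.congr h1 (ae_of_all _ fun t => ?_)
    simp only [Pi.sub_apply, add_sub_cancel_right]
    ring
  have key := integral_superposition_mul_eq ham hai x (g := fun y => (g y : ℂ)) hg.ofReal
  have hsymb : ∀ ξ : Plane, ∫ t in Ioi (0 : ℝ), a t * (Real.pi / t *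
          Real.exp (-(Real.pi ^ 2 * ‖ξ‖ ^ 2 / t))) = -((2 * Real.pi * ‖ξ‖) ^ α *
        besselSymbol (1 - α / 2) (Real.pi ^ 2 * ‖ξ‖ ^ 2 * z ^ 2)) := fun ξ => by
    rw [← rpow_symbol, ← integral_conormal_symbol hα hα2 hz (by positivity)]
    rfl
  simp only [hsymb] at key
  rw [← key, conormal_eq_integral hα hg2 hz, ← integral_complex_ofReal]
  refine integral_congr_ae (ae_of_all _ fun y => ?_)
  simp only
  rw [Complex.ofReal_mul]
  congr 2
  have hs1 : (0 : ℝ) < 1 + α / 2 := by linarith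
  have hG := Real.Gamma_pos_of_pos hs1
  have hs2 : (0 : ℝ) < 2 + α / 2 := by linarith
  have hG2 : Real.Gamma (2 + α / 2) = (1 + α / 2) * Real.Gamma (1 + α / 2) := by
    rw [← Real.Gamma_add_one hs1.ne']; congr 1; ring
  have e1 := rpow_neg_eq_integral hs1 hz (x - y)
  have e2 := rpow_neg_eq_integral hs2 hz (x - y)
  have hI : ∀ s : ℝ, 0 < s → IntegrableOn (fun t : ℝ => (Real.Gamma s)⁻¹ *
      (t ^ (s - 1) * Real.exp (-(z ^ 2 * t))) * Real.exp (-(t * ‖x - y‖ ^ 2))) (Ioi 0) volume :=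
    fun s hs => by
      have := (integrableOn_rpow_mul_exp hs (w := ‖x - y‖ ^ 2 + z ^ 2) (by positivity)).const_mul
        (Real.Gamma s)⁻¹
      refine this.congr (ae_of_all _ fun t => ?_)
      simp only
      rw [show -((‖x - y‖ ^ 2 + z ^ 2) * t) = -(z ^ 2 * t) + -(t * ‖x - y‖ ^ 2) by ring,
        Real.exp_add]
      ring
  simp only [rieszKernel]
  rw [e1, e2, ← integral_const_mul, ← integral_const_mul,
    ← integral_sub ((hI _ hs1).const_mul _) ((hI _ hs2).const_mul _), ← integral_const_mul]
  refine integral_congr_ae (ae_of_all _ fun t => ?_)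
  simp only [ha, hC]
  rw [hG2, show (2 : ℝ) + α / 2 - 1 = 1 + α / 2 by ring, show (1 : ℝ) + α / 2 - 1 = α / 2 by ring]
  field_simp

lemma extension_fourier {α : ℝ} (hα : 0 < α) {g : Plane → ℝ}
    (hg : Integrable g volume) (x : Plane) {z : ℝ} (hz : 0 < z) :
    ((extension α g x z : ℝ) : ℂ) =
      ∫ ξ, ((besselSymbol (α / 2) (Real.pi ^ 2 * ‖ξ‖ ^ 2 * z ^ 2) : ℝ) : ℂ) *
        (Complex.exp (2 * Real.pi * Complex.I * (inner ℝ x ξ : ℝ)) *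
          𝓕 (fun y => (g y : ℂ)) ξ) := by
  have hz2 : 0 < z ^ 2 := by positivity
  have hs1 : (0 : ℝ) < 1 + α / 2 := by linarith
  set a : ℝ → ℝ := fun t => α / (2 * Real.pi) * z ^ α * ((Real.Gamma (1 + α / 2))⁻¹ *
      (t ^ (1 + α / 2 - 1) * Real.exp (-(z ^ 2 * t)))) with ha
  have ham : Measurable a := by fun_prop
  have hai : IntegrableOn a (Ioi 0) volume :=
    ((integrableOn_rpow_mul_exp hs1 hz2).const_mul _).const_mul _
  have key := integral_superposition_mul_eq ham hai x (g := fun y => (g y : ℂ)) hg.ofReal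
  have hsymb : ∀ ξ : Plane, ∫ t in Ioi (0 : ℝ), a t * (Real.pi / t *
          Real.exp (-(Real.pi ^ 2 * ‖ξ‖ ^ 2 / t))) =
        besselSymbol (α / 2) (Real.pi ^ 2 * ‖ξ‖ ^ 2 * z ^ 2) := fun ξ =>
    integral_poisson_symbol hα hz _
  simp only [hsymb] at key
  rw [← key, extension, ← integral_complex_ofReal]
  refine integral_congr_ae (ae_of_all _ fun y => ?_)
  simp only
  rw [Complex.ofReal_mul]
  congr 2
  have e1 := rpow_neg_eq_integral hs1 hz (x - y)
  rw [poissonKernel, show (2 + α) / 2 = 1 + α / 2 by ring, div_eq_mul_inv,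
    ← Real.rpow_neg (by positivity), e1, ← integral_const_mul]
  refine integral_congr_ae (ae_of_all _ fun t => ?_)
  simp only [ha]
  ring

/-! ### Boundary limits for smooth compactly supported functions -/

section Nice

variable {g : Plane → ℝ}

lemma exists_schwartz (hg : ContDiff ℝ ∞ g) (hgc : HasCompactSupport g) :
    ∃ G : SchwartzMap Plane ℂ, (fun y => (g y : ℂ)) = G := by
  have h1 : HasCompactSupport (fun y => (g y : ℂ)) := hgc.comp_left Complex.ofReal_zero
  have h2 : ContDiff ℝ ∞ (fun y => (g y : ℂ)) := Complex.ofRealCLM.contDiff.comp hg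
  exact ⟨h1.toSchwartzMap h2, rfl⟩

lemma integrable_fourier (hg : ContDiff ℝ ∞ g) (hgc : HasCompactSupport g) :
    Integrable (𝓕 (fun y => (g y : ℂ))) volume := by
  obtain ⟨G, hG⟩ := exists_schwartz hg hgc
  rw [hG, ← SchwartzMap.fourier_coe]
  exact (𝓕 G).integrable

lemma integrable_rpow_mul_fourier {α : ℝ} (hα : 0 < α) (hα2 : α < 2)
    (hg : ContDiff ℝ ∞ g) (hgc : HasCompactSupport g) :
    Integrable (fun ξ : Plane => (2 * Real.pi * ‖ξ‖) ^ α * ‖𝓕 (fun y => (g y : ℂ)) ξ‖) volume := by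
  have hpi := Real.pi_pos
  obtain ⟨G, hG⟩ := exists_schwartz hg hgc
  rw [hG, ← SchwartzMap.fourier_coe]
  have h1 := (((𝓕 G).integrable_pow_mul volume 0).add
    ((𝓕 G).integrable_pow_mul volume 2)).const_mul ((2 * Real.pi) ^ α)
  refine h1.mono' ?_ (ae_of_all _ fun ξ => ?_)
  · refine Continuous.aestronglyMeasurable ?_
    refine Continuous.mul ?_ (𝓕 G).continuous.norm
    exact Continuous.rpow_const (by fun_prop) fun _ => Or.inr hα.le
  · rw [norm_mul, norm_norm, Real.norm_of_nonneg (by positivity),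
      Real.mul_rpow (by positivity) (norm_nonneg _), mul_assoc]
    simp only [Pi.add_apply]
    rw [← add_mul]
    gcongr
    -- As `0 < α < 2`, the power `|ξ|^α` is at most `1 + |ξ|²`, which is integrable against a
    -- Schwartz function.
    rcases le_total ‖ξ‖ 1 with h | h
    · have := Real.rpow_le_one (norm_nonneg ξ) h hα.le
      have h3 : 0 ≤ ‖ξ‖ ^ 2 := by positivity
      simp; linarith
    · have := Real.rpow_le_rpow_of_exponent_le h hα2.le
      rw [Real.rpow_two] at this
      have h3 : ‖ξ‖ ^ 0 = 1 := pow_zero _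
      linarith

lemma memLp_two_of_smooth (hg : ContDiff ℝ ∞ g) (hgc : HasCompactSupport g) :
    MemLp g 2 volume := hg.continuous.memLp_of_hasCompactSupport hgc

lemma continuous_cexp_inner (x : Plane) :
    Continuous fun ξ : Plane => Complex.exp (2 * Real.pi * Complex.I * (inner ℝ x ξ : ℝ)) := by
  fun_prop

/-- The Bessel factor lies in `[0, 1]`, so the bound is uniform in `x` and does not degenerate as `z
→ 0`. -/
lemma abs_conormal_le {α : ℝ} (hα : 0 < α) (hα2 : α < 2)
    (hg : ContDiff ℝ ∞ g) (hgc : HasCompactSupport g) (x : Plane) {z : ℝ} (hz : 0 < z) :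
    |conormal α g (x, z)| ≤
      ∫ ξ : Plane, (2 * Real.pi * ‖ξ‖) ^ α * ‖𝓕 (fun y => (g y : ℂ)) ξ‖ := by
  have hpi := Real.pi_pos
  rw [← Real.norm_eq_abs, ← Complex.norm_real,
    conormal_fourier hα hα2 (memLp_two_of_smooth hg hgc)
    (hg.continuous.integrable_of_hasCompactSupport hgc) x hz]
  refine norm_integral_le_of_norm_le (integrable_rpow_mul_fourier hα hα2 hg hgc)
    (ae_of_all _ fun ξ => ?_)
  rw [norm_mul, norm_mul, norm_cexp_two_pi_I, one_mul, Complex.norm_real, norm_neg, norm_mul]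
  have h1 := besselSymbol_nonneg (ν := 1 - α / 2) (by linarith) (Real.pi ^ 2 * ‖ξ‖ ^ 2 * z ^ 2)
  have h2 := besselSymbol_le_one (ν := 1 - α / 2) (by linarith)
    (r := Real.pi ^ 2 * ‖ξ‖ ^ 2 * z ^ 2) (by positivity)
  rw [Real.norm_of_nonneg h1, Real.norm_of_nonneg (by positivity)]
  gcongr
  exact mul_le_of_le_one_right (by positivity) h2

lemma tendsto_symbol_arg (ξ : Plane) :
    Tendsto (fun z : ℝ => Real.pi ^ 2 * ‖ξ‖ ^ 2 * z ^ 2) (𝓝[>] 0) (𝓝[≥] 0) := by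
  refine tendsto_nhdsWithin_iff.2 ⟨?_, Eventually.of_forall fun z => ?_⟩
  · have : Continuous fun z : ℝ => Real.pi ^ 2 * ‖ξ‖ ^ 2 * z ^ 2 := by fun_prop
    simpa using (this.tendsto 0).mono_left nhdsWithin_le_nhds
  · show 0 ≤ Real.pi ^ 2 * ‖ξ‖ ^ 2 * z ^ 2
    positivity

/-- Dominated convergence on the frequency side: the Bessel factor tends to 1 and leaves the
multiplier `(2π|ξ|)^α`. The normalization `c_α` is exactly the one that makes this limit free of
constants. -/
lemma tendsto_conormal {α : ℝ} (hα : 0 < α) (hα2 : α < 2)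
    (hg : ContDiff ℝ ∞ g) (hgc : HasCompactSupport g) (x : Plane) :
    Tendsto (fun z => conormal α g (x, z)) (𝓝[>] 0) (𝓝 (-fracLaplacian α g x)) := by
  have hpi := Real.pi_pos
  have hgi := hg.continuous.integrable_of_hasCompactSupport (μ := volume) hgc
  have hFc := continuous_fourier (g := fun y => (g y : ℂ)) hgi.ofReal
  have h1 : Tendsto (fun z => ∫ ξ, ((-((2 * Real.pi * ‖ξ‖) ^ α *
        besselSymbol (1 - α / 2) (Real.pi ^ 2 * ‖ξ‖ ^ 2 * z ^ 2)) : ℝ) : ℂ) *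
        (Complex.exp (2 * Real.pi * Complex.I * (inner ℝ x ξ : ℝ)) *
          𝓕 (fun y => (g y : ℂ)) ξ)) (𝓝[>] 0)
      (𝓝 (∫ ξ, ((-((2 * Real.pi * ‖ξ‖) ^ α * 1) : ℝ) : ℂ) *
        (Complex.exp (2 * Real.pi * Complex.I * (inner ℝ x ξ : ℝ)) *
          𝓕 (fun y => (g y : ℂ)) ξ))) := by
    refine tendsto_integral_filter_of_dominated_convergence _ ?_ ?_
      (integrable_rpow_mul_fourier hα hα2 hg hgc) ?_
    · refine Eventually.of_forall fun z => Measurable.aestronglyMeasurable ?_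
      have hb := measurable_besselSymbol (1 - α / 2)
      have := (continuous_cexp_inner x).measurable
      have := hFc.measurable
      fun_prop
    · filter_upwards [self_mem_nhdsWithin] with z hz
      refine ae_of_all _ fun ξ => ?_
      rw [norm_mul, norm_mul, norm_cexp_two_pi_I, one_mul, Complex.norm_real, norm_neg, norm_mul]
      have h1 := besselSymbol_nonneg (ν := 1 - α / 2) (by linarith)
        (Real.pi ^ 2 * ‖ξ‖ ^ 2 * z ^ 2)
      have h2 := besselSymbol_le_one (ν := 1 - α / 2) (by linarith)
        (r := Real.pi ^ 2 * ‖ξ‖ ^ 2 * z ^ 2) (by positivity)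
      rw [Real.norm_of_nonneg h1, Real.norm_of_nonneg (by positivity)]
      gcongr
      exact mul_le_of_le_one_right (by positivity) h2
    · refine ae_of_all _ fun ξ => ?_
      refine Tendsto.mul_const _ ?_
      refine (Complex.continuous_ofReal.tendsto _).comp ?_
      exact (((tendsto_besselSymbol (by linarith)).comp (tendsto_symbol_arg ξ)).const_mul _).neg
  have h2 := (Complex.continuous_re.tendsto _).comp h1
  have h3 : (∫ ξ, ((-((2 * Real.pi * ‖ξ‖) ^ α * 1) : ℝ) : ℂ) *
        (Complex.exp (2 * Real.pi * Complex.I * (inner ℝ x ξ : ℝ)) *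
          𝓕 (fun y => (g y : ℂ)) ξ)).re = -fracLaplacian α g x := by
    rw [fracLaplacian, Real.fourierInv_eq', ← Complex.neg_re, ← integral_neg]
    congr 1
    refine integral_congr_ae (ae_of_all _ fun ξ => ?_)
    simp only [smul_eq_mul, mul_one]
    rw [real_inner_comm x ξ, show ((2 * Real.pi * inner ℝ x ξ : ℝ) : ℂ) * Complex.I =
      2 * Real.pi * Complex.I * (inner ℝ x ξ : ℝ) by push_cast; ring]
    push_cast
    ring
  rw [h3] at h2
  refine h2.congr' ?_
  filter_upwards [self_mem_nhdsWithin] with z hz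
  simp only [Function.comp]
  rw [← conormal_fourier hα hα2 (memLp_two_of_smooth hg hgc) hgi x hz, Complex.ofReal_re]

lemma abs_extension_le {α : ℝ} (hα : 0 < α)
    (hg : ContDiff ℝ ∞ g) (hgc : HasCompactSupport g) (x : Plane) {z : ℝ} (hz : 0 < z) :
    |extension α g x z| ≤ ∫ ξ : Plane, ‖𝓕 (fun y => (g y : ℂ)) ξ‖ := by
  rw [← Real.norm_eq_abs, ← Complex.norm_real,
    extension_fourier hα (hg.continuous.integrable_of_hasCompactSupport hgc) x hz]
  refine norm_integral_le_of_norm_le (integrable_fourier hg hgc).norm (ae_of_all _ fun ξ => ?_)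
  rw [norm_mul, norm_mul, norm_cexp_two_pi_I, one_mul, Complex.norm_real]
  have h1 := besselSymbol_nonneg (half_pos hα) (Real.pi ^ 2 * ‖ξ‖ ^ 2 * z ^ 2)
  have h2 := besselSymbol_le_one (half_pos hα) (r := Real.pi ^ 2 * ‖ξ‖ ^ 2 * z ^ 2) (by positivity)
  rw [Real.norm_of_nonneg h1]
  exact mul_le_of_le_one_left (norm_nonneg _) h2

lemma tendsto_extension_of_smooth {α : ℝ} (hα : 0 < α)
    (hg : ContDiff ℝ ∞ g) (hgc : HasCompactSupport g) (x : Plane) :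
    Tendsto (fun z => extension α g x z) (𝓝[>] 0) (𝓝 (g x)) := by
  have hgi := hg.continuous.integrable_of_hasCompactSupport (μ := volume) hgc
  have hFc := continuous_fourier (g := fun y => (g y : ℂ)) hgi.ofReal
  have h1 : Tendsto (fun z => ∫ ξ,
        ((besselSymbol (α / 2) (Real.pi ^ 2 * ‖ξ‖ ^ 2 * z ^ 2) : ℝ) : ℂ) *
        (Complex.exp (2 * Real.pi * Complex.I * (inner ℝ x ξ : ℝ)) *
          𝓕 (fun y => (g y : ℂ)) ξ)) (𝓝[>] 0)
      (𝓝 (∫ ξ, ((1 : ℝ) : ℂ) *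
        (Complex.exp (2 * Real.pi * Complex.I * (inner ℝ x ξ : ℝ)) *
          𝓕 (fun y => (g y : ℂ)) ξ))) := by
    refine tendsto_integral_filter_of_dominated_convergence _ ?_ ?_
      (integrable_fourier hg hgc).norm ?_
    · refine Eventually.of_forall fun z => Measurable.aestronglyMeasurable ?_
      have hb := measurable_besselSymbol (α / 2)
      have := (continuous_cexp_inner x).measurable
      have := hFc.measurable
      fun_prop
    · filter_upwards [self_mem_nhdsWithin] with z hz
      refine ae_of_all _ fun ξ => ?_
      rw [norm_mul, norm_mul, norm_cexp_two_pi_I, one_mul, Complex.norm_real]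
      have h1 := besselSymbol_nonneg (half_pos hα) (Real.pi ^ 2 * ‖ξ‖ ^ 2 * z ^ 2)
      have h2 := besselSymbol_le_one (half_pos hα)
        (r := Real.pi ^ 2 * ‖ξ‖ ^ 2 * z ^ 2) (by positivity)
      rw [Real.norm_of_nonneg h1]
      exact mul_le_of_le_one_left (norm_nonneg _) h2
    · refine ae_of_all _ fun ξ => ?_
      refine Tendsto.mul_const _ ?_
      refine (Complex.continuous_ofReal.tendsto _).comp ?_
      exact (tendsto_besselSymbol (half_pos hα)).comp (tendsto_symbol_arg ξ)
  have h2 := (Complex.continuous_re.tendsto _).comp h1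
  have h3 : (∫ ξ, ((1 : ℝ) : ℂ) *
        (Complex.exp (2 * Real.pi * Complex.I * (inner ℝ x ξ : ℝ)) *
          𝓕 (fun y => (g y : ℂ)) ξ)) = g x := by
    have hinv := congrFun (Continuous.fourierInv_fourier_eq
      (f := fun y => (g y : ℂ)) (Complex.continuous_ofReal.comp hg.continuous) hgi.ofReal
      (integrable_fourier hg hgc)) x
    rw [← hinv, Real.fourierInv_eq']
    refine integral_congr_ae (ae_of_all _ fun ξ => ?_)
    simp only [smul_eq_mul, Complex.ofReal_one, one_mul]
    rw [real_inner_comm x ξ, show ((2 * Real.pi * inner ℝ x ξ : ℝ) : ℂ) * Complex.I =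
      2 * Real.pi * Complex.I * (inner ℝ x ξ : ℝ) by push_cast; ring]
  rw [h3, Complex.ofReal_re] at h2
  refine h2.congr' ?_
  filter_upwards [self_mem_nhdsWithin] with z hz
  simp only [Function.comp]
  rw [← extension_fourier hα hgi x hz, Complex.ofReal_re]

end Nice

end SQG

namespace SQG

/-! ### Off-diagonal bounds -/

lemma abs_integral_le_of_abs_le {X : Type*} [MeasurableSpace X] {μ : Measure X} {F b : X → ℝ}
    (hb : Integrable b μ) (h : ∀ y, |F y| ≤ b y) : |∫ y, F y ∂μ| ≤ ∫ y, b y ∂μ := by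
  have := norm_integral_le_of_norm_le (f := F) hb (ae_of_all _ h)
  rwa [Real.norm_eq_abs] at this

lemma integrable_translated_decay_mul {f : Plane → ℝ} (hf : MemLp f 2 volume) (x : Plane) :
    Integrable (fun y : Plane => (1 + ‖x - y‖ ^ 2)⁻¹ * |f y|) volume := by
  have h : MemLp (fun y : Plane => (1 + ‖x - y‖ ^ 2)⁻¹) 2 volume :=
    memLp_decay.comp_measurePreserving (Measure.measurePreserving_sub_left volume x)
  exact h.integrable_mul hf.norm

/-- By `ab ≤ a² + b²` and translation invariance of the integral of `a²`, the bound does not depend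
on `x`. -/
lemma exists_translated_decay_bound {f : Plane → ℝ} (hf : MemLp f 2 volume) :
    ∃ M : ℝ, 0 ≤ M ∧ ∀ x, ∫ y : Plane, (1 + ‖x - y‖ ^ 2)⁻¹ * |f y| ≤ M := by
  have h1 : Integrable (fun y : Plane => ((1 + ‖y‖ ^ 2)⁻¹) ^ 2) volume :=
    memLp_decay.integrable_sq
  refine ⟨(∫ y : Plane, ((1 + ‖y‖ ^ 2)⁻¹) ^ 2) + ∫ y, f y ^ 2, ?_, fun x => ?_⟩
  · exact add_nonneg (integral_nonneg fun y => sq_nonneg _) (integral_nonneg fun y => sq_nonneg _)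
  · have h2 : Integrable (fun y : Plane => ((1 + ‖x - y‖ ^ 2)⁻¹) ^ 2) volume :=
      h1.comp_sub_left x
    rw [← integral_sub_left_eq_self (fun y : Plane => ((1 + ‖y‖ ^ 2)⁻¹) ^ 2) volume x,
      ← integral_add h2 hf.integrable_sq]
    refine integral_mono (integrable_translated_decay_mul hf x) (h2.add hf.integrable_sq) fun y => ?_
    have := two_mul_le_add_sq ((1 + ‖x - y‖ ^ 2)⁻¹) |f y|
    have h3 : 0 ≤ (1 + ‖x - y‖ ^ 2)⁻¹ * |f y| := by positivity
    rw [sq_abs] at this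
    linarith

/-- At distance at least `d` the kernel has no singularity, and dropping `z²` from the base gives a
bound uniform in `z`. -/
lemma rieszKernel_le_of_le_dist {s d : ℝ} (hs : 1 ≤ s) (hd : 0 < d) {x y : Plane} {z : ℝ}
    (hz : 0 < z) (hxy : d ≤ ‖x - y‖) :
    rieszKernel s (x, z) y ≤ (1 + (d ^ 2)⁻¹) ^ s * (1 + ‖x - y‖ ^ 2)⁻¹ := by
  have hq := base_pos (p := (x, z)) hz y
  have h1 : (0 : ℝ) ≤ (1 + ‖x - y‖ ^ 2)⁻¹ := by positivity
  have h2 : (1 + ‖x - y‖ ^ 2)⁻¹ ≤ 1 := inv_le_one_of_one_le₀ (by nlinarith [sq_nonneg ‖x - y‖])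
  have h3 : (‖x - y‖ ^ 2 + z ^ 2)⁻¹ ≤ (1 + (d ^ 2)⁻¹) * (1 + ‖x - y‖ ^ 2)⁻¹ := by
    rw [← div_eq_mul_inv, inv_eq_one_div, div_le_div_iff₀ hq (by positivity), one_mul]
    have h4 : d ^ 2 ≤ ‖x - y‖ ^ 2 := pow_le_pow_left₀ hd.le hxy 2
    have h5 : 1 ≤ (d ^ 2)⁻¹ * ‖x - y‖ ^ 2 := by
      rw [inv_mul_eq_div, le_div_iff₀ (by positivity)]; linarith
    have h6 : 0 ≤ (d ^ 2)⁻¹ * z ^ 2 := by positivity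
    nlinarith [sq_nonneg z]
  rw [rieszKernel, Real.rpow_neg hq.le, ← Real.inv_rpow hq.le]
  calc ((‖x - y‖ ^ 2 + z ^ 2)⁻¹) ^ s ≤ ((1 + (d ^ 2)⁻¹) * (1 + ‖x - y‖ ^ 2)⁻¹) ^ s :=
        Real.rpow_le_rpow (by positivity) h3 (by linarith)
    _ = (1 + (d ^ 2)⁻¹) ^ s * ((1 + ‖x - y‖ ^ 2)⁻¹) ^ s := Real.mul_rpow (by positivity) h1
    _ ≤ _ := by
        gcongr
        exact Real.rpow_le_self_of_le_one h1 h2 hs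

lemma sq_mul_rieszKernel_le {s : ℝ} {x : Plane} {z : ℝ} (hz : 0 < z) (y : Plane) :
    z ^ 2 * rieszKernel (s + 1) (x, z) y ≤ rieszKernel s (x, z) y := by
  have hq := base_pos (p := (x, z)) hz y
  have h1 : rieszKernel s (x, z) y = (‖x - y‖ ^ 2 + z ^ 2) * rieszKernel (s + 1) (x, z) y := by
    rw [rieszKernel, rieszKernel, show -s = 1 + -(s + 1) by ring, Real.rpow_add hq, Real.rpow_one]
  rw [h1]
  refine mul_le_mul_of_nonneg_right ?_ (rieszKernel_pos (p := (x, z)) hz y).le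
  nlinarith [sq_nonneg ‖x - y‖]

/-- One factor `z²` compensates one unit of the exponent, so both terms are multiples of the first
kernel, with coefficients `α` and `2 + α`. -/
lemma abs_conormal_kernel_le {α : ℝ} (hα : 0 < α) (hα2 : α < 2) {x : Plane} {z : ℝ} (hz : 0 < z)
    (y : Plane) :
    |normConst α * (α / (2 * Real.pi)) * (α * rieszKernel (1 + α / 2) (x, z) y -
        (2 + α) * z ^ 2 * rieszKernel (2 + α / 2) (x, z) y)| ≤
      normConst α * (α / (2 * Real.pi)) * (2 + 2 * α) * rieszKernel (1 + α / 2) (x, z) y := by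
  have hpi := Real.pi_pos
  have hc := normConst_pos hα hα2
  have h1 := sq_mul_rieszKernel_le (s := 1 + α / 2) (x := x) hz y
  rw [show 1 + α / 2 + 1 = 2 + α / 2 by ring] at h1
  have h2 := rieszKernel_pos (s := 1 + α / 2) (p := (x, z)) hz y
  have h3 := rieszKernel_pos (s := 2 + α / 2) (p := (x, z)) hz y
  rw [abs_mul, abs_of_pos (by positivity : 0 < normConst α * (α / (2 * Real.pi)))]
  rw [mul_assoc (normConst α * (α / (2 * Real.pi)))]
  refine mul_le_mul_of_nonneg_left ?_ (by positivity)
  have h4 : 0 ≤ z ^ 2 * rieszKernel (2 + α / 2) (x, z) y := by positivity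
  rw [abs_le]
  constructor <;> nlinarith

/-- When `f` vanishes within `d` of `x`, the integrals never see the singularity. The extension
keeps its prefactor `z^α` and so tends to 0 at the boundary; the conormal derivative has no such
prefactor and merely stays bounded. -/
lemma exists_far_bound {α : ℝ} (hα : 0 < α) (hα2 : α < 2) {f : Plane → ℝ} (hf : MemLp f 2 volume)
    {d : ℝ} (hd : 0 < d) :
    ∃ C : ℝ, 0 ≤ C ∧ ∀ x z, 0 < z → (∀ y, ‖x - y‖ < d → f y = 0) →
      |extension α f x z| ≤ C * z ^ α ∧ |conormal α f (x, z)| ≤ C := by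
  have hpi := Real.pi_pos
  have hc := normConst_pos hα hα2
  obtain ⟨M, hM0, hM⟩ := exists_translated_decay_bound hf
  set B : ℝ := (1 + (d ^ 2)⁻¹) ^ (1 + α / 2) with hB
  have hBpos : 0 < B := by positivity
  set A : ℝ := normConst α * (α / (2 * Real.pi)) * (2 + 2 * α)
  have hA : 0 ≤ A := by positivity
  have hker : ∀ x z, 0 < z → (∀ y, ‖x - y‖ < d → f y = 0) → ∀ y,
      rieszKernel (1 + α / 2) (x, z) y * |f y| ≤ B * ((1 + ‖x - y‖ ^ 2)⁻¹ * |f y|) := by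
    intro x z hz hfar y
    rcases lt_or_ge ‖x - y‖ d with h | h
    · simp [hfar y h]
    · rw [← mul_assoc]
      exact mul_le_mul_of_nonneg_right
        (rieszKernel_le_of_le_dist (by linarith) hd hz h) (abs_nonneg _)
  refine ⟨max (α / (2 * Real.pi) * (B * M)) (A * (B * M)), le_max_of_le_right (by positivity),
    fun x z hz hfar => ⟨?_, ?_⟩⟩
  · have h1 : |rieszH f (1 + α / 2) (x, z)| ≤ B * M := by
      refine (abs_integral_le_of_abs_le ((integrable_translated_decay_mul hf x).const_mul B)
        fun y => ?_).trans ?_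
      · rw [one_mul, abs_mul,
          abs_of_pos (rieszKernel_pos (p := (x, z)) hz y)]
        exact hker x z hz hfar y
      · rw [integral_const_mul]
        gcongr
        exact hM x
    rw [extension_eq, abs_mul, abs_of_pos (by positivity : 0 < α / (2 * Real.pi) * z ^ α)]
    calc _ ≤ α / (2 * Real.pi) * z ^ α * (B * M) := by gcongr
      _ = α / (2 * Real.pi) * (B * M) * z ^ α := by ring
      _ ≤ _ := by gcongr; exact le_max_left _ _
  · refine le_trans ?_ (le_max_right _ _)
    rw [conormal_eq_integral hα hf hz]
    refine (abs_integral_le_of_abs_le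
      (((integrable_translated_decay_mul hf x).const_mul B).const_mul A)
        fun y => ?_).trans ?_
    · rw [abs_mul]
      calc _ ≤ A * rieszKernel (1 + α / 2) (x, z) y * |f y| :=
            mul_le_mul_of_nonneg_right (abs_conormal_kernel_le hα hα2 hz y) (abs_nonneg _)
        _ = A * (rieszKernel (1 + α / 2) (x, z) y * |f y|) := by ring
        _ ≤ _ := by gcongr A * ?_; exact hker x z hz hfar y
    · rw [integral_const_mul, integral_const_mul]
      gcongr
      exact hM x

/-- Decay uniform in `z` is what dominates `f` times the conormal derivative of `g` when `f` is only
square integrable. Near the support of `g` it follows from the Fourier bound, far away from the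
decay of the kernel. -/
lemma exists_conormal_decay {α : ℝ} (hα : 0 < α) (hα2 : α < 2) {g : Plane → ℝ}
    (hg : ContDiff ℝ ∞ g) (hgc : HasCompactSupport g) :
    ∃ C : ℝ, ∀ x z, 0 < z → |conormal α g (x, z)| ≤ C * (1 + ‖x‖ ^ 2)⁻¹ := by
  have hpi := Real.pi_pos
  have hc := normConst_pos hα hα2
  have hgi := hg.continuous.integrable_of_hasCompactSupport (μ := volume) hgc
  obtain ⟨ρ, hρ0, hρ⟩ := hgc.isCompact.isBounded.subset_closedBall_lt 0 (0 : Plane)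
  set A : ℝ := ∫ ξ : Plane, (2 * Real.pi * ‖ξ‖) ^ α * ‖𝓕 (fun y => (g y : ℂ)) ξ‖
  have hA : 0 ≤ A := integral_nonneg fun ξ => by positivity
  set B : ℝ := normConst α * (α / (2 * Real.pi)) * (2 + 2 * α)
  have hB : 0 ≤ B := by positivity
  set D : ℝ := (1 + (ρ ^ 2)⁻¹) ^ (1 + α / 2)
  have hD : 0 ≤ D := by positivity
  have hgn : 0 ≤ ∫ y, |g y| := integral_nonneg fun y => abs_nonneg _
  refine ⟨A * (1 + (2 * ρ) ^ 2) + B * (D * 4) * ∫ y, |g y|, fun x z hz => ?_⟩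
  -- For `|x| ≥ 2ρ` every `y` in the support of `g` satisfies `|x - y| ≥ |x|/2 ≥ ρ`.
  rcases le_total ‖x‖ (2 * ρ) with h | h
  · calc |conormal α g (x, z)| ≤ A := abs_conormal_le hα hα2 hg hgc x hz
      _ = A * ((1 + ‖x‖ ^ 2) * (1 + ‖x‖ ^ 2)⁻¹) := by
          rw [mul_inv_cancel₀ (by positivity), mul_one]
      _ ≤ A * ((1 + (2 * ρ) ^ 2) * (1 + ‖x‖ ^ 2)⁻¹) := by gcongr
      _ = A * (1 + (2 * ρ) ^ 2) * (1 + ‖x‖ ^ 2)⁻¹ := by ring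
      _ ≤ _ := by
          gcongr
          have : 0 ≤ B * (D * 4) * ∫ y, |g y| := by positivity
          linarith
  · have hk : ∀ y, rieszKernel (1 + α / 2) (x, z) y * |g y| ≤
        D * 4 * (1 + ‖x‖ ^ 2)⁻¹ * |g y| := by
      intro y
      by_cases hy : g y = 0
      · simp [hy]
      · have hy1 : ‖y‖ ≤ ρ := by
          simpa using hρ (subset_tsupport _ hy)
        have hxy : ‖x‖ / 2 ≤ ‖x - y‖ := by
          have := norm_sub_norm_le x y
          linarith
        have h1 := rieszKernel_le_of_le_dist (s := 1 + α / 2) (by linarith) hρ0 hz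
          (show ρ ≤ ‖x - y‖ by linarith)
        refine mul_le_mul_of_nonneg_right (h1.trans ?_) (abs_nonneg _)
        rw [mul_assoc]
        refine mul_le_mul_of_nonneg_left ?_ hD
        rw [← div_eq_mul_inv, inv_eq_one_div, div_le_div_iff₀ (by positivity) (by positivity)]
        have h2 : (‖x‖ / 2) ^ 2 ≤ ‖x - y‖ ^ 2 := pow_le_pow_left₀ (by positivity) hxy 2
        nlinarith
    rw [conormal_eq_integral hα (memLp_two_of_smooth hg hgc) hz]
    refine (abs_integral_le_of_abs_le ((hgi.abs.const_mul (D * 4 * (1 + ‖x‖ ^ 2)⁻¹)).const_mul B)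
        fun y => ?_).trans ?_
    · rw [abs_mul]
      calc _ ≤ B * rieszKernel (1 + α / 2) (x, z) y * |g y| :=
            mul_le_mul_of_nonneg_right (abs_conormal_kernel_le hα hα2 hz y) (abs_nonneg _)
        _ = B * (rieszKernel (1 + α / 2) (x, z) y * |g y|) := by ring
        _ ≤ _ := by gcongr B * ?_; exact hk y
    · rw [integral_const_mul, integral_const_mul]
      have h0 : (0 : ℝ) ≤ (1 + ‖x‖ ^ 2)⁻¹ := by positivity
      have h1 : 0 ≤ A * (1 + (2 * ρ) ^ 2) * (1 + ‖x‖ ^ 2)⁻¹ :=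
        mul_nonneg (mul_nonneg hA (by positivity)) h0
      clear_value A B D
      rw [add_mul]
      refine le_trans (le_of_eq ?_) (le_add_of_nonneg_left h1)
      ring

/-! ### Symmetry -/

lemma rieszKernel_symm (s : ℝ) (x y : Plane) (z : ℝ) :
    rieszKernel s (x, z) y = rieszKernel s (y, z) x := by
  simp only [rieszKernel, norm_sub_rev]

lemma continuous_rieszH_slice {f : Plane → ℝ} (hf : MemLp f 2 volume) {s : ℝ} (hs : 1 ≤ s)
    {z : ℝ} (hz : 0 < z) : Continuous fun x => rieszH f s (x, z) :=
  continuous_iff_continuousAt.2 fun x =>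
    (continuousAt_rieszH hf hz hs).comp (f := fun x : Plane => (x, z)) (by fun_prop)

lemma continuous_conormal_slice {α : ℝ} (hα : 0 < α) {f : Plane → ℝ} (hf : MemLp f 2 volume)
    {z : ℝ} (hz : 0 < z) : Continuous fun x => conormal α f (x, z) := by
  unfold conormal
  have h1 := continuous_rieszH_slice hf (s := 1 + α / 2) (by linarith) hz
  have h2 := continuous_rieszH_slice hf (s := 2 + α / 2) (by linarith) hz
  fun_prop

lemma measurable_rieszKernel (s z : ℝ) :
    Measurable fun p : Plane × Plane => rieszKernel s (p.1, z) p.2 := by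
  unfold rieszKernel
  fun_prop

/-- Fubini for a symmetric kernel. Absolute integrability holds because the Riesz integral of `|f|`
is continuous in `x` and `g` has compact support. -/
lemma integral_rieszH_mul_comm {f g : Plane → ℝ} (hf : MemLp f 2 volume) (hg : Continuous g)
    (hgc : HasCompactSupport g) {s : ℝ} (hs : 1 ≤ s) {z : ℝ} (hz : 0 < z) :
    ∫ x, rieszH f s (x, z) * g x = ∫ y, f y * rieszH g s (y, z) := by
  have hI : Integrable (Function.uncurry fun x y => rieszKernel s (x, z) y * f y * g x)
      (volume.prod volume) := by
    have hmeas : AEStronglyMeasurable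
        (Function.uncurry fun x y => rieszKernel s (x, z) y * f y * g x)
        ((volume : Measure Plane).prod volume) :=
      ((measurable_rieszKernel s z).aestronglyMeasurable.mul hf.1.comp_snd).mul
        hg.aestronglyMeasurable.comp_fst
    rw [integrable_prod_iff hmeas]
    have hH : ∀ x, Integrable (fun y => rieszKernel s (x, z) y * f y) volume := fun x => by
      have := integrable_rieszInt hf (m := fun _ => 1) (p := (x, z)) continuous_const (d := 0)
        (by simp) (s := s) (by simpa using hs) hz
      simpa using this
    refine ⟨ae_of_all _ fun x => (hH x).mul_const (g x), ?_⟩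
    have : (fun x => ∫ y, ‖Function.uncurry
        (fun x y => rieszKernel s (x, z) y * f y * g x) (x, y)‖) =
        fun x => rieszH (fun y => |f y|) s (x, z) * |g x| := by
      ext x
      rw [rieszH, rieszInt, ← integral_mul_const]
      refine integral_congr_ae (ae_of_all _ fun y => ?_)
      simp only [Function.uncurry, norm_mul, Real.norm_eq_abs,
        abs_of_pos (rieszKernel_pos (s := s) (p := (x, z)) hz y), one_mul]
    rw [this]
    refine Continuous.integrable_of_hasCompactSupport ?_ ?_
    · exact (continuous_rieszH_slice hf.norm hs hz).mul hg.abs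
    · exact HasCompactSupport.mul_left (hgc.comp_left abs_zero)
  calc _ = ∫ x, ∫ y, rieszKernel s (x, z) y * f y * g x := by
        refine integral_congr_ae (ae_of_all _ fun x => ?_)
        simp only [rieszH, rieszInt, one_mul]
        rw [integral_mul_const]
    _ = ∫ y, ∫ x, rieszKernel s (x, z) y * f y * g x := integral_integral_swap hI
    _ = _ := by
        refine integral_congr_ae (ae_of_all _ fun y => ?_)
        simp only [rieszH, rieszInt, one_mul]
        rw [← integral_const_mul]
        refine integral_congr_ae (ae_of_all _ fun x => ?_)
        simp only
        rw [rieszKernel_symm s x y z]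
        ring

lemma integral_conormal_mul_comm {α : ℝ} (hα : 0 < α) {f g : Plane → ℝ}
    (hf : MemLp f 2 volume) (hg : Continuous g) (hgc : HasCompactSupport g) {z : ℝ} (hz : 0 < z) :
    ∫ x, conormal α f (x, z) * g x = ∫ y, f y * conormal α g (y, z) := by
  have hg2 : MemLp g 2 volume := hg.memLp_of_hasCompactSupport hgc
  have h1 := integral_rieszH_mul_comm hf hg hgc (s := 1 + α / 2) (by linarith) hz
  have h2 := integral_rieszH_mul_comm hf hg hgc (s := 2 + α / 2) (by linarith) hz
  have hI : ∀ s : ℝ, 1 ≤ s → Integrable (fun x => rieszH f s (x, z) * g x) volume := fun s hs =>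
    ((continuous_rieszH_slice hf hs hz).mul hg).integrable_of_hasCompactSupport
      (HasCompactSupport.mul_left hgc)
  have hJ : ∀ s : ℝ, 1 ≤ s → Integrable (fun y => f y * rieszH g s (y, z)) volume := fun s hs => by
    have hcont := continuous_rieszH_slice hg2 hs hz
    have hmem : MemLp (fun y => rieszH g s (y, z)) 2 volume := by
      rw [memLp_two_iff_integrable_sq hcont.aestronglyMeasurable]
      -- The pairing with an `L²` function `f` requires decay of the Riesz integral of `g`. The
      -- height is fixed here, so the constant may blow up as `z → 0`.
      have hb : ∃ C : ℝ, ∀ y, |rieszH g s (y, z)| ≤ C * (1 + ‖y‖ ^ 2)⁻¹ := by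
        obtain ⟨ρ, hρ0, hρ⟩ := hgc.isCompact.isBounded.subset_closedBall_lt 0 (0 : Plane)
        set E : ℝ := 2 + (1 + 2 * ρ ^ 2) / z ^ 2
        have hE : 0 < E := by positivity
        refine ⟨E ^ s * ∫ x, |g x|, fun y => ?_⟩
        have hgi := hg.integrable_of_hasCompactSupport (μ := volume) hgc
        refine (abs_integral_le_of_abs_le (hgi.abs.const_mul (E ^ s * (1 + ‖y‖ ^ 2)⁻¹))
          fun x => ?_).trans ?_
        · rw [one_mul, abs_mul,
            abs_of_pos (rieszKernel_pos (p := (y, z)) hz x)]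
          by_cases hx : g x = 0
          · simp [hx]
          · have hx1 : ‖x‖ ≤ ρ := by simpa using hρ (subset_tsupport _ hx)
            refine mul_le_mul_of_nonneg_right ?_ (abs_nonneg _)
            have hq := base_pos (p := (y, z)) hz x
            have h0 : (0 : ℝ) ≤ (1 + ‖y‖ ^ 2)⁻¹ := by positivity
            have h0' : (1 + ‖y‖ ^ 2)⁻¹ ≤ 1 :=
              inv_le_one_of_one_le₀ (by nlinarith [sq_nonneg ‖y‖])
            have h3 : (‖y - x‖ ^ 2 + z ^ 2)⁻¹ ≤ E * (1 + ‖y‖ ^ 2)⁻¹ := by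
              rw [← div_eq_mul_inv, inv_eq_one_div, div_le_div_iff₀ hq (by positivity), one_mul]
              have h4 : ‖y‖ ≤ ‖y - x‖ + ρ := by
                have := norm_sub_norm_le y x
                linarith
              have h5 := pow_le_pow_left₀ (norm_nonneg y) h4 2
              have h6 : (1 + 2 * ρ ^ 2) / z ^ 2 * z ^ 2 = 1 + 2 * ρ ^ 2 := by field_simp
              have h7 : 0 ≤ (1 + 2 * ρ ^ 2) / z ^ 2 * ‖y - x‖ ^ 2 := by positivity
              have h8 : E * (‖y - x‖ ^ 2 + z ^ 2) = 2 * ‖y - x‖ ^ 2 + 2 * z ^ 2 +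
                (1 + 2 * ρ ^ 2) / z ^ 2 * ‖y - x‖ ^ 2 + (1 + 2 * ρ ^ 2) / z ^ 2 * z ^ 2 := by
                simp only [E]; ring
              rw [h8, h6]
              nlinarith [sq_nonneg (‖y - x‖ - ρ), sq_nonneg z]
            rw [rieszKernel, Real.rpow_neg hq.le, ← Real.inv_rpow hq.le]
            calc ((‖y - x‖ ^ 2 + z ^ 2)⁻¹) ^ s ≤ (E * (1 + ‖y‖ ^ 2)⁻¹) ^ s :=
                  Real.rpow_le_rpow (by positivity) h3 (by linarith)
              _ = E ^ s * ((1 + ‖y‖ ^ 2)⁻¹) ^ s := Real.mul_rpow hE.le h0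
              _ ≤ _ := by
                  gcongr
                  exact Real.rpow_le_self_of_le_one h0 h0' hs
        · rw [integral_const_mul]
          apply le_of_eq; ring
      obtain ⟨C, hC⟩ := hb
      refine ((memLp_decay.integrable_sq).const_mul (C ^ 2)).mono'
        (hcont.pow 2).aestronglyMeasurable (ae_of_all _ fun y => ?_)
      rw [norm_pow, Real.norm_eq_abs, ← mul_pow]
      exact pow_le_pow_left₀ (abs_nonneg _) (hC y) 2
    exact hf.integrable_mul hmem
  have e1 : ∀ x, conormal α f (x, z) * g x = normConst α * (α / (2 * Real.pi)) *
      (α * (rieszH f (1 + α / 2) (x, z) * g x) -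
        (2 + α) * z ^ 2 * (rieszH f (2 + α / 2) (x, z) * g x)) := fun x => by
    rw [conormal]; ring
  have e2 : ∀ y, f y * conormal α g (y, z) = normConst α * (α / (2 * Real.pi)) *
      (α * (f y * rieszH g (1 + α / 2) (y, z)) -
        (2 + α) * z ^ 2 * (f y * rieszH g (2 + α / 2) (y, z))) := fun x => by
    rw [conormal]; ring
  simp only [e1, e2]
  rw [integral_const_mul, integral_const_mul,
    integral_sub ((hI _ (by linarith)).const_mul _) ((hI _ (by linarith)).const_mul _),
    integral_sub ((hJ _ (by linarith)).const_mul _) ((hJ _ (by linarith)).const_mul _),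
    integral_const_mul, integral_const_mul, integral_const_mul, integral_const_mul, h1, h2]

end SQG

namespace SQG

/-! ### Behaviour of the extension at the boundary -/

section Boundary

variable {f ψ : Plane → ℝ} {c : Plane} {ρ : ℝ}

lemma contDiff_of_contDiffOn_of_tsupport {E F : Type*} [NormedAddCommGroup E] [NormedSpace ℝ E]
    [NormedAddCommGroup F] [NormedSpace ℝ F] {g : E → F} {U : Set E} {n : ℕ∞ω}
    (hU : IsOpen U) (hg : ContDiffOn ℝ n g U) (hs : tsupport g ⊆ U) : ContDiff ℝ n g := by
  rw [contDiff_iff_contDiffAt]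
  intro x
  by_cases hx : x ∈ tsupport g
  · exact hg.contDiffAt (hU.mem_nhds (hs hx))
  · have h : g =ᶠ[𝓝 x] fun _ => 0 := notMem_tsupport_iff_eventuallyEq.1 hx
    exact contDiffAt_const.congr_of_eventuallyEq h

lemma contDiff_mul_of_tsupport {E : Type*} [NormedAddCommGroup E] [NormedSpace ℝ E]
    {f ψ : E → ℝ} {U : Set E} {n : ℕ∞ω} (hU : IsOpen U) (hf : ContDiffOn ℝ n f U)
    (hψ : ContDiff ℝ n ψ) (hs : tsupport ψ ⊆ U) : ContDiff ℝ n fun x => ψ x * f x :=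
  contDiff_of_contDiffOn_of_tsupport hU (hψ.contDiffOn.mul hf)
    ((tsupport_mul_subset_left).trans hs)

lemma hasCompactSupport_of_tsupport_subset_ball {ψ : Plane → ℝ} (hs : tsupport ψ ⊆ ball c ρ) :
    HasCompactSupport ψ :=
  Metric.isCompact_of_isClosed_isBounded (isClosed_tsupport ψ) (isBounded_ball.subset hs)

lemma integrable_poissonKernel_mul {α : ℝ} (hα : 0 < α) (hf : MemLp f 2 volume) (x : Plane)
    {z : ℝ} (hz : 0 < z) : Integrable (fun y => poissonKernel α (x - y) z * f y) volume := by
  have h := (integrable_rieszInt hf (m := fun _ => 1) (p := (x, z)) continuous_const (d := 0)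
    (by simp) (s := 1 + α / 2) (by simp; linarith) hz).const_mul (α / (2 * Real.pi) * z ^ α)
  refine h.congr (ae_of_all _ fun y => ?_)
  simp only [poissonKernel, rieszKernel]
  rw [Real.rpow_neg (by positivity), show (2 + α) / 2 = 1 + α / 2 by ring]
  ring

lemma extension_add {α : ℝ} (hα : 0 < α) {f g : Plane → ℝ} (hf : MemLp f 2 volume)
    (hg : MemLp g 2 volume) (x : Plane) {z : ℝ} (hz : 0 < z) :
    extension α (fun y => f y + g y) x z = extension α f x z + extension α g x z := by
  rw [extension, extension, extension, ← integral_add (integrable_poissonKernel_mul hα hf x hz)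
    (integrable_poissonKernel_mul hα hg x hz)]
  simp only [mul_add]

lemma rieszH_add {f g : Plane → ℝ} (hf : MemLp f 2 volume)
    (hg : MemLp g 2 volume) (x : Plane) {z : ℝ} (hz : 0 < z) {s : ℝ} (hs : 1 ≤ s) :
    rieszH (fun y => f y + g y) s (x, z) = rieszH f s (x, z) + rieszH g s (x, z) := by
  rw [rieszH, rieszH, rieszH, rieszInt, rieszInt, rieszInt, ← integral_add
    (integrable_rieszInt hf (m := fun _ => 1) (p := (x, z)) continuous_const (d := 0)
      (by simp) (s := s) (by simpa using hs) hz)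
    (integrable_rieszInt hg (m := fun _ => 1) (p := (x, z)) continuous_const (d := 0)
      (by simp) (s := s) (by simpa using hs) hz)]
  simp only [mul_add]

lemma conormal_add {α : ℝ} (hα : 0 < α) {f g : Plane → ℝ} (hf : MemLp f 2 volume)
    (hg : MemLp g 2 volume) (x : Plane) {z : ℝ} (hz : 0 < z) :
    conormal α (fun y => f y + g y) (x, z) = conormal α f (x, z) + conormal α g (x, z) := by
  rw [conormal, rieszH_add hf hg x hz (by linarith), rieszH_add hf hg x hz (by linarith),
    conormal, conormal]
  ring

/-- Multiplication by a bump function that is 1 near the support of `ψ` and supported in the ball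
separates a smooth compactly supported part, treated by Fourier transform, from a part vanishing
near the support of `ψ`, treated by the off-diagonal bounds. -/
lemma exists_local_split (hf : MemLp f 2 volume) (hfs : ContDiffOn ℝ ∞ f (ball c ρ))
    (hs : tsupport ψ ⊆ ball c ρ) :
    ∃ (f₁ f₂ : Plane → ℝ) (d : ℝ), 0 < d ∧ ContDiff ℝ ∞ f₁ ∧ HasCompactSupport f₁ ∧
      MemLp f₂ 2 volume ∧ (f = fun y => f₁ y + f₂ y) ∧
      ∀ x ∈ tsupport ψ, ∀ y, ‖x - y‖ < d → f₂ y = 0 := by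
  rcases le_or_gt ρ 0 with hρ | hρ
  · rw [ball_eq_empty.2 hρ] at hs
    refine ⟨fun _ => 0, f, 1, one_pos, contDiff_const, HasCompactSupport.zero, hf, by simp,
      fun x hx => (hs hx).elim⟩
  obtain ⟨r, hr, hsr⟩ := exists_lt_subset_ball (isClosed_tsupport ψ) hs
  set r' := max r 0
  have hr' : r' < ρ := max_lt hr hρ
  have hr0 : 0 ≤ r' := le_max_right _ _
  -- The support of `ψ` lies within `r' < ρ` of the centre. Dividing the gap in three gives the bump
  -- its two radii and leaves the distance `d = (ρ - r')/3`.
  let b : ContDiffBump c := ⟨r' + (ρ - r') / 3, r' + 2 * (ρ - r') / 3, by linarith, by linarith⟩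
  have hbs : tsupport b ⊆ ball c ρ := by
    rw [b.tsupport_eq]
    exact closedBall_subset_ball (show r' + 2 * (ρ - r') / 3 < ρ by linarith)
  have h1 : ContDiff ℝ ∞ fun y => b y * f y :=
    contDiff_mul_of_tsupport isOpen_ball hfs b.contDiff hbs
  have h1c : HasCompactSupport fun y => b y * f y := b.hasCompactSupport.mul_right
  refine ⟨fun y => b y * f y, fun y => f y - b y * f y, (ρ - r') / 3, by linarith, h1, h1c,
    hf.sub (memLp_two_of_smooth h1 h1c), by ext; simp, fun x hx y hxy => ?_⟩
  have hb : b y = 1 := b.one_of_mem_closedBall (by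
    have h2 : dist x c < r := hsr hx
    have h3 : r ≤ r' := le_max_left _ _
    have h4 : dist y c ≤ dist x y + dist x c := by
      rw [dist_comm x y]; exact dist_triangle _ _ _
    rw [← dist_eq_norm] at hxy
    rw [mem_closedBall]
    show dist y c ≤ r' + (ρ - r') / 3
    linarith)
  simp [hb]

lemma exists_boundary_bound {α : ℝ} (hα : 0 < α) (hα2 : α < 2) (hf : MemLp f 2 volume)
    (hfs : ContDiffOn ℝ ∞ f (ball c ρ)) (hs : tsupport ψ ⊆ ball c ρ) (Z : ℝ) :
    ∃ C : ℝ, ∀ x ∈ tsupport ψ, ∀ z, 0 < z → z ≤ Z →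
      |extension α f x z| ≤ C ∧ |conormal α f (x, z)| ≤ C := by
  obtain ⟨f₁, f₂, d, hd, h1, h1c, h2, rfl, hfar⟩ := exists_local_split hf hfs hs
  have h1m := memLp_two_of_smooth h1 h1c
  obtain ⟨C, hC0, hC⟩ := exists_far_bound hα hα2 h2 hd
  refine ⟨max ((∫ ξ : Plane, ‖𝓕 (fun y => (f₁ y : ℂ)) ξ‖) + C * Z ^ α)
    ((∫ ξ : Plane, (2 * Real.pi * ‖ξ‖) ^ α * ‖𝓕 (fun y => (f₁ y : ℂ)) ξ‖) + C),
    fun x hx z hz hzZ => ⟨?_, ?_⟩⟩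
  · refine le_trans ?_ (le_max_left _ _)
    rw [extension_add hα h1m h2 x hz]
    refine (abs_add_le _ _).trans (add_le_add (abs_extension_le hα h1 h1c x hz) ?_)
    refine (hC x z hz (hfar x hx)).1.trans ?_
    gcongr
  · refine le_trans ?_ (le_max_right _ _)
    rw [conormal_add hα h1m h2 x hz]
    exact (abs_add_le _ _).trans (add_le_add (abs_conormal_le hα hα2 h1 h1c x hz)
      (hC x z hz (hfar x hx)).2)

lemma tendsto_extension {α : ℝ} (hα : 0 < α) (hα2 : α < 2) (hf : MemLp f 2 volume)
    (hfs : ContDiffOn ℝ ∞ f (ball c ρ)) (hs : tsupport ψ ⊆ ball c ρ) {x : Plane}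
    (hx : x ∈ tsupport ψ) : Tendsto (fun z => extension α f x z) (𝓝[>] 0) (𝓝 (f x)) := by
  obtain ⟨f₁, f₂, d, hd, h1, h1c, h2, rfl, hfar⟩ := exists_local_split hf hfs hs
  have h1m := memLp_two_of_smooth h1 h1c
  obtain ⟨C, hC0, hC⟩ := exists_far_bound hα hα2 h2 hd
  have e2 : f₂ x = 0 := hfar x hx x (by simpa using hd)
  have t2 : Tendsto (fun z => extension α f₂ x z) (𝓝[>] 0) (𝓝 (f₂ x)) := by
    rw [e2]
    have hb : ∀ᶠ z in 𝓝[>] (0 : ℝ), ‖extension α f₂ x z‖ ≤ C * z ^ α := by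
      filter_upwards [self_mem_nhdsWithin] with z hz using (hC x z hz (hfar x hx)).1
    refine squeeze_zero_norm' hb ?_
    have := ((Real.continuousAt_rpow_const 0 α (Or.inr hα.le)).tendsto.const_mul C).mono_left
      (nhdsWithin_le_nhds (s := Ioi 0))
    simpa [Real.zero_rpow hα.ne'] using this
  refine ((tendsto_extension_of_smooth hα h1 h1c x).add t2).congr' ?_
  filter_upwards [self_mem_nhdsWithin] with z hz
  rw [extension_add hα h1m h2 x hz]

lemma continuous_extension_slice {α : ℝ} (hα : 0 < α) (hf : MemLp f 2 volume)
    {z : ℝ} (hz : 0 < z) : Continuous fun x => extension α f x z := by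
  simp only [extension_eq]
  exact continuous_const.mul (continuous_rieszH_slice hf (by linarith) hz)

/-- The integral is written as `∫ N g + ∫ N (f* ψ - g)` with `g = ψ f`. By symmetry the first term
is `∫ f N_g`, and `N_g → -Λ^α g` because `g` is nice. In the second, `N` is bounded over the support
of `ψ` while `f* → f` there. -/
lemma tendsto_integral_conormal {α : ℝ} (hα : 0 < α) (hα2 : α < 2) (hf : MemLp f 2 volume)
    (hfs : ContDiffOn ℝ ∞ f (ball c ρ)) (hψ : ContDiff ℝ ∞ ψ) (hs : tsupport ψ ⊆ ball c ρ) :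
    Tendsto (fun z => ∫ x, conormal α f (x, z) * (extension α f x z * ψ x)) (𝓝[>] 0)
      (𝓝 (-∫ x, f x * fracLaplacian α (fun y => ψ y * f y) x)) := by
  have hψc := hasCompactSupport_of_tsupport_subset_ball hs
  set g : Plane → ℝ := fun y => ψ y * f y with hg_def
  have hg : ContDiff ℝ ∞ g := contDiff_mul_of_tsupport isOpen_ball hfs hψ hs
  have hgc : HasCompactSupport g := hψc.mul_right
  have hgi : Integrable g volume := hg.continuous.integrable_of_hasCompactSupport hgc
  have hψi : Integrable ψ volume := hψ.continuous.integrable_of_hasCompactSupport hψc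
  obtain ⟨C, hC⟩ := exists_boundary_bound hα hα2 hf hfs hs 1
  obtain ⟨D, hD⟩ := exists_conormal_decay hα hα2 hg hgc
  -- Dominated convergence over the whole plane, with the decay of `N_g` paired against `f ∈ L²`.
  have t1 : Tendsto (fun z => ∫ y, f y * conormal α g (y, z)) (𝓝[>] 0)
      (𝓝 (∫ x, f x * -fracLaplacian α g x)) := by
    refine tendsto_integral_filter_of_dominated_convergence
      (fun y => D * ((1 + ‖y‖ ^ 2)⁻¹ * |f y|)) ?_ ?_ ((integrable_decay_mul hf).const_mul D) ?_
    · filter_upwards [self_mem_nhdsWithin] with z hz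
      exact hf.1.mul (continuous_conormal_slice hα (memLp_two_of_smooth hg hgc)
        hz).aestronglyMeasurable
    · filter_upwards [self_mem_nhdsWithin] with z hz
      refine ae_of_all _ fun y => ?_
      rw [norm_mul, Real.norm_eq_abs, Real.norm_eq_abs, mul_comm, ← mul_assoc]
      exact mul_le_mul_of_nonneg_right (hD y z hz) (abs_nonneg _)
    · exact ae_of_all _ fun y => (tendsto_conormal hα hα2 hg hgc y).const_mul _
  have t2 : Tendsto (fun z => ∫ x, conormal α f (x, z) * (extension α f x z * ψ x - g x)) (𝓝[>] 0)
      (𝓝 (∫ x : Plane, (0 : ℝ))) := by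
    refine tendsto_integral_filter_of_dominated_convergence
      (fun y => C * (C * |ψ y| + |g y|)) ?_ ?_ (((hψi.abs.const_mul C).add hgi.abs).const_mul C) ?_
    · filter_upwards [self_mem_nhdsWithin] with z hz
      exact ((continuous_conormal_slice hα hf hz).mul (((continuous_extension_slice hα hf hz).mul
        hψ.continuous).sub hg.continuous)).aestronglyMeasurable
    · have h01 : ∀ᶠ z : ℝ in 𝓝[>] 0, z ≤ 1 :=
        nhdsWithin_le_nhds (ge_mem_nhds zero_lt_one)
      filter_upwards [self_mem_nhdsWithin, h01] with z hz hz1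
      refine ae_of_all _ fun x => ?_
      by_cases hx : x ∈ tsupport ψ
      · obtain ⟨c1, c2⟩ := hC x hx z hz hz1
        have hC0 : 0 ≤ C := (abs_nonneg _).trans c1
        rw [norm_mul, Real.norm_eq_abs, Real.norm_eq_abs]
        refine mul_le_mul c2 ((abs_sub _ _).trans ?_) (abs_nonneg _) hC0
        rw [abs_mul]
        gcongr
      · have : ψ x = 0 := image_eq_zero_of_notMem_tsupport hx
        simp [hg_def, this]
    · refine ae_of_all _ fun x => ?_
      by_cases hx : x ∈ tsupport ψ
      · have h3 : Tendsto (fun z => extension α f x z * ψ x - g x) (𝓝[>] 0) (𝓝 0) := by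
          have := ((tendsto_extension hα hα2 hf hfs hs hx).mul_const (ψ x)).sub_const (g x)
          simpa [hg_def, mul_comm] using this
        refine squeeze_zero_norm' (a := fun z => C * |extension α f x z * ψ x - g x|) ?_ ?_
        · have h01 : ∀ᶠ z : ℝ in 𝓝[>] 0, z ≤ 1 :=
            nhdsWithin_le_nhds (ge_mem_nhds zero_lt_one)
          filter_upwards [self_mem_nhdsWithin, h01] with z hz hz1
          rw [norm_mul, Real.norm_eq_abs, Real.norm_eq_abs]
          exact mul_le_mul_of_nonneg_right (hC x hx z hz hz1).2 (abs_nonneg _)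
        · simpa using h3.abs.const_mul C
      · have : ψ x = 0 := image_eq_zero_of_notMem_tsupport hx
        simp [hg_def, this]
  have h3 := t1.add t2
  rw [integral_zero, add_zero] at h3
  have e3 : ∫ x, f x * -fracLaplacian α g x = -∫ x, f x * fracLaplacian α g x := by
    rw [← integral_neg]; simp
  rw [e3] at h3
  refine h3.congr' ?_
  filter_upwards [self_mem_nhdsWithin] with z (hz : 0 < z)
  have hN := continuous_conormal_slice hα hf hz
  have hF := continuous_extension_slice hα hf hz
  rw [← integral_conormal_mul_comm hα hf hg.continuous hgc hz, ← integral_add]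
  · refine integral_congr_ae (ae_of_all _ fun x => ?_)
    simp only
    ring
  · exact (hN.mul hg.continuous).integrable_of_hasCompactSupport hgc.mul_left
  · refine (hN.mul ((hF.mul hψ.continuous).sub hg.continuous)).integrable_of_hasCompactSupport ?_
    refine HasCompactSupport.mul_left ?_
    exact (HasCompactSupport.mul_left hψc).sub hgc

/-- Measurability and decay of `Λ^α g` are inherited from the conormal derivatives, of which it is,
up to sign, the pointwise limit. -/
lemma integrable_mul_fracLaplacian {α : ℝ} (hα : 0 < α) (hα2 : α < 2) (hf : MemLp f 2 volume)
    {g : Plane → ℝ} (hg : ContDiff ℝ ∞ g) (hgc : HasCompactSupport g) :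
    Integrable (fun x => f x * fracLaplacian α g x) volume := by
  obtain ⟨D, hD⟩ := exists_conormal_decay hα hα2 hg hgc
  have ht := fun x => tendsto_conormal hα hα2 hg hgc x
  have hm : AEStronglyMeasurable (fun x => -fracLaplacian α g x) volume := by
    -- The approximating functions must be measurable for every real `z`, hence the value 0 at
    -- nonpositive heights, which the limit does not see.
    refine aestronglyMeasurable_of_tendsto_ae (𝓝[>] (0 : ℝ))
      (f := fun z x => if 0 < z then conormal α g (x, z) else 0) (fun z => ?_) (ae_of_all _ fun x => ?_)
    · by_cases hz : 0 < z
      · simp only [hz, if_true]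
        exact (continuous_conormal_slice hα (memLp_two_of_smooth hg hgc) hz).aestronglyMeasurable
      · simp only [hz, if_false]
        exact aestronglyMeasurable_const
    · refine (ht x).congr' ?_
      filter_upwards [self_mem_nhdsWithin] with z (hz : 0 < z)
      simp [hz]
  have h := integrable_kernel_mul hf (C := D) hm fun x => ?_
  · refine h.neg.congr (ae_of_all _ fun x => ?_)
    simp only [Pi.neg_apply]; ring
  · refine le_of_tendsto (ht x).abs ?_
    filter_upwards [self_mem_nhdsWithin] with z hz using hD x z hz

end Boundary

end SQG

namespace SQG

/-! ### The vertical cut-off function -/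

section Vertical

variable {δ C₀ R₀ Rs : ℝ} {χ : ℝ → ℝ}

lemma IsVerticalCutoff.nonneg (hR₀ : 0 < R₀) (hRs : 0 < Rs) (h : IsVerticalCutoff δ C₀ R₀ Rs χ)
    {z : ℝ} (hz : 0 ≤ z) : 0 ≤ χ z := by
  rcases le_total z (Rs + R₀) with h1 | h1
  · have := h.antitone (mem_Ici.2 hz) (mem_Ici.2 (by linarith : 0 ≤ Rs + R₀)) h1
    rwa [h.eq_zero _ le_rfl] at this
  · rw [h.eq_zero _ h1]

lemma IsVerticalCutoff.le_one (hRs : 0 < Rs) (h : IsVerticalCutoff δ C₀ R₀ Rs χ)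
    {z : ℝ} (hz : 0 ≤ z) : χ z ≤ 1 := by
  have := h.antitone (mem_Ici.2 le_rfl) (mem_Ici.2 hz) hz
  rwa [h.eq_one 0 ⟨le_rfl, hRs.le⟩] at this

lemma IsVerticalCutoff.contDiffOn_deriv (h : IsVerticalCutoff δ C₀ R₀ Rs χ) :
    DifferentiableOn ℝ χ (Ioi 0) ∧ DifferentiableOn ℝ (deriv χ) (Ioi 0) ∧
      ContinuousOn (deriv (deriv χ)) (Ioi 0) := by
  have h0 : ContDiffOn ℝ ∞ χ (Ioi 0) := h.smooth.mono Ioi_subset_Ici_self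
  have h1 := (contDiffOn_infty_iff_deriv_of_isOpen isOpen_Ioi).1 h0
  have h2 := (contDiffOn_infty_iff_deriv_of_isOpen isOpen_Ioi).1 h1.2
  exact ⟨h1.1, h2.1, h2.2.continuousOn⟩

lemma IsVerticalCutoff.hasDerivAt (h : IsVerticalCutoff δ C₀ R₀ Rs χ) {z : ℝ} (hz : 0 < z) :
    HasDerivAt χ (deriv χ z) z :=
  (h.contDiffOn_deriv.1.differentiableAt (Ioi_mem_nhds hz)).hasDerivAt

lemma IsVerticalCutoff.hasDerivAt_deriv (h : IsVerticalCutoff δ C₀ R₀ Rs χ) {z : ℝ}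
    (hz : 0 < z) : HasDerivAt (deriv χ) (deriv (deriv χ) z) z :=
  (h.contDiffOn_deriv.2.1.differentiableAt (Ioi_mem_nhds hz)).hasDerivAt

lemma IsVerticalCutoff.deriv_nonpos (h : IsVerticalCutoff δ C₀ R₀ Rs χ) {z : ℝ} (hz : 0 < z) :
    deriv χ z ≤ 0 := by
  have h1 : derivWithin χ (Ici 0) z ≤ 0 := h.antitone.derivWithin_nonpos
  rwa [derivWithin_of_mem_nhds (Ici_mem_nhds hz)] at h1

lemma IsVerticalCutoff.deriv_eq_zero (h : IsVerticalCutoff δ C₀ R₀ Rs χ) {z : ℝ} (hz : 0 < z)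
    (hz' : z < Rs) : deriv χ z = 0 := by
  have : χ =ᶠ[𝓝 z] fun _ => 1 := by
    filter_upwards [Ioo_mem_nhds hz hz'] with w hw using h.eq_one w ⟨hw.1.le, hw.2.le⟩
  rw [this.deriv_eq]; simp

lemma IsVerticalCutoff.deriv_eq_zero_of_ge (hR₀ : 0 < R₀) (hRs : 0 < Rs) (hδ : 1 / 2 < δ)
    (h : IsVerticalCutoff δ C₀ R₀ Rs χ) {z : ℝ} (hz : Rs + R₀ ≤ z) : deriv χ z = 0 := by
  have h1 := h.deriv_le z (by linarith)
  rw [h.eq_zero z hz, Real.zero_rpow (by linarith), mul_zero] at h1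
  exact abs_nonpos_iff.1 h1

/-- The energy `½χ'² - (C₀/R₀²) χ^(2δ)/(2δ)` is nondecreasing, since its derivative is a product of
two nonpositive factors, and it vanishes beyond `Rs + R₀`; so it is nonpositive throughout. The
assumed bound on `χ'` would only give `C₀²` where `C₀` is needed. -/
lemma IsVerticalCutoff.sq_deriv_le (hR₀ : 0 < R₀) (hRs : 0 < Rs) (hδ : 1 / 2 < δ)
    (h : IsVerticalCutoff δ C₀ R₀ Rs χ) {z : ℝ} (hz : 0 < z) :
    deriv χ z ^ 2 ≤ C₀ / R₀ ^ 2 * χ z ^ (2 * δ) / δ := by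
  set E : ℝ → ℝ := fun t => 1 / 2 * deriv χ t ^ 2 - C₀ / R₀ ^ 2 * χ t ^ (2 * δ) / (2 * δ) with hE
  have hd : ∀ t, 0 < t → HasDerivAt E
      (deriv χ t * (deriv (deriv χ) t - C₀ / R₀ ^ 2 * χ t ^ (2 * δ - 1))) t := fun t ht => by
    have h1 := ((h.hasDerivAt_deriv ht).pow 2).const_mul (1 / 2)
    have h2 := (((h.hasDerivAt ht).rpow_const (p := 2 * δ)
      (Or.inr (by linarith))).const_mul (C₀ / R₀ ^ 2)).div_const (2 * δ)
    refine (h1.sub h2).congr_deriv ?_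
    have : δ ≠ 0 := by linarith
    field_simp
    push_cast
    ring
  have hmono : MonotoneOn E (Ioi 0) := by
    refine monotoneOn_of_deriv_nonneg (convex_Ioi 0)
      (fun t ht => (hd t ht).continuousAt.continuousWithinAt)
      (fun t ht => (hd t (interior_subset ht)).differentiableAt.differentiableWithinAt)
      fun t ht => ?_
    have ht0 : 0 < t := interior_subset ht
    rw [(hd t ht0).deriv]
    refine mul_nonneg_of_nonpos_of_nonpos (h.deriv_nonpos ht0) ?_
    have := (abs_le.1 (h.deriv_deriv_le t ht0)).2
    linarith
  have hle : E z ≤ E (z + (Rs + R₀)) :=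
    hmono hz (by show 0 < z + (Rs + R₀); linarith) (by linarith)
  have h0 : E (z + (Rs + R₀)) = 0 := by
    simp only [hE]
    rw [h.deriv_eq_zero_of_ge hR₀ hRs hδ (by linarith), h.eq_zero _ (by linarith),
      Real.zero_rpow (by linarith)]
    simp
  rw [h0] at hle
  simp only [hE] at hle
  have h3 : C₀ / R₀ ^ 2 * χ z ^ (2 * δ) / δ = 2 * (C₀ / R₀ ^ 2 * χ z ^ (2 * δ) / (2 * δ)) := by
    have : δ ≠ 0 := by linarith
    field_simp
  rw [h3]; linarith

/-- The first derivative of the vertical cut-off function is controlled by `z` times the bound on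
the second derivative. -/
lemma IsVerticalCutoff.abs_deriv_le (hC₀ : 0 < C₀) (hR₀ : 0 < R₀) (hRs : 0 < Rs)
    (hδ : 1 / 2 < δ) (hδ1 : δ < 1)
    (h : IsVerticalCutoff δ C₀ R₀ Rs χ) {z : ℝ} (hz : 0 < z) :
    |deriv χ z| ≤ 2 * (C₀ / R₀ ^ 2) * z * χ z ^ (2 * δ - 1) := by
  have hχ0 := h.nonneg hR₀ hRs hz.le
  rcases hχ0.eq_or_lt with h0 | hpos
  · have h1 := h.deriv_le z hz
    rw [← h0, Real.zero_rpow (by linarith), mul_zero] at h1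
    rw [← h0, Real.zero_rpow (by linarith), mul_zero]
    exact h1
  obtain ⟨p, hp⟩ : ∃ p, p = 2 * δ - 1 := ⟨_, rfl⟩
  have hdd : ∀ t, 0 < t → |deriv (deriv χ) t| ≤ C₀ / R₀ ^ 2 * χ t ^ p := fun t ht => by
    rw [hp]; exact h.deriv_deriv_le t ht
  rw [← hp]
  -- The quotient `-χ'/χ^p` is controlled by its derivative: the `χ''` term contributes at most
  -- `C₀/R₀²` by assumption, and the `χ'²` term at most as much again by the energy bound.
  set W : ℝ → ℝ := fun t => -deriv χ t / χ t ^ p with hW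
  -- The starting point lies strictly between 0 and `Rs`, where `χ` is constant and `W` vanishes.
  set t₀ := min Rs z / 2 with ht₀
  have hmin : 0 < min Rs z := lt_min hRs hz
  have ht₀pos : 0 < t₀ := by positivity
  have ht₀R : t₀ < Rs := by
    have := min_le_left Rs z; linarith
  have ht₀z : t₀ ≤ z := by
    have := min_le_right Rs z; linarith
  have hχpos : ∀ t ∈ Icc t₀ z, 0 < χ t := fun t ht =>
    hpos.trans_le (h.antitone (mem_Ici.2 (by linarith [ht.1])) (mem_Ici.2 hz.le) ht.2)
  have hd : ∀ t ∈ Icc t₀ z, HasDerivAt W (-deriv (deriv χ) t / χ t ^ p +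
      p * deriv χ t ^ 2 / χ t ^ (p + 1)) t := fun t ht => by
    have ht0 : 0 < t := by linarith [ht.1]
    have hc := hχpos t ht
    have hc' : 0 < χ t ^ p := Real.rpow_pos_of_pos hc _
    have h1 := (h.hasDerivAt_deriv ht0).neg.div
      ((h.hasDerivAt ht0).rpow_const (p := p) (Or.inl hc.ne')) hc'.ne'
    refine h1.congr_deriv ?_
    rw [Real.rpow_sub_one hc.ne', Real.rpow_add_one hc.ne']
    simp only [Pi.neg_apply]
    field_simp
    ring
  have hWle : W z - W t₀ ≤ 2 * (C₀ / R₀ ^ 2) * (z - t₀) := by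
    refine (convex_Icc t₀ z).image_sub_le_mul_sub_of_deriv_le
      (fun t ht => (hd t ht).continuousAt.continuousWithinAt)
      (fun t ht => (hd t (interior_subset ht)).differentiableAt.differentiableWithinAt)
      (fun t ht => ?_) t₀ ⟨le_rfl, ht₀z⟩ z ⟨ht₀z, le_rfl⟩ ht₀z
    have ht' : t ∈ Icc t₀ z := interior_subset ht
    have ht0 : 0 < t := by linarith [ht'.1]
    have hc := hχpos t ht'
    have hc' : 0 < χ t ^ p := Real.rpow_pos_of_pos hc _
    have hc2 : 0 < χ t ^ (p + 1) := Real.rpow_pos_of_pos hc _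
    rw [(hd t ht').deriv]
    have e1 : -deriv (deriv χ) t / χ t ^ p ≤ C₀ / R₀ ^ 2 := by
      rw [div_le_iff₀ hc']
      have := (abs_le.1 (hdd t ht0)).1
      linarith
    have e2 : p * deriv χ t ^ 2 / χ t ^ (p + 1) ≤ C₀ / R₀ ^ 2 := by
      rw [div_le_iff₀ hc2]
      have h3 := h.sq_deriv_le hR₀ hRs hδ ht0
      rw [show 2 * δ = p + 1 by rw [hp]; ring] at h3
      have hp0 : 0 ≤ p := by rw [hp]; linarith
      -- Here `2δ - 1 ≤ δ` because `δ < 1`.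
      have hpd : p / δ ≤ 1 := by
        rw [div_le_one (by linarith), hp]; linarith
      calc p * deriv χ t ^ 2 ≤ p * (C₀ / R₀ ^ 2 * χ t ^ (p + 1) / δ) := by gcongr
        _ = (C₀ / R₀ ^ 2 * χ t ^ (p + 1)) * (p / δ) := by ring
        _ ≤ C₀ / R₀ ^ 2 * χ t ^ (p + 1) := mul_le_of_le_one_right (by positivity) hpd
    linarith
  have hW0 : W t₀ = 0 := by
    simp only [hW]; rw [h.deriv_eq_zero ht₀pos ht₀R]; simp
  rw [hW0, sub_zero] at hWle
  have hc' : 0 < χ z ^ p := Real.rpow_pos_of_pos hpos _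
  rw [abs_of_nonpos (h.deriv_nonpos hz)]
  have h5 : W z ≤ 2 * (C₀ / R₀ ^ 2) * z := by
    refine hWle.trans ?_
    gcongr
    linarith
  simp only [hW] at h5
  rwa [div_le_iff₀ hc'] at h5

/-- The derivative `(c_α z^b χ')'` of the weighted slope of the vertical cut-off function. -/
noncomputable def vertWeight (α : ℝ) (χ : ℝ → ℝ) (z : ℝ) : ℝ :=
  normConst α * (z ^ (1 - α) * deriv (deriv χ) z + (1 - α) * z ^ (-α) * deriv χ z)

/-- The singular factor `z^(-α) = z^(1-α)/z` is compensated by the factor `z` in the bound on `χ'`.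
The constant 3 is 1 from `χ''` plus 2 from `χ'`, using `|1 - α| ≤ 1`. -/
lemma IsVerticalCutoff.abs_vertWeight_le {α : ℝ} (hα : 0 < α) (hα2 : α < 2)
    (hC₀ : 0 < C₀) (hR₀ : 0 < R₀) (hRs : 0 < Rs)
    (hδ : 1 / 2 < δ) (hδ1 : δ < 1)
    (h : IsVerticalCutoff δ C₀ R₀ Rs χ) {z : ℝ} (hz : 0 < z) :
    |vertWeight α χ z| ≤ weight α z * (3 * (C₀ / R₀ ^ 2) * χ z ^ (2 * δ - 1)) := by
  have hc := normConst_pos hα hα2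
  have h1 := h.deriv_deriv_le z hz
  have h2 := h.abs_deriv_le hC₀ hR₀ hRs hδ hδ1 hz
  have hw : 0 < z ^ (1 - α) := Real.rpow_pos_of_pos hz _
  have hz' : z ^ (-α) = z ^ (1 - α) / z := by
    rw [← Real.rpow_sub_one hz.ne']; congr 1; ring
  have hb : |1 - α| ≤ 1 := abs_le.2 ⟨by linarith, by linarith⟩
  rw [vertWeight, weight_eq, abs_mul, abs_of_pos hc, mul_assoc (normConst α)]
  refine mul_le_mul_of_nonneg_left ?_ hc.le
  calc _ ≤ |z ^ (1 - α) * deriv (deriv χ) z| + |(1 - α) * z ^ (-α) * deriv χ z| := abs_add_le _ _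
    _ = z ^ (1 - α) * |deriv (deriv χ) z| + |1 - α| * (z ^ (1 - α) / z * |deriv χ z|) := by
        rw [abs_mul, abs_mul, abs_mul, hz', abs_of_pos hw, abs_of_pos (div_pos hw hz)]; ring
    _ ≤ z ^ (1 - α) * (C₀ / R₀ ^ 2 * χ z ^ (2 * δ - 1)) +
        1 * (z ^ (1 - α) / z * (2 * (C₀ / R₀ ^ 2) * z * χ z ^ (2 * δ - 1))) := by
        gcongr
    _ = _ := by field_simp; ring

lemma IsVerticalCutoff.hasDerivAt_weight_mul_deriv {α : ℝ}
    (h : IsVerticalCutoff δ C₀ R₀ Rs χ) {z : ℝ} (hz : 0 < z) :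
    HasDerivAt (fun z => weight α z * deriv χ z) (vertWeight α χ z) z := by
  have h1 := ((Real.hasDerivAt_rpow_const (p := 1 - α) (Or.inl hz.ne')).const_mul
    (normConst α)).mul (h.hasDerivAt_deriv hz)
  refine h1.congr_deriv ?_
  rw [vertWeight, show 1 - α - 1 = -α by ring]
  ring

lemma IsVerticalCutoff.continuousOn_vertWeight {α : ℝ}
    (h : IsVerticalCutoff δ C₀ R₀ Rs χ) : ContinuousOn (vertWeight α χ) (Ioi 0) := by
  obtain ⟨-, h2, h3⟩ := h.contDiffOn_deriv
  have hr : ∀ r : ℝ, ContinuousOn (fun z : ℝ => z ^ r) (Ioi 0) := fun r z hz =>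
    (Real.continuousAt_rpow_const z r (Or.inl (ne_of_gt hz))).continuousWithinAt
  exact continuousOn_const.mul (((hr _).mul h3).add ((continuousOn_const.mul (hr _)).mul
    h2.continuousOn))

end Vertical

/-! ### Square integrability of the extension -/

lemma integrable_poissonKernel_one {α : ℝ} (hα : 0 < α) :
    Integrable (fun x : Plane => poissonKernel α x 1) volume := by
  have h := (integrable_rpow_neg_one_add_norm_sq (E := Plane) (μ := volume) (r := 2 + α)
    (by rw [finrank_plane]; push_cast; linarith)).const_mul (α / (2 * Real.pi))
  refine h.congr (ae_of_all _ fun x => ?_)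
  simp only [poissonKernel]
  rw [neg_div, Real.rpow_neg (by positivity), add_comm]
  simp [div_eq_mul_inv]

/-- The kernels at different heights are `L¹`-normalized dilates of one profile, so their mass is
independent of `z`. -/
lemma poissonKernel_scale {α : ℝ} {z : ℝ} (hz : 0 < z) (x : Plane) :
    poissonKernel α x z = (z ^ 2)⁻¹ * poissonKernel α (z⁻¹ • x) 1 := by
  have h1 : ‖x‖ ^ 2 + z ^ 2 = z ^ 2 * (‖z⁻¹ • x‖ ^ 2 + 1 ^ 2) := by
    rw [norm_smul, Real.norm_of_nonneg (by positivity)]; field_simp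
  simp only [poissonKernel]
  rw [h1, Real.mul_rpow (by positivity) (by positivity)]
  have h2 : (z ^ 2) ^ ((2 + α) / 2) = z ^ 2 * z ^ α := by
    rw [← Real.rpow_natCast z 2, ← Real.rpow_mul hz.le, ← Real.rpow_add hz]
    congr 1; push_cast; ring
  have h3 : 0 < z ^ α := Real.rpow_pos_of_pos hz _
  rw [h2, Real.one_rpow]
  field_simp

lemma integrable_poissonKernel {α : ℝ} (hα : 0 < α) {z : ℝ} (hz : 0 < z) :
    Integrable (fun x : Plane => poissonKernel α x z) volume := by
  simp only [poissonKernel_scale hz]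
  exact ((integrable_poissonKernel_one hα).comp_smul (inv_ne_zero hz.ne')).const_mul _

lemma integral_poissonKernel {α : ℝ} {z : ℝ} (hz : 0 < z) :
    ∫ x : Plane, poissonKernel α x z = ∫ x : Plane, poissonKernel α x 1 := by
  simp only [poissonKernel_scale hz]
  rw [integral_const_mul, Measure.integral_comp_smul volume (fun x => poissonKernel α x 1),
    finrank_plane, smul_eq_mul, abs_of_pos (by positivity)]
  field_simp

lemma poissonKernel_nonneg {α : ℝ} (hα : 0 < α) {z : ℝ} (hz : 0 < z) (x : Plane) :
    0 ≤ poissonKernel α x z := by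
  have := Real.pi_pos
  unfold poissonKernel; positivity

/-- Cauchy–Schwarz for the weight `P`: the quadratic `m ↦ ∫ P (f - m)²` is nonnegative, so its
discriminant is not positive. -/
lemma integral_mul_sq_le {X : Type*} [MeasurableSpace X] {μ : Measure X} {P f : X → ℝ}
    (hP : ∀ x, 0 ≤ P x) (h0 : Integrable P μ) (h1 : Integrable (fun x => P x * f x) μ)
    (h2 : Integrable (fun x => P x * f x ^ 2) μ) :
    (∫ x, P x * f x ∂μ) ^ 2 ≤ (∫ x, P x ∂μ) * ∫ x, P x * f x ^ 2 ∂μ := by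
  have key : ∀ m : ℝ, 0 ≤ m * m * (∫ x, P x ∂μ) + m * (-(2 * ∫ x, P x * f x ∂μ)) +
      ∫ x, P x * f x ^ 2 ∂μ := fun m => by
    have e : ∫ x, P x * (f x - m) ^ 2 ∂μ = m * m * (∫ x, P x ∂μ) +
        m * (-(2 * ∫ x, P x * f x ∂μ)) + ∫ x, P x * f x ^ 2 ∂μ := by
      have e1 : ∀ x, P x * (f x - m) ^ 2 = m * m * P x + (-(2 * m)) * (P x * f x) +
          P x * f x ^ 2 := fun x => by ring
      simp only [e1]
      have i1 : Integrable (fun x => m * m * P x + (-(2 * m)) * (P x * f x)) μ :=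
        (h0.const_mul _).add (h1.const_mul _)
      rw [integral_add i1 h2,
        integral_add (h0.const_mul _) (h1.const_mul _), integral_const_mul, integral_const_mul]
      ring
    rw [← e]
    exact integral_nonneg fun x => mul_nonneg (hP x) (sq_nonneg _)
  have := discrim_le_zero (fun m => by have := key m; linarith [this])
    (a := ∫ x, P x ∂μ) (b := -(2 * ∫ x, P x * f x ∂μ)) (c := ∫ x, P x * f x ^ 2 ∂μ)
  rw [discrim] at this
  nlinarith

/-- Young's inequality by Cauchy–Schwarz against the Poisson kernel followed by Fubini. The mass of
the kernel is left unevaluated, since only its independence of `z` matters. -/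
lemma integral_extension_sq_le {α : ℝ} (hα : 0 < α) {f : Plane → ℝ} (hf : MemLp f 2 volume)
    {z : ℝ} (hz : 0 < z) :
    Integrable (fun x => extension α f x z ^ 2) volume ∧
    ∫ x, extension α f x z ^ 2 ≤ (∫ x : Plane, poissonKernel α x 1) ^ 2 * ∫ y, f y ^ 2 := by
  have hPi := integrable_poissonKernel hα hz
  have hfs := hf.integrable_sq
  set A := ∫ x : Plane, poissonKernel α x 1
  have hA : 0 ≤ A := integral_nonneg fun x => poissonKernel_nonneg hα one_pos x
  have hconv := Integrable.convolution_integrand (ContinuousLinearMap.mul ℝ ℝ) hfs hPi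
  have hprod : Integrable (fun p : Plane × Plane => poissonKernel α (p.1 - p.2) z * f p.2 ^ 2)
      (volume.prod volume) := by
    refine hconv.congr (ae_of_all _ fun p => ?_)
    simp [mul_comm]
  have hpt : ∀ᵐ x : Plane, extension α f x z ^ 2 ≤
      A * ∫ y, poissonKernel α (x - y) z * f y ^ 2 := by
    filter_upwards [hprod.prod_right_ae] with x hx
    have h0 : Integrable (fun y => poissonKernel α (x - y) z) volume := hPi.comp_sub_left x
    have := integral_mul_sq_le (fun y => poissonKernel_nonneg hα hz (x - y)) h0
      (integrable_poissonKernel_mul hα hf x hz) hx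
    rwa [integral_sub_left_eq_self (fun y => poissonKernel α y z) volume x,
      integral_poissonKernel hz] at this
  have hbi : Integrable (fun x => A * ∫ y, poissonKernel α (x - y) z * f y ^ 2) volume :=
    hprod.integral_prod_left.const_mul A
  have hFi : Integrable (fun x => extension α f x z ^ 2) volume := by
    refine hbi.mono' ((continuous_extension_slice hα hf hz).pow 2).aestronglyMeasurable ?_
    filter_upwards [hpt] with x hx
    rwa [Real.norm_of_nonneg (sq_nonneg _)]
  refine ⟨hFi, (integral_mono_ae hFi hbi hpt).trans (le_of_eq ?_)⟩
  rw [integral_const_mul, integral_integral_swap hprod]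
  have : ∀ y, ∫ x, poissonKernel α (x - y) z * f y ^ 2 = A * f y ^ 2 := fun y => by
    rw [integral_mul_const, integral_sub_right_eq_self (fun x => poissonKernel α x z) y,
      integral_poissonKernel hz]
  simp only [this]
  rw [integral_const_mul]
  ring

lemma continuousOn_extension {α : ℝ} (hα : 0 < α) {f : Plane → ℝ} (hf : MemLp f 2 volume) :
    ContinuousOn (fun p : Plane × ℝ => extension α f p.1 p.2) (univ ×ˢ Ioi 0) := by
  rintro ⟨x, z⟩ ⟨-, hz⟩
  simp only [extension_eq]
  refine ContinuousAt.continuousWithinAt ?_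
  refine ContinuousAt.mul (continuousAt_const.mul ?_) ?_
  · exact continuousAt_snd.rpow_const (Or.inl (ne_of_gt hz))
  · exact continuousAt_rieszH hf hz (by linarith)

lemma continuousOn_weight (α : ℝ) : ContinuousOn (weight α) (Ioi 0) := fun z hz =>
  (continuousAt_const.mul (Real.continuousAt_rpow_const z (1 - α)
    (Or.inl (ne_of_gt hz)))).continuousWithinAt

lemma integrableOn_weight {α : ℝ} (hα2 : α < 2) (Z : ℝ) :
    IntegrableOn (weight α) (Ioc 0 Z) volume := by
  have : IntervalIntegrable (fun z : ℝ => z ^ (1 - α)) volume 0 Z :=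
    intervalIntegral.intervalIntegrable_rpow' (by linarith)
  exact (this.1).const_mul _

lemma prod_restrict_Ioi : (volume : Measure Plane).prod (volume.restrict (Ioi (0 : ℝ))) =
    ((volume : Measure Plane).prod volume).restrict (univ ×ˢ Ioi 0) := by
  rw [← Measure.prod_restrict, Measure.restrict_univ]

lemma aestronglyMeasurable_of_continuousOn {g : Plane × ℝ → ℝ}
    (hg : ContinuousOn g (univ ×ˢ Ioi 0)) :
    AEStronglyMeasurable g ((volume : Measure Plane).prod (volume.restrict (Ioi (0 : ℝ)))) := by
  rw [prod_restrict_Ioi]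
  exact hg.aestronglyMeasurable (MeasurableSet.univ.prod measurableSet_Ioi)

/-- The bound on horizontal slices is uniform in `z`, and `z^(1-α)` is integrable at 0 because `α <
2`; truncation at `Z` takes care of infinity. -/
lemma weighted_extension_sq {α : ℝ} (hα : 0 < α) (hα2 : α < 2) {f : Plane → ℝ}
    (hf : MemLp f 2 volume) (Z : ℝ) :
    let g := fun p : Plane × ℝ => (Iic Z).indicator (weight α) p.2 * extension α f p.1 p.2 ^ 2
    Integrable g (volume.prod (volume.restrict (Ioi 0))) ∧
    ∫ p, g p ∂(volume.prod (volume.restrict (Ioi 0))) ≤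
      (∫ z in Ioc 0 Z, weight α z) * ((∫ x : Plane, poissonKernel α x 1) ^ 2 * ∫ y, f y ^ 2) := by
  intro g
  set A := (∫ x : Plane, poissonKernel α x 1) ^ 2 * ∫ y, f y ^ 2
  have hwi : IntegrableOn ((Iic Z).indicator (weight α)) (Ioi 0) volume := by
    rw [IntegrableOn, integrable_indicator_iff measurableSet_Iic, IntegrableOn,
      Measure.restrict_restrict measurableSet_Iic, inter_comm, Ioi_inter_Iic]
    exact integrableOn_weight hα2 Z
  have hw0 : ∀ z : ℝ, 0 < z → 0 ≤ (Iic Z).indicator (weight α) z := fun z hz =>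
    indicator_apply_nonneg fun _ => (weight_pos hα hα2 hz).le
  have hm : AEStronglyMeasurable g (volume.prod (volume.restrict (Ioi 0))) :=
    hwi.1.comp_snd.mul (aestronglyMeasurable_of_continuousOn ((continuousOn_extension hα hf).pow 2))
  have hsl : ∀ z : ℝ, 0 < z → ∫ x, ‖g (x, z)‖ ≤ (Iic Z).indicator (weight α) z * A :=
    fun z hz => by
      simp only [g, norm_mul]
      rw [integral_const_mul, Real.norm_of_nonneg (hw0 z hz)]
      refine mul_le_mul_of_nonneg_left ?_ (hw0 z hz)
      simp only [Real.norm_of_nonneg (sq_nonneg _)]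
      exact (integral_extension_sq_le hα hf hz).2
  have hI : Integrable g (volume.prod (volume.restrict (Ioi 0))) := by
    rw [integrable_prod_iff' hm]
    constructor
    · filter_upwards [ae_restrict_mem measurableSet_Ioi] with z hz
      exact (integral_extension_sq_le hα hf hz).1.const_mul ((Iic Z).indicator (weight α) z)
    · refine (hwi.mul_const A).mono' hm.norm.prod_swap.integral_prod_right' ?_
      filter_upwards [ae_restrict_mem measurableSet_Ioi] with z hz
      rw [Real.norm_of_nonneg (integral_nonneg fun x => norm_nonneg _)]
      exact hsl z hz
  refine ⟨hI, ?_⟩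
  rw [integral_prod_symm _ hI]
  calc _ ≤ ∫ z in Ioi (0 : ℝ), (Iic Z).indicator (weight α) z * A := by
        refine integral_mono_ae hI.integral_prod_right (hwi.mul_const A) ?_
        filter_upwards [ae_restrict_mem measurableSet_Ioi] with z hz
        exact (integral_mono_of_nonneg (g := fun x => ‖g (x, z)‖)
          (ae_of_all _ fun x => mul_nonneg (hw0 z hz) (sq_nonneg _))
          ((integral_extension_sq_le hα hf hz).1.const_mul ((Iic Z).indicator (weight α) z)).norm
          (ae_of_all _ fun x => le_abs_self _)).trans (hsl z hz)
    _ = _ := by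
        rw [integral_mul_const, setIntegral_indicator measurableSet_Iic, Ioi_inter_Iic]

end SQG

namespace SQG

/-! ### Differential identities for the extension -/

section Calculus

variable {α : ℝ} {f : Plane → ℝ} {x : Plane} {z : ℝ}

lemma differentiable_extension_slice (hα : 0 < α) (hf : MemLp f 2 volume) (hz : 0 < z) :
    Differentiable ℝ fun y => extension α f y z := fun x => by
  simp only [extension_eq]
  exact (differentiableAt_rieszH hf hz (by linarith)).const_mul _

lemma partialDeriv_const_mul {g : Plane → ℝ} (hg : DifferentiableAt ℝ g x) (r : ℝ) (i : Fin 2) :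
    partialDeriv i (fun y => r * g y) x = r * partialDeriv i g x := by
  rw [partialDeriv, partialDeriv, fderiv_const_mul hg]
  simp

lemma partialDeriv_mul {g h : Plane → ℝ} (hg : DifferentiableAt ℝ g x)
    (hh : DifferentiableAt ℝ h x) (i : Fin 2) :
    partialDeriv i (fun y => g y * h y) x = partialDeriv i g x * h x + g x * partialDeriv i h x := by
  rw [partialDeriv, partialDeriv, partialDeriv, fderiv_fun_mul hg hh]
  simp
  ring

lemma partialDeriv_extension (hα : 0 < α) (hf : MemLp f 2 volume) (hz : 0 < z) (i : Fin 2) :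
    partialDeriv i (fun y => extension α f y z) x =
      -(α / (2 * Real.pi) * z ^ α * (2 + α)) * rieszD i f (2 + α / 2) (x, z) := by
  simp only [extension_eq]
  rw [partialDeriv_const_mul (differentiableAt_rieszH hf hz (by linarith)),
    partialDeriv_rieszH hf hz (by linarith), show (1 : ℝ) + α / 2 + 1 = 2 + α / 2 by ring]
  ring

lemma norm_gradient_sq (g : Plane → ℝ) (x : Plane) :
    ‖gradient g x‖ ^ 2 = ∑ i, partialDeriv i g x ^ 2 := by
  rw [EuclideanSpace.real_norm_sq_eq]
  refine Finset.sum_congr rfl fun i _ => ?_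
  have h : partialDeriv i g x = gradient g x i := by
    rw [partialDeriv, ← inner_gradient_left, EuclideanSpace.inner_single_right]
    simp
  rw [h]

/-- Provides the closed form from which continuity in `(x, z)` and joint measurability with time are
read off. -/
lemma extensionGradSq_eq (hα : 0 < α) (hα2 : α < 2) (hf : MemLp f 2 volume) (hz : 0 < z) :
    extensionGradSq α f x z =
      ∑ i, (-(α / (2 * Real.pi) * z ^ α * (2 + α)) * rieszD i f (2 + α / 2) (x, z)) ^ 2 +
        (conormal α f (x, z) / weight α z) ^ 2 := by
  rw [extensionGradSq, norm_gradient_sq, (hasDerivAt_extension hα hα2 hf hz).deriv]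
  simp only [partialDeriv_extension hα hf hz]

lemma continuousOn_of_forall {g : Plane × ℝ → ℝ}
    (h : ∀ x z, 0 < z → ContinuousAt g (x, z)) : ContinuousOn g (univ ×ˢ Ioi 0) := by
  rintro ⟨x, z⟩ ⟨-, hz⟩
  exact (h x z hz).continuousWithinAt

lemma continuousAt_conormal (hα : 0 < α) (hf : MemLp f 2 volume) (hz : 0 < z) :
    ContinuousAt (conormal α f) (x, z) := by
  have h1 := continuousAt_rieszH (x := x) hf hz (s := 1 + α / 2) (by linarith)
  have h2 := continuousAt_rieszH (x := x) hf hz (s := 2 + α / 2) (by linarith)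
  unfold conormal
  fun_prop

lemma continuousAt_weight_snd (hz : 0 < z) :
    ContinuousAt (fun p : Plane × ℝ => weight α p.2) (x, z) := by
  unfold weight
  exact continuousAt_const.mul (continuousAt_snd.rpow_const (Or.inl (ne_of_gt hz)))

lemma continuousAt_extension (hα : 0 < α) (hf : MemLp f 2 volume) (hz : 0 < z) :
    ContinuousAt (fun p : Plane × ℝ => extension α f p.1 p.2) (x, z) :=
  (continuousOn_extension hα hf).continuousAt
    ((isOpen_univ.prod isOpen_Ioi).mem_nhds ⟨mem_univ _, hz⟩)

lemma continuousOn_extensionGradSq (hα : 0 < α) (hα2 : α < 2) (hf : MemLp f 2 volume) :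
    ContinuousOn (fun p : Plane × ℝ => extensionGradSq α f p.1 p.2) (univ ×ˢ Ioi 0) := by
  have h : ContinuousOn (fun p : Plane × ℝ =>
      ∑ i, (-(α / (2 * Real.pi) * p.2 ^ α * (2 + α)) * rieszD i f (2 + α / 2) p) ^ 2 +
        (conormal α f p / weight α p.2) ^ 2) (univ ×ˢ Ioi 0) := by
    refine continuousOn_of_forall fun x z hz => ?_
    have h1 : ∀ i, ContinuousAt (rieszD i f (2 + α / 2)) (x, z) := fun i =>
      continuousAt_rieszD hf hz i (by linarith)
    have h2 : ContinuousAt (fun p : Plane × ℝ => p.2 ^ α) (x, z) :=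
      continuousAt_snd.rpow_const (Or.inl (ne_of_gt hz))
    have h3 := (continuousAt_conormal (x := x) hα hf hz).div₀ (continuousAt_weight_snd (α := α) hz)
      (weight_pos hα hα2 hz).ne'
    refine ContinuousAt.add (tendsto_finsetSum _ fun i _ => ?_) (h3.pow 2)
    exact (((((continuousAt_const.mul h2).mul continuousAt_const).neg).mul (h1 i)).pow 2)
  refine h.congr fun p hp => ?_
  exact extensionGradSq_eq hα hα2 hf hp.2

lemma integral_mul_partialDeriv {u v : Plane → ℝ} (i : Fin 2) (hu : Differentiable ℝ u)
    (hv : Differentiable ℝ v) (hu' : Continuous (partialDeriv i u))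
    (hv' : Continuous (partialDeriv i v)) (hvc : HasCompactSupport v) :
    ∫ x, u x * partialDeriv i v x = -∫ x, partialDeriv i u x * v x := by
  have hvc' : HasCompactSupport (partialDeriv i v) := hvc.fderiv_apply ℝ _
  refine integral_mul_fderiv_eq_neg_fderiv_mul_of_integrable ?_ ?_ ?_ (fun x _ => hu x)
    (fun x _ => hv x)
  · exact (hu'.mul hv.continuous).integrable_of_hasCompactSupport hvc.mul_left
  · exact (hu.continuous.mul hv').integrable_of_hasCompactSupport hvc'.mul_left
  · exact (hu.continuous.mul hv.continuous).integrable_of_hasCompactSupport hvc.mul_left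

/-- The Laplacian in the plane. -/
noncomputable def planeLaplacian (g : Plane → ℝ) (x : Plane) : ℝ :=
  ∑ i, partialDeriv i (partialDeriv i g) x

lemma contDiff_partialDeriv {g : Plane → ℝ} (hg : ContDiff ℝ ∞ g) (i : Fin 2) :
    ContDiff ℝ ∞ (partialDeriv i g) := by
  unfold partialDeriv
  exact (hg.fderiv_right (m := ∞) (by simp)).clm_apply contDiff_const

lemma continuous_rieszD_slice (hf : MemLp f 2 volume) {s : ℝ} (hs : 3 / 2 ≤ s) (hz : 0 < z)
    (i : Fin 2) : Continuous fun x => rieszD i f s (x, z) :=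
  continuous_iff_continuousAt.2 fun x =>
    (continuousAt_rieszD hf hz i hs).comp (f := fun x : Plane => (x, z)) (by fun_prop)

lemma continuous_rieszDD_slice (hf : MemLp f 2 volume) {s : ℝ} (hs : 2 ≤ s) (hz : 0 < z)
    (i : Fin 2) : Continuous fun x => rieszDD i f s (x, z) :=
  continuous_iff_continuousAt.2 fun x =>
    (continuousAt_rieszDD hf hz i hs).comp (f := fun x : Plane => (x, z)) (by fun_prop)

/-- The horizontal energy identity at height `z`. -/
lemma integral_vertical_second_deriv (hα : 0 < α) (hf : MemLp f 2 volume)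
    (hz : 0 < z) {ψ : Plane → ℝ} (hψ : ContDiff ℝ ∞ ψ) (hψc : HasCompactSupport ψ) :
    ∫ x, -(normConst α * (α / (2 * Real.pi)) * z *
        ((2 + α) ^ 2 * rieszH f (2 + α / 2) (x, z) -
          (2 + α) * (4 + α) * z ^ 2 * rieszH f (3 + α / 2) (x, z))) *
        (extension α f x z * ψ x) =
      weight α z * (∫ x, (∑ i, (-(α / (2 * Real.pi) * z ^ α * (2 + α)) *
        rieszD i f (2 + α / 2) (x, z)) ^ 2) * ψ x) -
      1 / 2 * weight α z * ∫ x, extension α f x z ^ 2 * planeLaplacian ψ x := by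
  set k : ℝ := normConst α * (α / (2 * Real.pi)) * z * (2 + α) with hk
  set a : ℝ := α / (2 * Real.pi) * z ^ α * (2 + α) with ha
  have hwk : weight α z * a = k := by
    have : z ^ (1 - α) * z ^ α = z := by rw [← Real.rpow_add hz]; simp
    rw [weight_eq, ha, hk]
    linear_combination normConst α * (α / (2 * Real.pi)) * (2 + α) * this
  have hs : (3 : ℝ) / 2 ≤ 2 + α / 2 := by linarith
  have hFd := differentiable_extension_slice hα hf hz
  have hF := hFd.continuous
  have hψd : Differentiable ℝ ψ := hψ.differentiable (by simp)
  have hDc := fun i => continuous_rieszD_slice hf hs hz i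
  have hFp : ∀ i, partialDeriv i (fun y => extension α f y z) =
      fun x => -a * rieszD i f (2 + α / 2) (x, z) := fun i =>
    funext fun x => partialDeriv_extension hα hf hz i
  have hψp := fun i => contDiff_partialDeriv hψ i
  have hψpc : ∀ i, HasCompactSupport (partialDeriv i ψ) := fun i => hψc.fderiv_apply ℝ _
  have hDp : ∀ i, partialDeriv i (fun y => rieszD i f (2 + α / 2) (y, z)) = fun x =>
      rieszH f (2 + α / 2) (x, z) - 2 * (2 + α / 2) * rieszDD i f (2 + α / 2 + 1) (x, z) :=
    fun i => funext fun x => partialDeriv_rieszD hf hz hs i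
  have hDpc : ∀ i, Continuous (partialDeriv i (fun y => rieszD i f (2 + α / 2) (y, z))) :=
    fun i => by
      rw [hDp i]
      exact (continuous_rieszH_slice hf (by linarith) hz).sub
        (continuous_const.mul (continuous_rieszDD_slice hf (by linarith) hz i))
  have hFψp : ∀ i, partialDeriv i (fun y => extension α f y z * ψ y) = fun x =>
      -a * rieszD i f (2 + α / 2) (x, z) * ψ x + extension α f x z * partialDeriv i ψ x :=
    fun i => funext fun x => by rw [partialDeriv_mul (hFd x) (hψd x), hFp]
  -- Integration by parts of `∂ᵢDᵢ` against `f* ψ`. As `∂ᵢf* = -a Dᵢ`, this produces the square of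
  -- the horizontal gradient and a cross term with `∂ᵢψ`.
  have e1 : ∀ i, ∫ x, rieszD i f (2 + α / 2) (x, z) *
      (-a * rieszD i f (2 + α / 2) (x, z) * ψ x + extension α f x z * partialDeriv i ψ x) =
      -∫ x, (rieszH f (2 + α / 2) (x, z) - 2 * (2 + α / 2) *
        rieszDD i f (2 + α / 2 + 1) (x, z)) * (extension α f x z * ψ x) := fun i => by
    have := integral_mul_partialDeriv i (u := fun y => rieszD i f (2 + α / 2) (y, z))
      (v := fun y => extension α f y z * ψ y) (fun x => differentiableAt_rieszD hf hz hs i)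
      (hFd.mul hψd) (hDpc i) (by
        rw [hFψp i]
        exact ((continuous_const.mul (hDc i)).mul hψ.continuous).add
          (hF.mul (hψp i).continuous)) hψc.mul_left
    rwa [hFψp i, hDp i] at this
  -- A second integration by parts, of `(f*)²` against `∂ᵢ∂ᵢψ`, identifies the cross term with the
  -- Laplacian error.
  have e2 : ∀ i, ∫ x, extension α f x z ^ 2 * partialDeriv i (partialDeriv i ψ) x =
      2 * a * ∫ x, rieszD i f (2 + α / 2) (x, z) *
        (extension α f x z * partialDeriv i ψ x) := fun i => by
    have hp : partialDeriv i (fun y => extension α f y z * extension α f y z) = fun x =>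
        2 * (extension α f x z * (-a * rieszD i f (2 + α / 2) (x, z))) := funext fun x => by
      rw [partialDeriv_mul (hFd x) (hFd x), hFp]; ring
    have := integral_mul_partialDeriv i (u := fun y => extension α f y z * extension α f y z)
      (v := partialDeriv i ψ) (hFd.mul hFd) ((hψp i).differentiable (by simp)) (by
        rw [hp]
        exact continuous_const.mul (hF.mul (continuous_const.mul (hDc i))))
      (contDiff_partialDeriv (hψp i) i).continuous (hψpc i)
    rw [hp] at this
    simp only [sq]
    rw [this, ← integral_neg, ← integral_const_mul]
    refine integral_congr_ae (ae_of_all _ fun x => ?_)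
    simp only
    ring
  have hI1 : ∀ i, Integrable (fun x => rieszD i f (2 + α / 2) (x, z) ^ 2 * ψ x) volume := fun i =>
    (((hDc i).pow 2).mul hψ.continuous).integrable_of_hasCompactSupport hψc.mul_left
  have hI2 : ∀ i, Integrable (fun x => rieszD i f (2 + α / 2) (x, z) *
      (extension α f x z * partialDeriv i ψ x)) volume := fun i =>
    ((hDc i).mul (hF.mul (hψp i).continuous)).integrable_of_hasCompactSupport
      (HasCompactSupport.mul_left (hψpc i).mul_left)
  have hI3 : ∀ i, Integrable (fun x => (rieszH f (2 + α / 2) (x, z) - 2 * (2 + α / 2) *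
        rieszDD i f (2 + α / 2 + 1) (x, z)) * (extension α f x z * ψ x)) volume := fun i => by
    have h := hDpc i
    rw [hDp i] at h
    exact (h.mul (hF.mul hψ.continuous)).integrable_of_hasCompactSupport
      (HasCompactSupport.mul_left hψc.mul_left)
  have hI4 : ∀ i, Integrable (fun x => extension α f x z ^ 2 *
      partialDeriv i (partialDeriv i ψ) x) volume := fun i =>
    ((hF.pow 2).mul (contDiff_partialDeriv (hψp i) i).continuous).integrable_of_hasCompactSupport
      (HasCompactSupport.mul_left ((hψpc i).fderiv_apply ℝ _))
  -- This is the extension equation `∂_z N = -c_α z^b Δₓ f*` in terms of Riesz integrals: the sum of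
  -- the `∂ᵢDᵢ` is evaluated by `sum_rieszDD`.
  have hleft : ∫ x, -(normConst α * (α / (2 * Real.pi)) * z *
        ((2 + α) ^ 2 * rieszH f (2 + α / 2) (x, z) -
          (2 + α) * (4 + α) * z ^ 2 * rieszH f (3 + α / 2) (x, z))) *
        (extension α f x z * ψ x) = k * ∑ i, ∫ x, (rieszH f (2 + α / 2) (x, z) -
        2 * (2 + α / 2) * rieszDD i f (2 + α / 2 + 1) (x, z)) * (extension α f x z * ψ x) := by
    rw [← integral_finsetSum _ fun i _ => hI3 i, ← integral_const_mul]
    refine integral_congr_ae (ae_of_all _ fun x => ?_)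
    simp only
    rw [← Finset.sum_mul, Finset.sum_sub_distrib, ← Finset.mul_sum,
      sum_rieszDD hf hz (by linarith), show (2 : ℝ) + α / 2 + 1 = 3 + α / 2 by ring]
    simp only [Finset.sum_const, Finset.card_univ, Fintype.card_fin, nsmul_eq_mul, hk]
    push_cast
    ring
  have hg : ∫ x, (∑ i, (-a * rieszD i f (2 + α / 2) (x, z)) ^ 2) * ψ x =
      a ^ 2 * ∑ i, ∫ x, rieszD i f (2 + α / 2) (x, z) ^ 2 * ψ x := by
    rw [← integral_finsetSum _ fun i _ => hI1 i, ← integral_const_mul]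
    refine integral_congr_ae (ae_of_all _ fun x => ?_)
    simp only
    rw [← Finset.sum_mul, ← mul_assoc, Finset.mul_sum]
    congr 1
    exact Finset.sum_congr rfl fun i _ => by ring
  have hl : ∫ x, extension α f x z ^ 2 * planeLaplacian ψ x =
      ∑ i, ∫ x, extension α f x z ^ 2 * partialDeriv i (partialDeriv i ψ) x := by
    rw [← integral_finsetSum _ fun i _ => hI4 i]
    simp only [planeLaplacian, Finset.mul_sum]
  have e3 : ∀ i, ∫ x, (rieszH f (2 + α / 2) (x, z) - 2 * (2 + α / 2) *
        rieszDD i f (2 + α / 2 + 1) (x, z)) * (extension α f x z * ψ x) =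
      a * (∫ x, rieszD i f (2 + α / 2) (x, z) ^ 2 * ψ x) -
        ∫ x, rieszD i f (2 + α / 2) (x, z) * (extension α f x z * partialDeriv i ψ x) :=
    fun i => by
      rw [← neg_eq_iff_eq_neg.2 (e1 i), ← integral_const_mul,
        ← integral_sub ((hI1 i).const_mul _) (hI2 i), ← integral_neg]
      refine integral_congr_ae (ae_of_all _ fun x => ?_)
      simp only
      ring
  rw [hleft, hg, hl]
  simp only [e2, e3]
  rw [Finset.sum_sub_distrib, ← Finset.mul_sum, ← Finset.mul_sum, ← hwk]
  ring

/-! ### Integrals against a horizontal cut-off function -/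

/-- Compactness of the support of `ψ` times `[z/2, 2z]` supplies the dominating constant; no control
at `z = 0` enters. -/
lemma hasDerivAt_integral_mul_cutoff {G G' : Plane → ℝ → ℝ} {ψ : Plane → ℝ}
    (hd : ∀ x z, 0 < z → HasDerivAt (G x) (G' x z) z)
    (hc : ∀ z, 0 < z → Continuous fun x => G x z)
    (hc' : ContinuousOn (fun p : Plane × ℝ => G' p.1 p.2) (univ ×ˢ Ioi 0))
    (hψ : Continuous ψ) (hψc : HasCompactSupport ψ) (hz : 0 < z) :
    HasDerivAt (fun w => ∫ x, G x w * ψ x) (∫ x, G' x z * ψ x) z := by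
  have hK : IsCompact (tsupport ψ ×ˢ Icc (z / 2) (2 * z)) := hψc.isCompact.prod isCompact_Icc
  have hsub : tsupport ψ ×ˢ Icc (z / 2) (2 * z) ⊆ univ ×ˢ Ioi 0 :=
    prod_mono (subset_univ _) fun w hw => by
      have := hw.1
      show 0 < w
      linarith
  obtain ⟨C, hC⟩ := hK.exists_bound_of_continuousOn (hc'.mono hsub)
  have hsl : Continuous fun x => G' x z := by
    rw [← continuousOn_univ]
    exact hc'.comp (f := fun x : Plane => (x, z)) (by fun_prop) fun x _ => ⟨mem_univ _, hz⟩
  refine (hasDerivAt_integral_of_dominated_loc_of_deriv_le (F := fun w x => G x w * ψ x)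
    (F' := fun w x => G' x w * ψ x) (bound := fun x => C * |ψ x|) (s := Ioo (z / 2) (2 * z))
    (Ioo_mem_nhds (by linarith) (by linarith)) ?_ ?_ ?_ ?_ ?_ ?_).2
  · filter_upwards [Ioi_mem_nhds hz] with w hw using ((hc w hw).mul hψ).aestronglyMeasurable
  · exact ((hc z hz).mul hψ).integrable_of_hasCompactSupport hψc.mul_left
  · exact (hsl.mul hψ).aestronglyMeasurable
  · refine ae_of_all _ fun x w hw => ?_
    by_cases hx : x ∈ tsupport ψ
    · rw [norm_mul, Real.norm_eq_abs (ψ x)]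
      exact mul_le_mul_of_nonneg_right (hC (x, w) ⟨hx, hw.1.le, hw.2.le⟩) (abs_nonneg _)
    · simp [image_eq_zero_of_notMem_tsupport hx]
  · exact (hψ.integrable_of_hasCompactSupport hψc).abs.const_mul C
  · refine ae_of_all _ fun x w hw => (hd x w ?_).mul_const _
    linarith [hw.1]

lemma continuousOn_integral_mul_cutoff {G : Plane → ℝ → ℝ} {ψ : Plane → ℝ}
    (hc : ContinuousOn (fun p : Plane × ℝ => G p.1 p.2) (univ ×ˢ Ioi 0))
    (hψ : Continuous ψ) (hψc : HasCompactSupport ψ) :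
    ContinuousOn (fun z => ∫ x, G x z * ψ x) (Ioi 0) := by
  refine continuousOn_integral_of_compact_support (k := tsupport ψ) hψc ?_ fun z x _ hx => ?_
  · have h1 : ContinuousOn (fun p : ℝ × Plane => G p.2 p.1) (Ioi 0 ×ˢ univ) :=
      hc.comp (f := fun p : ℝ × Plane => (p.2, p.1)) (by fun_prop) fun p hp => ⟨mem_univ _, hp.1⟩
    exact h1.mul (hψ.comp continuous_snd).continuousOn
  · simp [image_eq_zero_of_notMem_tsupport hx]

end Calculus

end SQG

namespace SQG

/-! ### The energy identity in the half space -/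

section SliceIdentity

variable {α δ C₀ R₀ Rs : ℝ} {χ : ℝ → ℝ} {f ψ : Plane → ℝ} {c : Plane} {ρ : ℝ}

/-- The localized dissipation density. -/
noncomputable def dissipationDensity (α : ℝ) (f ψ : Plane → ℝ) (χ : ℝ → ℝ) (p : Plane × ℝ) : ℝ :=
  weight α p.2 * extensionGradSq α f p.1 p.2 * (ψ p.1 * χ p.2)

/-- The density of the error created by the gradients of the cut-off functions. -/
noncomputable def cutoffDensity (α : ℝ) (f ψ : Plane → ℝ) (χ : ℝ → ℝ) (p : Plane × ℝ) : ℝ :=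
  1 / 2 * extension α f p.1 p.2 ^ 2 *
    (χ p.2 * weight α p.2 * planeLaplacian ψ p.1 + vertWeight α χ p.2 * ψ p.1)

lemma continuous_planeLaplacian (hψ : ContDiff ℝ ∞ ψ) : Continuous (planeLaplacian ψ) :=
  continuous_finsetSum _ fun i _ =>
    (contDiff_partialDeriv (contDiff_partialDeriv hψ i) i).continuous

lemma hasCompactSupport_planeLaplacian (hψc : HasCompactSupport ψ) :
    HasCompactSupport (planeLaplacian ψ) := by
  have h : ∀ i, HasCompactSupport (partialDeriv i (partialDeriv i ψ)) := fun i =>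
    (hψc.fderiv_apply ℝ _ : HasCompactSupport (partialDeriv i ψ)).fderiv_apply ℝ _
  have : planeLaplacian ψ = fun x => partialDeriv 0 (partialDeriv 0 ψ) x +
      partialDeriv 1 (partialDeriv 1 ψ) x := funext fun x => by
    simp [planeLaplacian, Fin.sum_univ_two]
  rw [this]
  exact (h 0).add (h 1)

/-- Of the two terms in the derivative of `N f*`, the one with `∂_z N` gives the horizontal gradient
and the Laplacian error, while `N ∂_z f* = N²/weight` is the weighted square of the vertical
derivative. -/
lemma hasDerivAt_flux (hα : 0 < α) (hα2 : α < 2) (hf : MemLp f 2 volume) {z : ℝ} (hz : 0 < z)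
    (hψ : ContDiff ℝ ∞ ψ) (hψc : HasCompactSupport ψ) :
    HasDerivAt (fun w => ∫ x, conormal α f (x, w) * extension α f x w * ψ x)
      ((∫ x, weight α z * extensionGradSq α f x z * ψ x) -
        1 / 2 * weight α z * ∫ x, extension α f x z ^ 2 * planeLaplacian ψ x) z := by
  set N' : Plane → ℝ → ℝ := fun x z => -(normConst α * (α / (2 * Real.pi)) * z *
        ((2 + α) ^ 2 * rieszH f (2 + α / 2) (x, z) -
          (2 + α) * (4 + α) * z ^ 2 * rieszH f (3 + α / 2) (x, z))) with hN'
  have hw := weight_pos hα hα2 hz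
  have hcN' : ∀ x z, 0 < z → ContinuousAt (fun p : Plane × ℝ => N' p.1 p.2) (x, z) :=
    fun x z hz => by
      have h1 := continuousAt_rieszH (x := x) hf hz (s := 2 + α / 2) (by linarith)
      have h2 := continuousAt_rieszH (x := x) hf hz (s := 3 + α / 2) (by linarith)
      simp only [hN']
      fun_prop
  have hsl : ∀ {g : Plane × ℝ → ℝ}, (∀ x z, 0 < z → ContinuousAt g (x, z)) →
      Continuous fun x => g (x, z) := fun h => continuous_iff_continuousAt.2 fun x =>
    (h x z hz).comp (f := fun x : Plane => (x, z)) (by fun_prop)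
  have key := hasDerivAt_integral_mul_cutoff (z := z)
    (G := fun x w => conormal α f (x, w) * extension α f x w)
    (G' := fun x z => N' x z * extension α f x z +
      conormal α f (x, z) * (conormal α f (x, z) / weight α z)) (ψ := ψ)
    (fun x z hz => (hasDerivAt_conormal hα hf hz).mul (hasDerivAt_extension hα hα2 hf hz))
    (fun z hz => (continuous_conormal_slice hα hf hz).mul (continuous_extension_slice hα hf hz))
    (continuousOn_of_forall fun x z hz => ((hcN' x z hz).mul
      (continuousAt_extension hα hf hz)).add ((continuousAt_conormal hα hf hz).mul
        ((continuousAt_conormal hα hf hz).div₀ (continuousAt_weight_snd hz)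
          (weight_pos hα hα2 hz).ne'))) hψ.continuous hψc hz
  refine key.congr_deriv ?_
  have hid := integral_vertical_second_deriv hα hf hz hψ hψc
  set B : Plane → ℝ := fun x => ∑ i, (-(α / (2 * Real.pi) * z ^ α * (2 + α)) *
        rieszD i f (2 + α / 2) (x, z)) ^ 2 with hB
  have hBc : Continuous B := continuous_finsetSum _ fun i _ =>
    (continuous_const.mul (continuous_rieszD_slice hf (by linarith) hz i)).pow 2
  have hNc := continuous_conormal_slice hα hf hz
  have hFc := continuous_extension_slice hα hf hz
  have i1 : Integrable (fun x => N' x z * (extension α f x z * ψ x)) volume :=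
    ((hsl hcN').mul (hFc.mul hψ.continuous)).integrable_of_hasCompactSupport
      (HasCompactSupport.mul_left hψc.mul_left)
  have i2 : Integrable (fun x => conormal α f (x, z) ^ 2 / weight α z * ψ x) volume :=
    (((hNc.pow 2).div_const _).mul hψ.continuous).integrable_of_hasCompactSupport hψc.mul_left
  have i3 : Integrable (fun x => weight α z * (B x * ψ x)) volume :=
    (continuous_const.mul (hBc.mul hψ.continuous)).integrable_of_hasCompactSupport
      (HasCompactSupport.mul_left hψc.mul_left)
  have e1 : ∫ x, (N' x z * extension α f x z +
      conormal α f (x, z) * (conormal α f (x, z) / weight α z)) * ψ x =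
      (∫ x, N' x z * (extension α f x z * ψ x)) +
        ∫ x, conormal α f (x, z) ^ 2 / weight α z * ψ x := by
    rw [← integral_add i1 i2]
    refine integral_congr_ae (ae_of_all _ fun x => ?_)
    simp only
    ring
  have e2 : ∫ x, weight α z * extensionGradSq α f x z * ψ x =
      weight α z * (∫ x, B x * ψ x) + ∫ x, conormal α f (x, z) ^ 2 / weight α z * ψ x := by
    rw [← integral_const_mul, ← integral_add i3 i2]
    refine integral_congr_ae (ae_of_all _ fun x => ?_)
    simp only
    rw [extensionGradSq_eq hα hα2 hf hz]
    simp only [hB]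
    field_simp
  rw [e1, e2, hid]
  ring

lemma hasDerivAt_integral_extension_sq (hα : 0 < α) (hα2 : α < 2) (hf : MemLp f 2 volume) {z : ℝ}
    (hz : 0 < z) (hψ : ContDiff ℝ ∞ ψ) (hψc : HasCompactSupport ψ) :
    HasDerivAt (fun w => ∫ x, extension α f x w ^ 2 * ψ x)
      (2 / weight α z * ∫ x, conormal α f (x, z) * extension α f x z * ψ x) z := by
  have key := hasDerivAt_integral_mul_cutoff (z := z)
    (G := fun x w => extension α f x w ^ 2)
    (G' := fun x z => 2 * extension α f x z * (conormal α f (x, z) / weight α z)) (ψ := ψ)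
    (fun x z hz => by
      refine ((hasDerivAt_extension hα hα2 hf hz).pow 2).congr_deriv ?_
      push_cast; ring)
    (fun z hz => (continuous_extension_slice hα hf hz).pow 2)
    (continuousOn_of_forall fun x z hz => (continuousAt_const.mul
      (continuousAt_extension hα hf hz)).mul ((continuousAt_conormal hα hf hz).div₀
        (continuousAt_weight_snd hz) (weight_pos hα hα2 hz).ne')) hψ.continuous hψc hz
  refine key.congr_deriv ?_
  rw [← integral_const_mul]
  refine integral_congr_ae (ae_of_all _ fun x => ?_)
  simp only
  ring

lemma continuousOn_dissipationDensity (hα : 0 < α) (hα2 : α < 2) (hf : MemLp f 2 volume)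
    (hψ : Continuous ψ) (hχ : IsVerticalCutoff δ C₀ R₀ Rs χ) :
    ContinuousOn (dissipationDensity α f ψ χ) (univ ×ˢ Ioi 0) := by
  have h2 : MapsTo (Prod.snd : Plane × ℝ → ℝ) (univ ×ˢ Ioi 0) (Ioi 0) := fun p hp => hp.2
  have h1 : ContinuousOn χ (Ioi 0) := hχ.contDiffOn_deriv.1.continuousOn
  exact (((continuousOn_weight α).comp continuousOn_snd h2).mul
    (continuousOn_extensionGradSq hα hα2 hf)).mul ((hψ.comp continuous_fst).continuousOn.mul
      (h1.comp continuousOn_snd h2))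

lemma continuousOn_cutoffDensity (hα : 0 < α) (hf : MemLp f 2 volume)
    (hψ : ContDiff ℝ ∞ ψ) (hχ : IsVerticalCutoff δ C₀ R₀ Rs χ) :
    ContinuousOn (cutoffDensity α f ψ χ) (univ ×ˢ Ioi 0) := by
  have h2 : MapsTo (Prod.snd : Plane × ℝ → ℝ) (univ ×ˢ Ioi 0) (Ioi 0) := fun p hp => hp.2
  have h1 : ContinuousOn χ (Ioi 0) := hχ.contDiffOn_deriv.1.continuousOn
  have hw := (continuousOn_weight α).comp (continuousOn_snd (α := Plane)) h2
  have hv := (hχ.continuousOn_vertWeight (α := α)).comp (continuousOn_snd (α := Plane)) h2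
  exact (continuousOn_const.mul ((continuousOn_extension hα hf).pow 2)).mul
    ((((h1.comp continuousOn_snd h2).mul hw).mul
      ((continuous_planeLaplacian hψ).comp continuous_fst).continuousOn).add
      (hv.mul (hψ.continuous.comp continuous_fst).continuousOn))

/-- Both parts of the density are at most a constant times the weight and vanish above `Rs + R₀`, so
the truncated weighted `L²` bound applies. -/
lemma integrable_cutoffDensity (hα : 0 < α) (hα2 : α < 2) (hf : MemLp f 2 volume)
    (hC₀ : 0 < C₀) (hR₀ : 0 < R₀) (hRs : 0 < Rs) (hδ : 1 / 2 < δ) (hδ1 : δ < 1)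
    (hψ : ContDiff ℝ ∞ ψ) (hψc : HasCompactSupport ψ) (hχ : IsVerticalCutoff δ C₀ R₀ Rs χ) :
    Integrable (cutoffDensity α f ψ χ) (volume.prod (volume.restrict (Ioi 0))) := by
  obtain ⟨A, hA⟩ := (continuous_planeLaplacian hψ).bounded_above_of_compact_support
    (hasCompactSupport_planeLaplacian hψc)
  obtain ⟨B, hB⟩ := hψ.continuous.bounded_above_of_compact_support hψc
  have hA0 : 0 ≤ A := (norm_nonneg _).trans (hA 0)
  have hB0 : 0 ≤ B := (norm_nonneg _).trans (hB 0)
  set M := 1 / 2 * (A + 3 * (C₀ / R₀ ^ 2) * B) with hM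
  refine ((weighted_extension_sq hα hα2 hf (Rs + R₀)).1.const_mul M).mono'
    (aestronglyMeasurable_of_continuousOn (continuousOn_cutoffDensity hα hf hψ hχ)) ?_
  rw [prod_restrict_Ioi]
  filter_upwards [ae_restrict_mem (MeasurableSet.univ.prod measurableSet_Ioi)] with ⟨x, z⟩ hp
  have hz : 0 < z := hp.2
  have hv := hχ.abs_vertWeight_le hα hα2 hC₀ hR₀ hRs hδ hδ1 hz
  have hw := weight_pos hα hα2 hz
  have hχ0 := hχ.nonneg hR₀ hRs hz.le
  have hχ1 := hχ.le_one hRs hz.le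
  simp only [cutoffDensity]
  rcases le_or_gt z (Rs + R₀) with h | h
  · rw [indicator_of_mem (mem_Iic.2 h), norm_mul, Real.norm_of_nonneg (by positivity)]
    have hb : ‖χ z * weight α z * planeLaplacian ψ x + vertWeight α χ z * ψ x‖ ≤
        weight α z * (A + 3 * (C₀ / R₀ ^ 2) * B) := by
      have hp1 : χ z ^ (2 * δ - 1) ≤ 1 := Real.rpow_le_one hχ0 hχ1 (by linarith)
      have hp0 : 0 ≤ χ z ^ (2 * δ - 1) := Real.rpow_nonneg hχ0 _
      calc _ ≤ ‖χ z * weight α z * planeLaplacian ψ x‖ + ‖vertWeight α χ z * ψ x‖ :=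
            norm_add_le _ _
        _ = χ z * weight α z * ‖planeLaplacian ψ x‖ + |vertWeight α χ z| * ‖ψ x‖ := by
            rw [norm_mul (χ z * weight α z), norm_mul (vertWeight α χ z), Real.norm_of_nonneg (by positivity : 0 ≤ χ z * weight α z),
              Real.norm_eq_abs (vertWeight α χ z)]
        _ ≤ 1 * weight α z * A + (weight α z * (3 * (C₀ / R₀ ^ 2) * 1)) * B := by
            gcongr
            · exact hA x
            · exact hv.trans (by gcongr)
            · exact hB x
        _ = _ := by ring
    calc _ ≤ 1 / 2 * extension α f x z ^ 2 * (weight α z * (A + 3 * (C₀ / R₀ ^ 2) * B)) := by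
          gcongr
      _ = _ := by rw [hM]; ring
  · rw [indicator_of_notMem (by simpa using h)]
    rw [hχ.eq_zero z h.le, Real.zero_rpow (by linarith)] at hv
    have : vertWeight α χ z = 0 := abs_nonpos_iff.1 (by simpa using hv)
    rw [this, hχ.eq_zero z h.le]
    simp

/-- The energy identity for the extension, localized by the cut-off function `ψ(x) χ(z)`. -/
theorem integral_dissipationDensity (hα : 0 < α) (hα2 : α < 2) (hf : MemLp f 2 volume)
    (hC₀ : 0 < C₀) (hR₀ : 0 < R₀) (hRs : 0 < Rs) (hδ : 1 / 2 < δ) (hδ1 : δ < 1)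
    (hfs : ContDiffOn ℝ ∞ f (ball c ρ)) (hψ : ContDiff ℝ ∞ ψ) (hψ0 : ∀ x, 0 ≤ ψ x)
    (hs : tsupport ψ ⊆ ball c ρ) (hχ : IsVerticalCutoff δ C₀ R₀ Rs χ) :
    Integrable (dissipationDensity α f ψ χ) (volume.prod (volume.restrict (Ioi 0))) ∧
    ∫ p, dissipationDensity α f ψ χ p ∂(volume.prod (volume.restrict (Ioi 0))) =
      (∫ x, f x * fracLaplacian α (fun y => ψ y * f y) x) +
        ∫ p, cutoffDensity α f ψ χ p ∂(volume.prod (volume.restrict (Ioi 0))) := by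
  have hψc := hasCompactSupport_of_tsupport_subset_ball hs
  have hV := integrable_cutoffDensity hα hα2 hf hC₀ hR₀ hRs hδ hδ1 hψ hψc hχ
  set Z := Rs + R₀ with hZ
  have hZ0 : 0 < Z := by positivity
  set J : ℝ → ℝ := fun w => ∫ x, conormal α f (x, w) * extension α f x w * ψ x with hJ
  set Q : ℝ → ℝ := fun w => ∫ x, extension α f x w ^ 2 * ψ x with hQ
  set L : ℝ → ℝ := fun w => ∫ x, extension α f x w ^ 2 * planeLaplacian ψ x with hL
  set D : ℝ → ℝ := fun w => ∫ x, weight α w * extensionGradSq α f x w * ψ x with hD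
  set R : ℝ → ℝ := fun w => 1 / 2 * (χ w * weight α w * L w + vertWeight α χ w * Q w) with hR
  have hFsq : ContinuousOn (fun p : Plane × ℝ => extension α f p.1 p.2 ^ 2) (univ ×ˢ Ioi 0) :=
    (continuousOn_extension hα hf).pow 2
  have hχc : ContinuousOn χ (Ioi 0) := hχ.contDiffOn_deriv.1.continuousOn
  have hQc : ContinuousOn Q (Ioi 0) := continuousOn_integral_mul_cutoff hFsq hψ.continuous hψc
  have hLc : ContinuousOn L (Ioi 0) := continuousOn_integral_mul_cutoff hFsq
    (continuous_planeLaplacian hψ) (hasCompactSupport_planeLaplacian hψc)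
  have hwc : ContinuousOn (fun p : Plane × ℝ => weight α p.2) (univ ×ˢ Ioi 0) :=
    (continuousOn_weight α).comp continuousOn_snd fun p hp => hp.2
  have hDc : ContinuousOn D (Ioi 0) := continuousOn_integral_mul_cutoff
    (G := fun x z => weight α z * extensionGradSq α f x z)
    (hwc.mul (continuousOn_extensionGradSq hα hα2 hf)) hψ.continuous hψc
  have hRc : ContinuousOn R (Ioi 0) := continuousOn_const.mul
    (((hχc.mul (continuousOn_weight α)).mul hLc).add (hχ.continuousOn_vertWeight.mul hQc))
  -- The subtracted term integrates the cross term `χ' J` by parts, since `J` is half the weight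
  -- times the derivative of `Q`. The derivative of `Y` then contains only the dissipation and the
  -- cut-off error.
  set Y : ℝ → ℝ := fun w => χ w * J w - 1 / 2 * (weight α w * deriv χ w * Q w) with hY
  have hYd : ∀ z, 0 < z → HasDerivAt Y (χ z * D z - R z) z := fun z hz => by
    have h1 := (hχ.hasDerivAt hz).mul (hasDerivAt_flux hα hα2 hf hz hψ hψc)
    have h2 := ((hχ.hasDerivAt_weight_mul_deriv (α := α) hz).mul
      (hasDerivAt_integral_extension_sq hα hα2 hf hz hψ hψc)).const_mul (1 / 2)
    refine (h1.sub h2).congr_deriv ?_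
    have := (weight_pos hα hα2 hz).ne'
    simp only [hR, hD, hL, hQ]
    field_simp
    ring
  have hRV : ∀ z, 0 < z → ∫ x, cutoffDensity α f ψ χ (x, z) = R z := fun z hz => by
    have hFc := (continuous_extension_slice hα hf hz).pow 2
    have i1 : Integrable (fun x => extension α f x z ^ 2 * planeLaplacian ψ x) volume :=
      (hFc.mul (continuous_planeLaplacian hψ)).integrable_of_hasCompactSupport
        (hasCompactSupport_planeLaplacian hψc).mul_left
    have i2 : Integrable (fun x => extension α f x z ^ 2 * ψ x) volume :=
      (hFc.mul hψ.continuous).integrable_of_hasCompactSupport hψc.mul_left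
    simp only [hR, hL, hQ]
    rw [← integral_const_mul, ← integral_const_mul, ← integral_add (i1.const_mul _)
      (i2.const_mul _), ← integral_const_mul]
    refine integral_congr_ae (ae_of_all _ fun x => ?_)
    simp only [cutoffDensity]
    ring
  have hRi : IntegrableOn R (Ioi 0) volume := by
    refine hV.integral_prod_right.congr ?_
    filter_upwards [ae_restrict_mem measurableSet_Ioi] with z hz using hRV z hz
  have hDi : ∀ ε, 0 < ε → ContinuousOn (fun z => χ z * D z) (Icc ε Z) := fun ε hε =>
    (hχc.mul hDc).mono fun z hz => hε.trans_le hz.1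
  have hD0 : ∀ z, 0 < z → 0 ≤ χ z * D z := fun z hz =>
    mul_nonneg (hχ.nonneg hR₀ hRs hz.le) (integral_nonneg fun x =>
      mul_nonneg (mul_nonneg (weight_pos hα hα2 hz).le
        (add_nonneg (sq_nonneg _) (sq_nonneg _))) (hψ0 x))
  have hYZ : Y Z = 0 := by
    simp only [hY]
    rw [hχ.eq_zero Z le_rfl, hχ.deriv_eq_zero_of_ge hR₀ hRs hδ le_rfl]
    ring
  -- Below `Rs` the cut-off is constant, so the boundary value of `Y` at 0 is that of `J`.
  have hYJ : ∀ z ∈ Ioo 0 Rs, Y z = J z := fun z hz => by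
    simp only [hY]
    rw [hχ.eq_one z ⟨hz.1.le, hz.2.le⟩, hχ.deriv_eq_zero hz.1 hz.2]
    ring
  have hJt : Tendsto J (𝓝[>] 0) (𝓝 (-∫ x, f x * fracLaplacian α (fun y => ψ y * f y) x)) := by
    have := tendsto_integral_conormal hα hα2 hf hfs hψ hs
    simpa only [hJ, mul_assoc] using this
  have hftc : ∀ ε, 0 < ε → ε < Rs →
      ∫ z in Ioc ε Z, χ z * D z = -J ε + ∫ z in Ioc ε Z, R z := fun ε hε hεR => by
    have hle : ε ≤ Z := by linarith
    have hRi' : IntervalIntegrable R volume ε Z :=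
      (hRc.mono fun z hz => by
        rw [uIcc_of_le hle] at hz; exact hε.trans_le hz.1).intervalIntegrable
    have hDi' : IntervalIntegrable (fun z => χ z * D z) volume ε Z := by
      refine ContinuousOn.intervalIntegrable ?_
      rw [uIcc_of_le hle]; exact hDi ε hε
    have := intervalIntegral.integral_eq_sub_of_hasDerivAt (a := ε) (b := Z) (f := Y)
      (fun z hz => hYd z (by rw [uIcc_of_le hle] at hz; exact hε.trans_le hz.1))
      (hDi'.sub hRi')
    rw [intervalIntegral.integral_sub hDi' hRi', hYZ, hYJ ε ⟨hε, hεR⟩,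
      intervalIntegral.integral_of_le hle, intervalIntegral.integral_of_le hle] at this
    linarith
  -- Finiteness of the energy down to the boundary is a conclusion: the integrand is nonnegative and
  -- its integrals over `(ε, Z]` are bounded, because `J` converges and `R` is integrable.
  have hχDi : IntegrableOn (fun z => χ z * D z) (Ioc 0 Z) volume := by
    obtain ⟨B, hB⟩ : ∃ B, ∀ᶠ ε in 𝓝[>] (0 : ℝ), -J ε ≤ B :=
      ⟨_, (hJt.neg).eventually (eventually_le_nhds (lt_add_one _))⟩
    -- The criterion wants integrability on `(a ε, Z]` for every `ε`. The lower limit is therefore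
    -- set to 1 for nonpositive `ε`, and equals `ε` along the filter.
    refine integrableOn_Ioc_of_intervalIntegral_norm_bounded_left (l := 𝓝[>] (0 : ℝ))
      (a := fun ε => max ε 0 + if ε ≤ 0 then 1 else 0)
      (I := B + ∫ z in Ioi (0 : ℝ), ‖R z‖) (fun ε => ?_) ?_ ?_
    · refine ((hDi _ ?_).integrableOn_Icc).mono_set Ioc_subset_Icc_self
      split_ifs with h
      · positivity
      · rw [add_zero]; exact lt_max_of_lt_left (not_le.1 h)
    · have : Tendsto (fun ε : ℝ => ε) (𝓝[>] 0) (𝓝 0) := tendsto_id.mono_left nhdsWithin_le_nhds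
      refine this.congr' ?_
      filter_upwards [self_mem_nhdsWithin] with ε hε
      have hε' : 0 < ε := hε
      rw [if_neg (not_le.2 hε'), max_eq_left hε'.le, add_zero]
    · filter_upwards [hB, Ioo_mem_nhdsGT hRs] with ε hBε hε
      rw [if_neg (not_le.2 hε.1), max_eq_left hε.1.le, add_zero]
      have e : ∫ z in Ioc ε Z, ‖χ z * D z‖ = ∫ z in Ioc ε Z, χ z * D z :=
        setIntegral_congr_fun measurableSet_Ioc fun z hz =>
          Real.norm_of_nonneg (hD0 z (hε.1.trans hz.1))
      rw [e, hftc ε hε.1 hε.2]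
      refine add_le_add hBε ?_
      have hsub : Ioc ε Z ⊆ Ioi 0 := fun z hz => hε.1.trans hz.1
      calc ∫ z in Ioc ε Z, R z ≤ ∫ z in Ioc ε Z, ‖R z‖ :=
            integral_mono (hRi.mono_set hsub) (hRi.mono_set hsub).norm fun z => le_abs_self _
        _ ≤ _ := setIntegral_mono_set hRi.norm (ae_of_all _ fun z => norm_nonneg _)
            hsub.eventuallyLE
  have hlim : ∫ z in (0 : ℝ)..Z, (χ z * D z - R z) =
      ∫ x, f x * fracLaplacian α (fun y => ψ y * f y) x := by
    have hi1 : IntervalIntegrable (fun z => χ z * D z) volume 0 Z :=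
      (intervalIntegrable_iff_integrableOn_Ioc_of_le hZ0.le).2 hχDi
    have hi2 : IntervalIntegrable R volume 0 Z :=
      (intervalIntegrable_iff_integrableOn_Ioc_of_le hZ0.le).2
        (hRi.mono_set Ioc_subset_Ioi_self)
    have := intervalIntegral.integral_eq_sub_of_hasDerivAt_of_tendsto (f := Y) hZ0
      (fun z hz => hYd z hz.1) (hi1.sub hi2)
      (hJt.congr' (by
        filter_upwards [Ioo_mem_nhdsGT hRs] with z hz using (hYJ z hz).symm))
      (((hYd Z hZ0).continuousAt.tendsto).mono_left nhdsWithin_le_nhds)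
    rw [this, hYZ]; ring
  have hzero : ∀ z ∈ Ioi 0 \ Ioc 0 Z, χ z = 0 := fun z hz =>
    hχ.eq_zero z (not_lt.1 fun h => hz.2 ⟨hz.1, h.le⟩)
  have hχDi' : IntegrableOn (fun z => χ z * D z) (Ioi 0) volume :=
    hχDi.of_forall_sdiff_eq_zero measurableSet_Ioi fun z hz => by rw [hzero z hz, zero_mul]
  have hDE : ∀ z, 0 < z → ∫ x, dissipationDensity α f ψ χ (x, z) = χ z * D z := fun z hz => by
    simp only [hD]
    rw [← integral_const_mul]
    refine integral_congr_ae (ae_of_all _ fun x => ?_)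
    simp only [dissipationDensity]
    ring
  have hm := aestronglyMeasurable_of_continuousOn
    (continuousOn_dissipationDensity hα hα2 hf hψ.continuous hχ)
  have hE0 : ∀ x z, 0 < z → 0 ≤ dissipationDensity α f ψ χ (x, z) := fun x z hz =>
    mul_nonneg (mul_nonneg (weight_pos hα hα2 hz).le
      (add_nonneg (sq_nonneg _) (sq_nonneg _)))
      (mul_nonneg (hψ0 x) (hχ.nonneg hR₀ hRs hz.le))
  have hEi : Integrable (dissipationDensity α f ψ χ) (volume.prod (volume.restrict (Ioi 0))) := by
    rw [integrable_prod_iff' hm]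
    constructor
    · filter_upwards [ae_restrict_mem measurableSet_Ioi] with z hz
      have hc : Continuous fun x => dissipationDensity α f ψ χ (x, z) := by
        rw [← continuousOn_univ]
        exact (continuousOn_dissipationDensity hα hα2 hf hψ.continuous hχ).comp
          (f := fun x : Plane => (x, z)) (by fun_prop) fun x _ => ⟨mem_univ _, hz⟩
      refine hc.integrable_of_hasCompactSupport (hψc.mono' fun x hx => subset_tsupport ψ ?_)
      intro h0
      exact hx (by simp [dissipationDensity, h0])
    · refine hχDi'.congr ?_
      filter_upwards [ae_restrict_mem measurableSet_Ioi] with z hz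
      rw [← hDE z hz]
      exact integral_congr_ae (ae_of_all _ fun x => (Real.norm_of_nonneg (hE0 x z hz)).symm)
  refine ⟨hEi, ?_⟩
  rw [integral_prod_symm _ hEi, integral_prod_symm _ hV, setIntegral_congr_fun measurableSet_Ioi
    (fun z hz => hDE z hz), setIntegral_congr_fun measurableSet_Ioi (fun z hz => hRV z hz),
    ← hlim, intervalIntegral.integral_of_le hZ0.le,
    integral_sub hχDi (hRi.mono_set Ioc_subset_Ioi_self)]
  have e1 : ∫ z in Ioi 0, χ z * D z = ∫ z in Ioc 0 Z, χ z * D z :=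
    (setIntegral_eq_of_subset_of_forall_sdiff_eq_zero measurableSet_Ioi Ioc_subset_Ioi_self
      fun z hz => by rw [hzero z hz, zero_mul])
  have e2 : ∫ z in Ioi 0, R z = ∫ z in Ioc 0 Z, R z :=
    (setIntegral_eq_of_subset_of_forall_sdiff_eq_zero measurableSet_Ioi Ioc_subset_Ioi_self
      fun z hz => by
        have hv := hχ.abs_vertWeight_le hα hα2 hC₀ hR₀ hRs hδ hδ1 hz.1
        rw [hzero z hz, Real.zero_rpow (by linarith)] at hv
        have : vertWeight α χ z = 0 := abs_nonpos_iff.1 (by simpa using hv)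
        simp only [hR]
        rw [this, hzero z hz]; ring)
  rw [e1, e2]
  ring

end SliceIdentity

end SQG

namespace SQG

/-! ### Covers and their cut-off functions -/

section Covers

variable {δ C₀ R₀ R Rs : ℝ} {x₀ : Plane} {ψ₀ : Plane → ℝ} {K₁ K₂ : ℕ} {n : ℕ}
  {c : Fin n → Plane} {ψ : Fin n → Plane → ℝ}

lemma IsCover.card_pos (h : IsCover K₁ K₂ x₀ R₀ R n c) : 0 < (n : ℝ) :=
  lt_of_lt_of_le (by have := h.scale_pos; have := h.scale_le; have : 0 < R₀ := by linarith
                     positivity) h.le_card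

lemma volume_line (a b : Plane) : volume (line[ℝ, a, b] : Set Plane) = 0 := by
  refine Measure.addHaar_affineSubspace volume _ fun htop => ?_
  have h1 : (line[ℝ, a, b]).direction = ⊤ := by rw [htop, AffineSubspace.direction_top]
  rw [direction_affineSpan, vectorSpan_pair] at h1
  have h2 := finrank_span_le_card (R := ℝ) ({a -ᵥ b} : Set Plane)
  rw [h1, finrank_top, finrank_plane] at h2
  simp at h2

/-- The inclusion of balls forces `|y - x₀| + r ≤ R₀`, so a common boundary point gives equality in
the triangle inequality and is collinear with the centres. -/
lemma mem_line_of_tangent {y p : Plane} {r : ℝ} (hr : 0 < r) (hyx : y ≠ x₀)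
    (hsub : ball y r ⊆ ball x₀ R₀) (hp : dist p y ≤ r) (hpx : dist p x₀ = R₀) :
    p ∈ line[ℝ, x₀, y] := by
  have hd : 0 < dist y x₀ := dist_pos.2 hyx
  have hcl : closedBall y r ⊆ closedBall x₀ R₀ := by
    rw [← closure_ball y hr.ne']
    exact closure_minimal (hsub.trans ball_subset_closedBall) isClosed_closedBall
  have hq : y + (r / dist y x₀) • (y - x₀) ∈ closedBall x₀ R₀ := hcl (by
    rw [mem_closedBall, dist_eq_norm, add_sub_cancel_left, norm_smul, ← dist_eq_norm,
      Real.norm_of_nonneg (by positivity), div_mul_cancel₀ _ hd.ne'])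
  have hq' : dist y x₀ + r ≤ R₀ := by
    have e : y + (r / dist y x₀) • (y - x₀) - x₀ = (1 + r / dist y x₀) • (y - x₀) := by
      module
    rw [mem_closedBall, dist_eq_norm, e, norm_smul, ← dist_eq_norm,
      Real.norm_of_nonneg (by positivity)] at hq
    have : (1 + r / dist y x₀) * dist y x₀ = dist y x₀ + r := by field_simp
    linarith
  have htri := dist_triangle p y x₀
  have heq : dist x₀ y + dist y p = dist x₀ p := by
    rw [dist_comm x₀ y, dist_comm y p, dist_comm x₀ p]; linarith
  exact (dist_add_dist_eq_iff.1 heq).right_mem_affineSpan_of_left_ne hyx.symm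

/-- Intermediate value theorem along the ray beyond `∂B(x₀, R₀)`: the distance to `y` starts at most
`r` and eventually exceeds it. -/
lemma exists_ray_mem_sphere {x y : Plane} {r : ℝ} (hx : R₀ ≤ dist x x₀) (hR₀ : 0 < R₀)
    (hp : dist (x₀ + (R₀ / dist x x₀) • (x - x₀)) y ≤ r) :
    ∃ s : ℝ, 0 ≤ s ∧ x₀ + s • (x - x₀) ∈ sphere y r ∩ (ball x₀ R₀)ᶜ := by
  have hd : 0 < dist x x₀ := hR₀.trans_le hx
  have hr : 0 ≤ r := dist_nonneg.trans hp
  have hdist : ∀ s : ℝ, 0 ≤ s → dist (x₀ + s • (x - x₀)) x₀ = s * dist x x₀ := fun s hs => by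
    rw [dist_eq_norm, add_sub_cancel_left, norm_smul, ← dist_eq_norm, Real.norm_of_nonneg hs]
  set s₁ := (R₀ + r + dist y x₀) / dist x x₀ with hs₁
  have hs₁0 : 0 ≤ s₁ := by positivity
  have hle : R₀ / dist x x₀ ≤ s₁ := by
    rw [hs₁]; gcongr; linarith [dist_nonneg (x := y) (y := x₀)]
  have hc : ContinuousOn (fun s : ℝ => dist (x₀ + s • (x - x₀)) y) (Icc (R₀ / dist x x₀) s₁) :=
    (by fun_prop : Continuous fun s : ℝ => dist (x₀ + s • (x - x₀)) y).continuousOn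
  have hfar : r ≤ dist (x₀ + s₁ • (x - x₀)) y := by
    have h1 := dist_triangle (x₀ + s₁ • (x - x₀)) y x₀
    rw [hdist s₁ hs₁0, hs₁, div_mul_cancel₀ _ hd.ne'] at h1
    linarith
  obtain ⟨s, hs, hsr⟩ := intermediate_value_Icc hle hc ⟨hp, hfar⟩
  have hs0 : 0 ≤ s := le_trans (by positivity) hs.1
  refine ⟨s, hs0, hsr, ?_⟩
  rw [mem_compl_iff, mem_ball, not_lt, hdist s hs0, ← div_le_iff₀ hd]
  exact hs.1

/-- The boundary point of the macro-scale ball in the direction of `x` lies in one of the closed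
balls of the cover. -/
lemma IsCover.exists_dist_le (h : IsCover K₁ K₂ x₀ R₀ R n c) {x : Plane}
    (hx : R₀ ≤ dist x x₀) (hR₀ : 0 < R₀) :
    ∃ i, dist (x₀ + (R₀ / dist x x₀) • (x - x₀)) (c i) ≤ R := by
  have hd : 0 < dist x x₀ := hR₀.trans_le hx
  have hF : IsClosed (⋃ i, closedBall (c i) R) :=
    isClosed_iUnion_of_finite fun i => isClosed_closedBall
  have hsub : closedBall x₀ R₀ ⊆ ⋃ i, closedBall (c i) R := by
    rw [← closure_ball x₀ hR₀.ne']
    exact closure_minimal (h.covers.trans (iUnion_mono fun i => ball_subset_closedBall)) hF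
  have hp : x₀ + (R₀ / dist x x₀) • (x - x₀) ∈ closedBall x₀ R₀ := by
    rw [mem_closedBall, dist_eq_norm, add_sub_cancel_left, norm_smul, ← dist_eq_norm,
      Real.norm_of_nonneg (by positivity), div_mul_cancel₀ _ hd.ne']
  simpa using hsub hp

/-- Inside `B(x₀, R₀)` a covering ball has cut-off 1. In the annulus the radial projection of `x`
lies in a closed ball of the cover; if that ball leaves `B(x₀, R₀)`, then `x` is in its sector,
where the cut-off is `ψ₀`. An internally tangent ball would put `x` on an excluded line. -/
lemma IsCutoffFamily.parent_le_sum_of_notMem_line (hR₀ : 0 < R₀)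
    (hψ₀ : IsMacroCutoff δ C₀ x₀ R₀ ψ₀)
    (hc : IsCover K₁ K₂ x₀ R₀ R n c) (h : IsCutoffFamily δ C₀ x₀ R₀ ψ₀ K₂ R n c ψ) {x : Plane}
    (hx : ∀ i, x ∉ line[ℝ, x₀, c i]) : ψ₀ x ≤ ∑ i, ψ i x := by
  have hle : ∀ i, ψ i x ≤ ∑ j, ψ j x := fun i =>
    Finset.single_le_sum (f := fun j => ψ j x) (fun j _ => (h.refined j).nonneg x)
      (Finset.mem_univ i)
  rcases lt_or_ge (dist x x₀) R₀ with h1 | h1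
  · obtain ⟨i, hi⟩ := mem_iUnion.1 (hc.covers h1)
    have : ψ i x = 1 := by
      by_cases hb : ball (c i) R ⊆ ball x₀ R₀
      · exact h.interior_eq_one i hb x hi
      · exact h.boundary_eq_one i hb x ⟨hi, h1⟩
    exact (hψ₀.refined.le_one x).trans (this ▸ hle i)
  rcases lt_or_ge (dist x x₀) (2 * R₀) with h2 | h2
  · obtain ⟨i, hi⟩ := hc.exists_dist_le h1 hR₀
    have hd : 0 < dist x x₀ := hR₀.trans_le h1
    have : ψ i x = ψ₀ x := by
      by_cases hb : ball (c i) R ⊆ ball x₀ R₀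
      · have hpx : dist (x₀ + (R₀ / dist x x₀) • (x - x₀)) x₀ = R₀ := by
          rw [dist_eq_norm, add_sub_cancel_left, norm_smul, ← dist_eq_norm,
            Real.norm_of_nonneg (by positivity), div_mul_cancel₀ _ hd.ne']
        -- A concentric ball reaching the boundary is the whole macro-scale ball, whose cut-off is
        -- `ψ₀` by convention.
        by_cases hcx : c i = x₀
        · have : R = R₀ := le_antisymm hc.scale_le (by rwa [hcx, hpx] at hi)
          rw [h.macro_eq i hcx this]
        · refine absurd ?_ (hx i)
          have hmem := mem_line_of_tangent hc.scale_pos hcx hb hi hpx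
          have hx₀ : x₀ ∈ line[ℝ, x₀, c i] := left_mem_affineSpan_pair ℝ _ _
          have := AffineMap.lineMap_mem (dist x x₀ / R₀) hx₀ hmem
          convert this using 1
          rw [AffineMap.lineMap_apply, vsub_eq_sub, add_sub_cancel_left, smul_smul, vadd_eq_add,
            div_mul_div_cancel₀ hR₀.ne', div_self hd.ne', one_smul, sub_add_cancel]
      · exact IsCutoffFamily.boundary_eq_macro h i hb x ⟨h1, h2, exists_ray_mem_sphere h1 hR₀ hi⟩
    exact this ▸ hle i
  · have : ψ₀ x = 0 := by
      refine image_eq_zero_of_notMem_tsupport fun hm => ?_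
      have := hψ₀.support_subset hm
      rw [mem_ball] at this
      linarith
    rw [this]
    exact Finset.sum_nonneg fun i _ => (h.refined i).nonneg x

/-- The exceptional lines are finitely many null sets, so the inequality holds on a dense set, and
by continuity everywhere. -/
lemma IsCutoffFamily.parent_le_sum (hR₀ : 0 < R₀) (hψ₀ : IsMacroCutoff δ C₀ x₀ R₀ ψ₀)
    (hc : IsCover K₁ K₂ x₀ R₀ R n c) (h : IsCutoffFamily δ C₀ x₀ R₀ ψ₀ K₂ R n c ψ) (x : Plane) :
    ψ₀ x ≤ ∑ i, ψ i x := by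
  have hae : ∀ᵐ x : Plane, ∀ i, x ∉ line[ℝ, x₀, c i] :=
    ae_all_iff.2 fun i => measure_eq_zero_iff_ae_notMem.1 (volume_line x₀ (c i))
  have hdense : Dense {x | ψ₀ x ≤ ∑ i, ψ i x} :=
    (Measure.dense_of_ae hae).mono fun x hx => h.parent_le_sum_of_notMem_line hR₀ hψ₀ hc hx
  have hcl : IsClosed {x | ψ₀ x ≤ ∑ i, ψ i x} :=
    isClosed_le hψ₀.refined.smooth.continuous
      (continuous_finsetSum _ fun i _ => (h.refined i).smooth.continuous)
  have := hdense.closure_eq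
  rw [hcl.closure_eq] at this
  exact (this ▸ mem_univ x : x ∈ {x | ψ₀ x ≤ ∑ i, ψ i x})

/-- At most `K₂` terms are nonzero at a given point. The form with general `aᵢ` also serves for
powers of the cut-offs. -/
lemma IsCutoffFamily.sum_le (h : IsCutoffFamily δ C₀ x₀ R₀ ψ₀ K₂ R n c ψ) {x : Plane}
    {a : Fin n → ℝ} {A : ℝ} (hA : 0 ≤ A) (h0 : ∀ i, ψ i x = 0 → a i = 0) (ha : ∀ i, a i ≤ A) :
    ∑ i, a i ≤ K₂ * A := by
  classical
  have e : ∑ i, a i = ∑ i ∈ Finset.univ.filter fun i => ψ i x ≠ 0, a i := by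
    refine (Finset.sum_subset (Finset.filter_subset _ _) fun i _ hi => h0 i ?_).symm
    simpa using hi
  have hcard : ((Finset.univ.filter fun i => ψ i x ≠ 0).card : ℝ) ≤ K₂ := by
    have := h.multiplicity x
    rw [Set.ncard_eq_toFinset_card', Set.toFinset_ofPred] at this
    exact_mod_cast this
  rw [e]
  calc _ ≤ ∑ i ∈ Finset.univ.filter fun i => ψ i x ≠ 0, A := Finset.sum_le_sum fun i _ => ha i
    _ = (Finset.univ.filter fun i => ψ i x ≠ 0).card * A := by
        rw [Finset.sum_const, nsmul_eq_mul]
    _ ≤ _ := by gcongr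

lemma IsCutoffFamily.tsupport_subset (hψ₀ : IsMacroCutoff δ C₀ x₀ R₀ ψ₀)
    (h : IsCutoffFamily δ C₀ x₀ R₀ ψ₀ K₂ R n c ψ) (i : Fin n) :
    tsupport (ψ i) ⊆ ball x₀ (2 * R₀) := by
  refine (closure_mono fun x hx => ?_).trans hψ₀.support_subset
  intro h0
  exact hx (le_antisymm (h0 ▸ IsCutoffFamily.le_macro h i x) ((h.refined i).nonneg x))

lemma IsRefined.abs_planeLaplacian_le {ψ : Plane → ℝ} (h : IsRefined δ C₀ R ψ) (x : Plane) :
    |planeLaplacian ψ x| ≤ 2 * (C₀ / R ^ 2) * ψ x ^ (2 * δ - 1) := by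
  rw [planeLaplacian, Fin.sum_univ_two]
  have h0 := h.deriv_deriv_le x 0 0
  have h1 := h.deriv_deriv_le x 1 1
  have := abs_add_le (partialDeriv 0 (partialDeriv 0 ψ) x) (partialDeriv 1 (partialDeriv 1 ψ) x)
  linarith

/-- The density of the average `ϑ₀*` for the cut-off function `ψ(x) χ(z)`. -/
noncomputable def varianceDensity (α δ : ℝ) (f ψ : Plane → ℝ) (χ : ℝ → ℝ) (p : Plane × ℝ) : ℝ :=
  weight α p.2 * (1 / 2 * extension α f p.1 p.2 ^ 2) * (ψ p.1 * χ p.2) ^ (2 * δ - 1)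

/-- The constant 5 is 2 from the two second derivatives in the plane plus 3 from the vertical
cut-off. The vertical scale `R₀` is replaced by `R ≤ R₀`, and `a ≤ a^(2δ-1)` on `[0, 1]` brings both
terms to the same power. -/
lemma IsRefined.abs_cutoffDensity_le {α : ℝ} {f ψ : Plane → ℝ} {χ : ℝ → ℝ} (hα : 0 < α)
    (hα2 : α < 2) (hC₀ : 0 < C₀) (hR₀ : 0 < R₀) (hRs : 0 < Rs) (hδ : 1 / 2 < δ) (hδ1 : δ < 1)
    (hχ : IsVerticalCutoff δ C₀ R₀ Rs χ) (h : IsRefined δ C₀ R ψ) (hR : 0 < R) (hRR : R ≤ R₀)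
    (x : Plane) {z : ℝ} (hz : 0 < z) :
    |cutoffDensity α f ψ χ (x, z)| ≤ 5 * (C₀ / R ^ 2) * varianceDensity α δ f ψ χ (x, z) := by
  have hχ0 := hχ.nonneg hR₀ hRs hz.le
  have hχ1 := hχ.le_one hRs hz.le
  have hψ0 := h.nonneg x
  have hψ1 := h.le_one x
  have hw := weight_pos hα hα2 hz
  have hv := hχ.abs_vertWeight_le hα hα2 hC₀ hR₀ hRs hδ hδ1 hz
  have hl := h.abs_planeLaplacian_le x
  simp only [cutoffDensity, varianceDensity]
  rw [Real.mul_rpow hψ0 hχ0]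
  obtain ⟨p, hp⟩ : ∃ p, p = 2 * δ - 1 := ⟨_, rfl⟩
  rw [← hp] at hv hl ⊢
  have hψp : ψ x ≤ ψ x ^ p := by
    conv_lhs => rw [← Real.rpow_one (ψ x)]
    exact Real.rpow_le_rpow_of_exponent_ge' hψ0 hψ1 (by linarith) (by linarith)
  have hχp : χ z ≤ χ z ^ p := by
    conv_lhs => rw [← Real.rpow_one (χ z)]
    exact Real.rpow_le_rpow_of_exponent_ge' hχ0 hχ1 (by linarith) (by linarith)
  have hCR : C₀ / R₀ ^ 2 ≤ C₀ / R ^ 2 := by gcongr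
  rw [abs_mul, abs_of_nonneg (by positivity : (0:ℝ) ≤ 1 / 2 * extension α f x z ^ 2)]
  have hψp0 : 0 ≤ ψ x ^ p := Real.rpow_nonneg hψ0 _
  have hχp0 : 0 ≤ χ z ^ p := Real.rpow_nonneg hχ0 _
  have hb : |χ z * weight α z * planeLaplacian ψ x + vertWeight α χ z * ψ x| ≤
      weight α z * (5 * (C₀ / R ^ 2) * (ψ x ^ p * χ z ^ p)) := by
    calc _ ≤ |χ z * weight α z * planeLaplacian ψ x| + |vertWeight α χ z * ψ x| := abs_add_le _ _
      _ = χ z * weight α z * |planeLaplacian ψ x| + |vertWeight α χ z| * ψ x := by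
          rw [abs_mul (χ z * weight α z), abs_mul (vertWeight α χ z), abs_of_nonneg hψ0,
            abs_of_nonneg (mul_nonneg hχ0 hw.le)]
      _ ≤ χ z ^ p * weight α z * (2 * (C₀ / R ^ 2) * ψ x ^ p) +
          weight α z * (3 * (C₀ / R ^ 2) * χ z ^ p) * ψ x ^ p := by
          gcongr
          exact hv.trans (by gcongr)
      _ = _ := by ring
  calc _ ≤ 1 / 2 * extension α f x z ^ 2 *
        (weight α z * (5 * (C₀ / R ^ 2) * (ψ x ^ p * χ z ^ p))) := by gcongr
    _ = _ := by ring

end Covers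

end SQG

namespace SQG

/-! ### The localized energy balance -/

lemma continuous_of_continuousOn_of_zero {X : Type*} [TopologicalSpace X] [T2Space X] {F : X → ℝ}
    {U K : Set X} (hU : IsOpen U) (hK : IsCompact K) (hKU : K ⊆ U) (hF : ContinuousOn F U)
    (h0 : ∀ x, x ∉ K → F x = 0) : Continuous F ∧ HasCompactSupport F := by
  have hs : tsupport F ⊆ K := closure_minimal (fun x hx => by
    by_contra h; exact hx (h0 x h)) hK.isClosed
  exact ⟨hF.continuous_of_tsupport_subset hU (hs.trans hKU), HasCompactSupport.intro hK h0⟩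

lemma inner_gradient (v : Plane) (g : Plane → ℝ) (x : Plane) :
    inner ℝ v (gradient g x) = fderiv ℝ g x v := by
  rw [real_inner_comm, inner_gradient_left]

lemma deriv_time_slice {W : ℝ × Plane → ℝ} (hW : Differentiable ℝ W) (t : ℝ) (x : Plane) :
    deriv (fun s => W (s, x)) t = fderiv ℝ W (t, x) (1, 0) := by
  have h1 : HasDerivAt (fun s : ℝ => (s, x)) ((1 : ℝ), (0 : Plane)) t :=
    (hasDerivAt_id t).prodMk (hasDerivAt_const t x)
  exact ((hW (t, x)).hasFDerivAt.comp_hasDerivAt t h1).deriv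

lemma integral_deriv_time_slice {W : ℝ × Plane → ℝ} (hW : ContDiff ℝ ∞ W)
    (hWc : HasCompactSupport W) :
    Integrable (fun p : ℝ × Plane => deriv (fun s => W (s, p.2)) p.1) (volume.prod volume) ∧
    ∫ t, ∫ x, deriv (fun s => W (s, x)) t = 0 := by
  have hWd : Differentiable ℝ W := hW.differentiable (by simp)
  have hc : Continuous fun p => fderiv ℝ W p (1, 0) :=
    (hW.continuous_fderiv (by simp)).clm_apply continuous_const
  have hi : Integrable (fun p => fderiv ℝ W p (1, 0)) (volume.prod volume) :=
    hc.integrable_of_hasCompactSupport (hWc.fderiv_apply ℝ _)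
  simp only [deriv_time_slice hWd]
  refine ⟨hi, ?_⟩
  rw [← integral_prod _ hi]
  have h0 : ∀ p : ℝ × Plane, fderiv ℝ (fun _ : ℝ × Plane => (1 : ℝ)) p = 0 := fun p => by simp
  have := integral_mul_fderiv_eq_neg_fderiv_mul_of_integrable (μ := (volume.prod volume))
    (f := fun _ : ℝ × Plane => (1 : ℝ)) (g := W) (v := (1, 0)) (by simp) (by simpa using hi)
    (by simpa using hW.continuous.integrable_of_hasCompactSupport hWc)
    (fun p _ => differentiableAt_const _) (fun p _ => hWd p)
  simpa using this

lemma fracLaplacian_zero (α : ℝ) (x : Plane) : fracLaplacian α (fun _ => 0) x = 0 := by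
  simp [fracLaplacian, Real.fourier_eq', Real.fourierInv_eq']

section Balance

variable {α δ C₀ R₀ Rs T : ℝ} {θ₀ : Plane → ℝ} {θ : ℝ → Plane → ℝ} {u : ℝ → Plane → Plane}
  {η χ : ℝ → ℝ} {ψ : Plane → ℝ} {c : Plane} {ρ : ℝ}

lemma IsTimeCutoff.tsupport_subset (hT : 0 < T) (hη : IsTimeCutoff δ C₀ T η) :
    tsupport η ⊆ Ioo 0 (2 * T) := fun t ht => by
  refine ⟨hη.support_pos ht, ?_⟩
  have h : tsupport η ⊆ Iic (5 * T / 3) := closure_minimal (fun s hs => by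
    by_contra h
    have h' : ¬ s ≤ 5 * T / 3 := h
    exact hs (hη.eq_zero s (Or.inr (not_le.1 h')))) isClosed_Iic
  have : t ≤ 5 * T / 3 := h ht
  linarith

lemma tsupport_mul_prod_subset (a : ℝ → ℝ) (ψ : Plane → ℝ) :
    tsupport (fun p : ℝ × Plane => a p.1 * ψ p.2) ⊆ tsupport a ×ˢ tsupport ψ :=
  closure_minimal (fun p hp => by
    have hp' : a p.1 * ψ p.2 ≠ 0 := hp
    exact ⟨subset_tsupport _ (left_ne_zero_of_mul hp'),
      subset_tsupport _ (right_ne_zero_of_mul hp')⟩)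
    ((isClosed_tsupport a).prod (isClosed_tsupport ψ))

lemma contDiffOn_slice {F : Type*} [NormedAddCommGroup F] [NormedSpace ℝ F] {v : ℝ → Plane → F}
    (hv : ContDiffOn ℝ ∞ (fun p : ℝ × Plane => v p.1 p.2) (Ioo 0 (2 * T) ×ˢ ball c ρ)) {t : ℝ}
    (ht : t ∈ Ioo 0 (2 * T)) : ContDiffOn ℝ ∞ (v t) (ball c ρ) :=
  hv.comp (f := fun x : Plane => (t, x)) (by fun_prop) fun x hx => ⟨ht, hx⟩

lemma smooth_cylinder (hT : 0 < T) (hη : IsTimeCutoff δ C₀ T η) (hψ : ContDiff ℝ ∞ ψ)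
    (hs : tsupport ψ ⊆ ball c ρ) {w : ℝ → Plane → ℝ}
    (hw : ContDiffOn ℝ ∞ (fun p : ℝ × Plane => w p.1 p.2) (Ioo 0 (2 * T) ×ˢ ball c ρ)) :
    ContDiff ℝ ∞ (fun p : ℝ × Plane => η p.1 * ψ p.2 * w p.1 p.2) ∧
      HasCompactSupport (fun p : ℝ × Plane => η p.1 * ψ p.2 * w p.1 p.2) := by
  have hsub := tsupport_mul_prod_subset η ψ
  have hψc := hasCompactSupport_of_tsupport_subset_ball hs
  have hU : IsOpen (Ioo 0 (2 * T) ×ˢ ball c ρ) := isOpen_Ioo.prod isOpen_ball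
  refine ⟨contDiff_mul_of_tsupport hU hw ?_
    (hsub.trans (prod_mono (hη.tsupport_subset hT) hs)), ?_⟩
  · exact (hη.smooth.comp contDiff_fst).mul (hψ.comp contDiff_snd)
  · refine HasCompactSupport.intro (hη.compact.isCompact.prod hψc.isCompact) fun p hp => ?_
    have : p ∉ tsupport fun p : ℝ × Plane => η p.1 * ψ p.2 := fun h => hp (hsub h)
    rw [image_eq_zero_of_notMem_tsupport this, zero_mul]

/-- The product rule behind the localized energy balance. -/
lemma energy_density_identity (hη : IsTimeCutoff δ C₀ T η) (hψ : ContDiff ℝ ∞ ψ)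
    (hs : tsupport ψ ⊆ ball c ρ)
    (hθ : ContDiffOn ℝ ∞ (fun p : ℝ × Plane => θ p.1 p.2) (Ioo 0 (2 * T) ×ˢ ball c ρ))
    {t : ℝ} (ht : t ∈ Ioo 0 (2 * T)) (x v : Plane) :
    θ t x * (deriv (fun s => η s * ψ x * θ s x) t +
        inner ℝ v (gradient (fun y => η t * ψ y * θ t y) x)) =
      deriv (fun s => η s * ψ x * (1 / 2 * θ s x ^ 2)) t +
        1 / 2 * θ t x ^ 2 * (deriv η t * ψ x) +
        η t / 2 * inner ℝ v (gradient (fun y => ψ y * θ t y ^ 2) x) +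
        1 / 2 * θ t x ^ 2 * inner ℝ v (gradient (fun y => η t * ψ y) x) := by
  simp only [inner_gradient]
  by_cases hx : x ∈ tsupport ψ
  · have hU : IsOpen (Ioo 0 (2 * T) ×ˢ ball c ρ) := isOpen_Ioo.prod isOpen_ball
    have hd := (hθ.differentiableOn (by simp)).differentiableAt
      (hU.mem_nhds (⟨ht, hs hx⟩ : (t, x) ∈ Ioo 0 (2 * T) ×ˢ ball c ρ))
    have hd1 : HasDerivAt (fun s => θ s x) (deriv (fun s => θ s x) t) t :=
      (DifferentiableAt.comp t (g := fun p : ℝ × Plane => θ p.1 p.2) (f := fun s : ℝ => (s, x)) hd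
        (by fun_prop)).hasDerivAt
    have hD : HasFDerivAt (θ t) (fderiv ℝ (θ t) x) x :=
      (((contDiffOn_slice hθ ht).differentiableOn (by simp)).differentiableAt
        (isOpen_ball.mem_nhds (hs hx))).hasFDerivAt
    have hP : HasFDerivAt ψ (fderiv ℝ ψ x) x := ((hψ.differentiable (by simp)) x).hasFDerivAt
    have hE : HasDerivAt η (deriv η t) t := ((hη.smooth.differentiable (by simp)) t).hasDerivAt
    have e1 : deriv (fun s => η s * ψ x * θ s x) t = _ := ((hE.mul_const (ψ x)).mul hd1).deriv
    have e2 : deriv (fun s => η s * ψ x * (1 / 2 * θ s x ^ 2)) t = _ :=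
      ((hE.mul_const (ψ x)).mul ((hd1.pow 2).const_mul (1 / 2))).deriv
    have e3 : fderiv ℝ (fun y => η t * ψ y * θ t y) x = _ := ((hP.const_mul (η t)).mul hD).fderiv
    have e4 : fderiv ℝ (fun y => ψ y * θ t y ^ 2) x = _ := (hP.mul (hD.pow 2)).fderiv
    have e5 : fderiv ℝ (fun y => η t * ψ y) x = _ := (hP.const_mul (η t)).fderiv
    rw [e1, e2, e3, e4, e5]
    simp only [add_apply, smul_apply, smul_eq_mul, Pi.pow_apply,
      nsmul_eq_mul]
    push_cast
    ring
  · have h0 : ψ =ᶠ[𝓝 x] fun _ => 0 := notMem_tsupport_iff_eventuallyEq.1 hx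
    have hψ0 : ψ x = 0 := h0.self_of_nhds
    have e1 : (fun y => η t * ψ y * θ t y) =ᶠ[𝓝 x] fun _ => 0 := by
      filter_upwards [h0] with y hy; rw [hy]; ring
    have e2 : (fun y => ψ y * θ t y ^ 2) =ᶠ[𝓝 x] fun _ => 0 := by
      filter_upwards [h0] with y hy; rw [hy]; ring
    have e3 : (fun y => η t * ψ y) =ᶠ[𝓝 x] fun _ => 0 := by
      filter_upwards [h0] with y hy; rw [hy]; ring
    rw [e1.fderiv_eq, e2.fderiv_eq, e3.fderiv_eq, hψ0]
    simp

/-- The rate of localized dissipation. -/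
noncomputable def dissipationRate (α : ℝ) (θ : ℝ → Plane → ℝ) (η : ℝ → ℝ) (ψ : Plane → ℝ)
    (χ : ℝ → ℝ) (t : ℝ) : ℝ :=
  ∫ p, dissipationDensity α (θ t) (fun x => η t * ψ x) χ p ∂(volume.prod (volume.restrict (Ioi 0)))

/-- The rate of the error created by the gradients of the spatial cut-off functions. -/
noncomputable def cutoffRate (α : ℝ) (θ : ℝ → Plane → ℝ) (η : ℝ → ℝ) (ψ : Plane → ℝ)
    (χ : ℝ → ℝ) (t : ℝ) : ℝ :=
  ∫ p, cutoffDensity α (θ t) (fun x => η t * ψ x) χ p ∂(volume.prod (volume.restrict (Ioi 0)))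

lemma tsupport_const_mul_subset (r : ℝ) (ψ : Plane → ℝ) :
    tsupport (fun x => r * ψ x) ⊆ tsupport ψ :=
  closure_mono fun _ hx => right_ne_zero_of_mul hx

/-- Square integrability of the time slices is part of the velocity relation, hence holds for almost
every positive time. -/
lemma IsVelocityOf.memLp {f : Plane → ℝ} {v : Plane → Plane} (h : IsVelocityOf f v) :
    MemLp f 2 volume := by
  obtain ⟨hf, -⟩ := h
  exact hf.re

lemma integrable_flux_density (hψ : ContDiff ℝ ∞ ψ) (hs : tsupport ψ ⊆ ball c ρ)
    (hT : 0 < T) (hη : IsTimeCutoff δ C₀ T η)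
    (hθ : ContDiffOn ℝ ∞ (fun p : ℝ × Plane => θ p.1 p.2) (Ioo 0 (2 * T) ×ˢ ball c ρ))
    (hu : ContDiffOn ℝ ∞ (fun p : ℝ × Plane => u p.1 p.2) (Ioo 0 (2 * T) ×ˢ ball c ρ)) :
    Continuous (fun p : ℝ × Plane =>
      1 / 2 * θ p.1 p.2 ^ 2 * inner ℝ (u p.1 p.2) (gradient (fun y => η p.1 * ψ y) p.2)) ∧
    HasCompactSupport (fun p : ℝ × Plane =>
      1 / 2 * θ p.1 p.2 ^ 2 * inner ℝ (u p.1 p.2) (gradient (fun y => η p.1 * ψ y) p.2)) := by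
  have hψc := hasCompactSupport_of_tsupport_subset_ball hs
  have e : ∀ p : ℝ × Plane, inner ℝ (u p.1 p.2) (gradient (fun y => η p.1 * ψ y) p.2) =
      η p.1 * fderiv ℝ ψ p.2 (u p.1 p.2) := fun p => by
    rw [inner_gradient, fderiv_const_mul ((hψ.differentiable (by simp)) p.2)]
    simp
  simp only [e]
  refine continuous_of_continuousOn_of_zero (isOpen_Ioo.prod isOpen_ball)
    (hη.compact.isCompact.prod hψc.isCompact) (prod_mono (hη.tsupport_subset hT) hs) ?_ ?_
  · have h1 : Continuous fun p : ℝ × Plane => fderiv ℝ ψ p.2 :=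
      (hψ.continuous_fderiv (by simp)).comp continuous_snd
    exact (continuousOn_const.mul (hθ.continuousOn.pow 2)).mul
      ((hη.smooth.continuous.comp continuous_fst).continuousOn.mul
        (h1.continuousOn.clm_apply hu.continuousOn))
  · rintro ⟨t, x⟩ hp
    rw [mem_prod, not_and_or] at hp
    rcases hp with h | h
    · simp [image_eq_zero_of_notMem_tsupport h]
    · have : fderiv ℝ ψ x = 0 := image_eq_zero_of_notMem_tsupport
        fun h' => h (tsupport_fderiv_subset ℝ h')
      simp [this]

lemma integrable_time_error_density (hψ : ContDiff ℝ ∞ ψ) (hs : tsupport ψ ⊆ ball c ρ)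
    (hT : 0 < T) (hη : IsTimeCutoff δ C₀ T η)
    (hθ : ContDiffOn ℝ ∞ (fun p : ℝ × Plane => θ p.1 p.2) (Ioo 0 (2 * T) ×ˢ ball c ρ)) :
    Continuous (fun p : ℝ × Plane => 1 / 2 * θ p.1 p.2 ^ 2 * (deriv η p.1 * ψ p.2)) ∧
    HasCompactSupport (fun p : ℝ × Plane => 1 / 2 * θ p.1 p.2 ^ 2 * (deriv η p.1 * ψ p.2)) := by
  have hψc := hasCompactSupport_of_tsupport_subset_ball hs
  refine continuous_of_continuousOn_of_zero (isOpen_Ioo.prod isOpen_ball)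
    (hη.compact.isCompact.prod hψc.isCompact) (prod_mono (hη.tsupport_subset hT) hs) ?_ ?_
  · exact (continuousOn_const.mul (hθ.continuousOn.pow 2)).mul
      (((hη.smooth.continuous_deriv (by simp)).comp continuous_fst).mul
        (hψ.continuous.comp continuous_snd)).continuousOn
  · rintro ⟨t, x⟩ hp
    rw [mem_prod, not_and_or] at hp
    rcases hp with h | h
    · have : deriv η t = 0 := image_eq_zero_of_notMem_tsupport
        fun h' => h (tsupport_deriv_subset h')
      simp [this]
    · simp [image_eq_zero_of_notMem_tsupport h]

lemma hasCompactSupport_slice {F : ℝ × Plane → ℝ} (hF : HasCompactSupport F) (t : ℝ) :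
    HasCompactSupport fun x => F (t, x) :=
  HasCompactSupport.intro (hF.isCompact.image continuous_snd) fun _ hx =>
    image_eq_zero_of_notMem_tsupport fun h => hx ⟨_, h, rfl⟩

/-- The localized energy balance. -/
theorem energy_balance (hα : 0 < α) (hα2 : α < 2)
    (hC₀ : 0 < C₀) (hR₀ : 0 < R₀) (hRs : 0 < Rs) (hδ : 1 / 2 < δ) (hδ1 : δ < 1) (hT : 0 < T)
    (hsol : IsWeakSolution α θ₀ θ u)
    (hθ : ContDiffOn ℝ ∞ (fun p : ℝ × Plane => θ p.1 p.2) (Ioo 0 (2 * T) ×ˢ ball c ρ))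
    (hu : ContDiffOn ℝ ∞ (fun p : ℝ × Plane => u p.1 p.2) (Ioo 0 (2 * T) ×ˢ ball c ρ))
    (hη : IsTimeCutoff δ C₀ T η) (hχ : IsVerticalCutoff δ C₀ R₀ Rs χ)
    (hψ : ContDiff ℝ ∞ ψ) (hψ0 : ∀ x, 0 ≤ ψ x) (hs : tsupport ψ ⊆ ball c ρ)
    (hE : IntegrableOn (dissipationRate α θ η ψ χ) (Ioo 0 (2 * T)))
    (hV : IntegrableOn (cutoffRate α θ η ψ χ) (Ioo 0 (2 * T))) :
    ∫ t in Ioo 0 (2 * T), ∫ x,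
        1 / 2 * θ t x ^ 2 * inner ℝ (u t x) (gradient (fun y => η t * ψ y) x) =
      (∫ t in Ioo 0 (2 * T), dissipationRate α θ η ψ χ t) -
        (∫ t in Ioo 0 (2 * T), cutoffRate α θ η ψ χ t) -
        ∫ t in Ioo 0 (2 * T), ∫ x, 1 / 2 * θ t x ^ 2 * (deriv η t * ψ x) := by
  have hψc := hasCompactSupport_of_tsupport_subset_ball hs
  obtain ⟨hΦ, hΦc⟩ := smooth_cylinder hT hη hψ hs hθ
  obtain ⟨hW, hWc⟩ := smooth_cylinder hT hη hψ hs (w := fun t x => 1 / 2 * θ t x ^ 2)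
    (contDiffOn_const.mul (hθ.pow 2))
  obtain ⟨hWi, hW0⟩ := integral_deriv_time_slice hW hWc
  obtain ⟨hBc, hBs⟩ := integrable_flux_density hψ hs hT hη hθ hu
  obtain ⟨hCc, hCs⟩ := integrable_time_error_density hψ hs hT hη hθ
  have hη0 : ∀ t, t ∉ Ioo 0 (2 * T) → t ∉ tsupport η := fun t ht h =>
    ht (hη.tsupport_subset hT h)
  -- The solution times its own cut-off is a legitimate test function, because `θ` is smooth where
  -- `η ψ` lives. The initial term drops since `η` vanishes at 0.
  have heq := hsol.equation (fun t x => η t * ψ x * θ t x) hΦ hΦc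
  have hz0 : η 0 = 0 := image_eq_zero_of_notMem_tsupport (hη0 0 fun h => lt_irrefl _ h.1)
  simp only [hz0, zero_mul, mul_zero, integral_zero, add_zero] at heq
  set I : ℝ → ℝ := fun t => ∫ x, θ t x * (deriv (fun s => η s * ψ x * θ s x) t +
    inner ℝ (u t x) (gradient (fun y => η t * ψ y * θ t y) x) -
      fracLaplacian α (fun y => η t * ψ y * θ t y) x) with hI
  have hI0 : ∀ t ∈ Ioi 0 \ Ioo 0 (2 * T), I t = 0 := fun t ht => by
    have h0 : η =ᶠ[𝓝 t] fun _ => 0 := notMem_tsupport_iff_eventuallyEq.1 (hη0 t ht.2)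
    have hηt : η t = 0 := h0.self_of_nhds
    have h1 : ∀ x, deriv (fun s => η s * ψ x * θ s x) t = 0 := fun x => by
      have : (fun s => η s * ψ x * θ s x) =ᶠ[𝓝 t] fun _ => 0 := by
        filter_upwards [h0] with s hs; rw [hs]; ring
      rw [this.deriv_eq]; simp
    simp only [hI, hηt, h1, zero_mul, inner_gradient, fracLaplacian_zero]
    simp
  have hIoo : ∫ t in Ioo 0 (2 * T), I t = 0 := by
    rw [← setIntegral_eq_of_subset_of_forall_sdiff_eq_zero measurableSet_Ioi
      Ioo_subset_Ioi_self hI0]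
    exact heq
  have hIt : ∀ᵐ t ∂(volume.restrict (Ioo 0 (2 * T))), I t =
      (∫ x, deriv (fun s => η s * ψ x * (1 / 2 * θ s x ^ 2)) t) +
        (∫ x, 1 / 2 * θ t x ^ 2 * (deriv η t * ψ x)) +
        (∫ x, 1 / 2 * θ t x ^ 2 * inner ℝ (u t x) (gradient (fun y => η t * ψ y) x)) -
        (dissipationRate α θ η ψ χ t - cutoffRate α θ η ψ χ t) := by
    filter_upwards [ae_restrict_mem measurableSet_Ioo, ae_restrict_of_ae hsol.velocity_eq,
      ae_restrict_of_ae hsol.div_free] with t ht hvel hdiv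
    have hf := (hvel ht.1).memLp
    have hfs := contDiffOn_slice hθ ht
    have hus := contDiffOn_slice hu ht
    have hsη : tsupport (fun x => η t * ψ x) ⊆ ball c ρ := (tsupport_const_mul_subset _ _).trans hs
    have hψη : ContDiff ℝ ∞ fun x => η t * ψ x := contDiff_const.mul hψ
    obtain ⟨-, hid⟩ := integral_dissipationDensity hα hα2 hf hC₀ hR₀ hRs hδ hδ1 hfs hψη
      (fun x => mul_nonneg (hη.nonneg t) (hψ0 x)) hsη hχ
    have hΦt : ContDiff ℝ ∞ fun y => η t * ψ y * θ t y :=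
      contDiff_mul_of_tsupport isOpen_ball hfs hψη hsη
    have i5 : Integrable (fun x => θ t x * fracLaplacian α (fun y => η t * ψ y * θ t y) x)
        volume := integrable_mul_fracLaplacian hα hα2 hf hΦt
          (hasCompactSupport_of_tsupport_subset_ball hsη).mul_right
    have hg : ContDiff ℝ ∞ fun y => ψ y * θ t y ^ 2 :=
      contDiff_mul_of_tsupport isOpen_ball (hfs.pow 2) hψ hs
    have hgs : tsupport (fun y => ψ y * θ t y ^ 2) ⊆ tsupport ψ := tsupport_mul_subset_left
    -- Incompressibility removes the transport term in which the gradient falls on `ψ θ²`; only the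
    -- gradient of the cut-off remains in the flux.
    have hg0 := hdiv ht.1 _ hg hψc.mul_right
    have i1 : Integrable (fun x => deriv (fun s => η s * ψ x * (1 / 2 * θ s x ^ 2)) t) volume := by
      have hWd := hW.differentiable (by simp)
      have e : ∀ x, deriv (fun s => η s * ψ x * (1 / 2 * θ s x ^ 2)) t = _ :=
        fun x => deriv_time_slice hWd t x
      refine Continuous.integrable_of_hasCompactSupport ?_
        (HasCompactSupport.intro hψc.isCompact fun x hx => ?_)
      · simp only [e]
        exact ((hW.continuous_fderiv (by simp)).comp (Continuous.prodMk_right t)).clm_apply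
          continuous_const
      · simp [image_eq_zero_of_notMem_tsupport hx]
    have i2 : Integrable (fun x => 1 / 2 * θ t x ^ 2 * (deriv η t * ψ x)) volume :=
      (hCc.comp (Continuous.prodMk_right t)).integrable_of_hasCompactSupport
        (hasCompactSupport_slice hCs t)
    have i4 : Integrable (fun x => 1 / 2 * θ t x ^ 2 *
        inner ℝ (u t x) (gradient (fun y => η t * ψ y) x)) volume :=
      (hBc.comp (Continuous.prodMk_right t)).integrable_of_hasCompactSupport
        (hasCompactSupport_slice hBs t)
    have i3 : Integrable (fun x => inner ℝ (u t x) (gradient (fun y => ψ y * θ t y ^ 2) x))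
        volume := by
      simp only [inner_gradient]
      obtain ⟨h1, h2⟩ := continuous_of_continuousOn_of_zero
        (F := fun x => fderiv ℝ (fun y => ψ y * θ t y ^ 2) x (u t x)) isOpen_ball hψc.isCompact hs
        ((hg.continuous_fderiv (by simp)).continuousOn.clm_apply hus.continuousOn)
        fun x hx => by
          have : fderiv ℝ (fun y => ψ y * θ t y ^ 2) x = 0 := image_eq_zero_of_notMem_tsupport
            fun h' => hx (hgs (tsupport_fderiv_subset ℝ h'))
          simp [this]
      exact h1.integrable_of_hasCompactSupport h2
    have e : I t = ∫ x, ((deriv (fun s => η s * ψ x * (1 / 2 * θ s x ^ 2)) t +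
        1 / 2 * θ t x ^ 2 * (deriv η t * ψ x) +
        η t / 2 * inner ℝ (u t x) (gradient (fun y => ψ y * θ t y ^ 2) x) +
        1 / 2 * θ t x ^ 2 * inner ℝ (u t x) (gradient (fun y => η t * ψ y) x)) -
        θ t x * fracLaplacian α (fun y => η t * ψ y * θ t y) x) := by
      refine integral_congr_ae (ae_of_all _ fun x => ?_)
      simp only
      rw [← energy_density_identity hη hψ hs hθ ht x (u t x)]
      ring
    rw [e, integral_sub _ i5, integral_add _ i4, integral_add _ (i3.const_mul _),
      integral_add i1 i2, integral_const_mul, hg0]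
    · rw [dissipationRate, cutoffRate, hid]
      ring
    · exact i1.add i2
    · exact (i1.add i2).add (i3.const_mul _)
    · exact ((i1.add i2).add (i3.const_mul _)).add i4
  have j1 : IntegrableOn (fun t => ∫ x, deriv (fun s => η s * ψ x * (1 / 2 * θ s x ^ 2)) t)
      (Ioo 0 (2 * T)) := hWi.integral_prod_left.integrableOn
  have hCi : Integrable (fun p : ℝ × Plane => 1 / 2 * θ p.1 p.2 ^ 2 * (deriv η p.1 * ψ p.2))
    (volume.prod volume) := hCc.integrable_of_hasCompactSupport hCs
  have hBi : Integrable (fun p : ℝ × Plane => 1 / 2 * θ p.1 p.2 ^ 2 *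
    inner ℝ (u p.1 p.2) (gradient (fun y => η p.1 * ψ y) p.2)) (volume.prod volume) :=
    hBc.integrable_of_hasCompactSupport hBs
  have j2 : IntegrableOn (fun t => ∫ x, 1 / 2 * θ t x ^ 2 * (deriv η t * ψ x))
      (Ioo 0 (2 * T)) := hCi.integral_prod_left.integrableOn
  have j3 : IntegrableOn (fun t => ∫ x, 1 / 2 * θ t x ^ 2 *
      inner ℝ (u t x) (gradient (fun y => η t * ψ y) x)) (Ioo 0 (2 * T)) :=
    hBi.integral_prod_left.integrableOn
  have hW0' : ∫ t in Ioo 0 (2 * T), ∫ x, deriv (fun s => η s * ψ x * (1 / 2 * θ s x ^ 2)) t = 0 := by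
    rw [setIntegral_eq_integral_of_forall_compl_eq_zero]
    · exact hW0
    · intro t ht
      have h0 : η =ᶠ[𝓝 t] fun _ => 0 := notMem_tsupport_iff_eventuallyEq.1 (hη0 t ht)
      have h1 : ∀ x, deriv (fun s => η s * ψ x * (1 / 2 * θ s x ^ 2)) t = 0 := fun x => by
        have : (fun s => η s * ψ x * (1 / 2 * θ s x ^ 2)) =ᶠ[𝓝 t] fun _ => 0 := by
          filter_upwards [h0] with s hs; rw [hs]; ring
        rw [this.deriv_eq]; simp
      simp only [h1, integral_zero]
  have j4 : IntegrableOn (fun t => dissipationRate α θ η ψ χ t - cutoffRate α θ η ψ χ t)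
    (Ioo 0 (2 * T)) := hE.sub hV
  rw [integral_congr_ae hIt, integral_sub _ j4, integral_add _ j3, integral_add j1 j2,
    integral_sub hE hV, hW0'] at hIoo
  · linarith
  · exact j1.add j2
  · exact (j1.add j2).add j3

end Balance

end SQG

namespace SQG

/-! ### Measurability and integrability in time -/

section Time

variable {α δ C₀ R₀ R Rs T S : ℝ} {θ : ℝ → Plane → ℝ}
  {η χ : ℝ → ℝ} {ψ ψ₀ : Plane → ℝ} {c : Plane} {ρ : ℝ}

/-- Measurability is proved for a strongly measurable representative of `θ`. At almost every time it
agrees with `θ` at almost every `y`, so the integrals coincide at all points `(x, z)`. -/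
lemma aestronglyMeasurable_rieszInt {μ : Measure ℝ} [SFinite μ]
    (hθ : AEStronglyMeasurable (fun p : ℝ × Plane => θ p.1 p.2) (μ.prod volume))
    {m : Plane → ℝ} (hm : Continuous m) (s : ℝ) :
    AEStronglyMeasurable (fun q : ℝ × (Plane × ℝ) => rieszInt m (θ q.1) s q.2)
      (μ.prod (volume.prod (volume.restrict (Ioi 0)))) := by
  set Θ := hθ.mk _ with hΘ
  have hΘm : StronglyMeasurable Θ := hθ.stronglyMeasurable_mk
  have hsm : StronglyMeasurable fun q : ℝ × (Plane × ℝ) =>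
      rieszInt m (fun y => Θ (q.1, y)) s q.2 := by
    have hk : Measurable fun r : (ℝ × (Plane × ℝ)) × Plane =>
        m (r.1.2.1 - r.2) * rieszKernel s r.1.2 r.2 := by
      unfold rieszKernel
      exact (hm.measurable.comp (by fun_prop)).mul (Measurable.pow_const (by fun_prop) _)
    have hj : StronglyMeasurable fun r : (ℝ × (Plane × ℝ)) × Plane =>
        m (r.1.2.1 - r.2) * rieszKernel s r.1.2 r.2 * Θ (r.1.1, r.2) :=
      hk.stronglyMeasurable.mul (hΘm.comp_measurable (by fun_prop))
    exact hj.integral_prod_right'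
  refine hsm.aestronglyMeasurable.congr ?_
  have h1 : ∀ᵐ t ∂μ, ∀ᵐ y : Plane, θ t y = Θ (t, y) := Measure.ae_ae_of_ae_prod hθ.ae_eq_mk
  filter_upwards [Measure.quasiMeasurePreserving_fst.ae h1] with q hq
  refine integral_congr_ae ?_
  filter_upwards [hq] with y hy
  rw [hy]

lemma ae_snd_pos {μ : Measure ℝ} [SFinite μ] :
    ∀ᵐ q ∂(μ.prod ((volume : Measure Plane).prod (volume.restrict (Ioi (0 : ℝ))))), 0 < q.2.2 := by
  have h1 : ∀ᵐ z ∂(volume.restrict (Ioi (0 : ℝ))), 0 < z := ae_restrict_mem measurableSet_Ioi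
  have h2 : ∀ᵐ p ∂((volume : Measure Plane).prod (volume.restrict (Ioi (0 : ℝ)))), 0 < p.2 :=
    Measure.quasiMeasurePreserving_snd.ae h1
  exact Measure.quasiMeasurePreserving_snd.ae h2

lemma ae_height_pos :
    ∀ᵐ p ∂((volume : Measure Plane).prod (volume.restrict (Ioi (0 : ℝ)))), 0 < p.2 :=
  Measure.quasiMeasurePreserving_snd.ae (ae_restrict_mem measurableSet_Ioi :
    ∀ᵐ z ∂(volume.restrict (Ioi (0 : ℝ))), 0 < z)

lemma aestronglyMeasurable_height {μ : Measure ℝ} [SFinite μ] {g : ℝ → ℝ}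
    (hg : ContinuousOn g (Ioi 0)) :
    AEStronglyMeasurable (fun q : ℝ × (Plane × ℝ) => g q.2.2)
      (μ.prod (volume.prod (volume.restrict (Ioi 0)))) :=
  ((hg.aestronglyMeasurable measurableSet_Ioi).comp_snd (μ := (volume : Measure Plane))).comp_snd

lemma aestronglyMeasurable_weight {μ : Measure ℝ} [SFinite μ] :
    AEStronglyMeasurable (fun q : ℝ × (Plane × ℝ) => weight α q.2.2)
      (μ.prod (volume.prod (volume.restrict (Ioi 0)))) :=
  aestronglyMeasurable_height (continuousOn_weight α)

lemma aestronglyMeasurable_extension {μ : Measure ℝ} [SFinite μ]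
    (hθ : AEStronglyMeasurable (fun p : ℝ × Plane => θ p.1 p.2) (μ.prod volume)) :
    AEStronglyMeasurable (fun q : ℝ × (Plane × ℝ) => extension α (θ q.1) q.2.1 q.2.2)
      (μ.prod (volume.prod (volume.restrict (Ioi 0)))) := by
  simp only [extension_eq]
  have hz : Measurable fun q : ℝ × (Plane × ℝ) => α / (2 * Real.pi) * q.2.2 ^ α := by fun_prop
  exact hz.aestronglyMeasurable.mul (aestronglyMeasurable_rieszInt hθ continuous_const _)

lemma aestronglyMeasurable_extensionGradSq (hα : 0 < α) (hα2 : α < 2) {μ : Measure ℝ} [SFinite μ]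
    (hθ : AEStronglyMeasurable (fun p : ℝ × Plane => θ p.1 p.2) (μ.prod volume))
    (hL : ∀ᵐ t ∂μ, MemLp (θ t) 2 volume) :
    AEStronglyMeasurable (fun q : ℝ × (Plane × ℝ) => extensionGradSq α (θ q.1) q.2.1 q.2.2)
      (μ.prod (volume.prod (volume.restrict (Ioi 0)))) := by
  have hz : Measurable fun q : ℝ × (Plane × ℝ) =>
    -(α / (2 * Real.pi) * q.2.2 ^ α * (2 + α)) := by fun_prop
  have hz2 : Measurable fun q : ℝ × (Plane × ℝ) => (2 + α) * q.2.2 ^ 2 := by fun_prop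
  have hH := fun s => aestronglyMeasurable_rieszInt hθ (m := fun _ => 1) continuous_const s
  have hD := fun i : Fin 2 => aestronglyMeasurable_rieszInt hθ (m := fun v => v i)
    (by fun_prop) (2 + α / 2)
  have hN : AEStronglyMeasurable (fun q : ℝ × (Plane × ℝ) => conormal α (θ q.1) q.2)
      (μ.prod (volume.prod (volume.restrict (Ioi 0)))) := by
    unfold conormal
    exact (((hH _).const_mul _).sub (hz2.aestronglyMeasurable.mul (hH _))).const_mul _
  have hf : AEStronglyMeasurable (fun q : ℝ × (Plane × ℝ) =>
      ((-(α / (2 * Real.pi) * q.2.2 ^ α * (2 + α)) * rieszD 0 (θ q.1) (2 + α / 2) q.2) ^ 2 +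
        (-(α / (2 * Real.pi) * q.2.2 ^ α * (2 + α)) * rieszD 1 (θ q.1) (2 + α / 2) q.2) ^ 2) +
        (conormal α (θ q.1) q.2 / weight α q.2.2) ^ 2)
      (μ.prod (volume.prod (volume.restrict (Ioi 0)))) :=
    (((hz.aestronglyMeasurable.mul (hD 0)).pow 2).add
      ((hz.aestronglyMeasurable.mul (hD 1)).pow 2)).add
      ((hN.div₀ aestronglyMeasurable_weight).pow 2)
  refine hf.congr ?_
  filter_upwards [ae_snd_pos, Measure.quasiMeasurePreserving_fst.ae hL] with q hq hLq
  rw [extensionGradSq_eq hα hα2 hLq hq, Fin.sum_univ_two]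

lemma aestronglyMeasurable_cutoff {μ : Measure ℝ} [SFinite μ] (hη : Continuous η)
    (hψ : Continuous ψ) :
    AEStronglyMeasurable (fun q : ℝ × (Plane × ℝ) => η q.1 * ψ q.2.1)
      (μ.prod (volume.prod (volume.restrict (Ioi 0)))) :=
  (by fun_prop : Continuous fun q : ℝ × (Plane × ℝ) => η q.1 * ψ q.2.1).aestronglyMeasurable

lemma aestronglyMeasurable_dissipationRate (hα : 0 < α) (hα2 : α < 2) {μ : Measure ℝ} [SFinite μ]
    (hθ : AEStronglyMeasurable (fun p : ℝ × Plane => θ p.1 p.2) (μ.prod volume))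
    (hL : ∀ᵐ t ∂μ, MemLp (θ t) 2 volume) (hη : Continuous η) (hψ : Continuous ψ)
    (hχ : IsVerticalCutoff δ C₀ R₀ Rs χ) :
    AEStronglyMeasurable (dissipationRate α θ η ψ χ) μ := by
  have h : AEStronglyMeasurable (fun q : ℝ × (Plane × ℝ) =>
      dissipationDensity α (θ q.1) (fun x => η q.1 * ψ x) χ q.2)
      (μ.prod (volume.prod (volume.restrict (Ioi 0)))) :=
    (aestronglyMeasurable_weight.mul (aestronglyMeasurable_extensionGradSq hα hα2 hθ hL)).mul
      ((aestronglyMeasurable_cutoff hη hψ).mul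
        (aestronglyMeasurable_height hχ.contDiffOn_deriv.1.continuousOn))
  exact h.integral_prod_right'

lemma planeLaplacian_const_mul (hψ : ContDiff ℝ ∞ ψ) (r : ℝ) (x : Plane) :
    planeLaplacian (fun y => r * ψ y) x = r * planeLaplacian ψ x := by
  have h1 : ∀ i, partialDeriv i (fun y => r * ψ y) = fun y => r * partialDeriv i ψ y := fun i =>
    funext fun y => partialDeriv_const_mul ((hψ.differentiable (by simp)) y) r i
  simp only [planeLaplacian, h1]
  rw [Finset.mul_sum]
  exact Finset.sum_congr rfl fun i _ =>
    partialDeriv_const_mul (((contDiff_partialDeriv hψ i).differentiable (by simp)) x) r i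

lemma aestronglyMeasurable_cutoffRate {μ : Measure ℝ} [SFinite μ]
    (hθ : AEStronglyMeasurable (fun p : ℝ × Plane => θ p.1 p.2) (μ.prod volume))
    (hη : Continuous η) (hψ : ContDiff ℝ ∞ ψ) (hχ : IsVerticalCutoff δ C₀ R₀ Rs χ) :
    AEStronglyMeasurable (cutoffRate α θ η ψ χ) μ := by
  have hχc := hχ.contDiffOn_deriv.1.continuousOn
  have h : AEStronglyMeasurable (fun q : ℝ × (Plane × ℝ) =>
      cutoffDensity α (θ q.1) (fun x => η q.1 * ψ x) χ q.2)
      (μ.prod (volume.prod (volume.restrict (Ioi 0)))) := by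
    simp only [cutoffDensity, planeLaplacian_const_mul hψ]
    exact (((aestronglyMeasurable_extension hθ).pow 2).const_mul _).mul
      ((((aestronglyMeasurable_height hχc).mul aestronglyMeasurable_weight).mul
        (aestronglyMeasurable_cutoff hη (continuous_planeLaplacian hψ))).add
        ((aestronglyMeasurable_height hχ.continuousOn_vertWeight).mul
          (aestronglyMeasurable_cutoff hη hψ.continuous)))
  exact h.integral_prod_right'

/-- The rate belonging to the average `ϑ₀*`. -/
noncomputable def varianceRate (α δ : ℝ) (θ : ℝ → Plane → ℝ) (η : ℝ → ℝ) (ψ : Plane → ℝ)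
    (χ : ℝ → ℝ) (t : ℝ) : ℝ :=
  ∫ p, varianceDensity α δ (θ t) (fun x => η t * ψ x) χ p
    ∂(volume.prod (volume.restrict (Ioi 0)))

lemma aestronglyMeasurable_varianceRate {μ : Measure ℝ} [SFinite μ]
    (hθ : AEStronglyMeasurable (fun p : ℝ × Plane => θ p.1 p.2) (μ.prod volume))
    (hδ : 1 / 2 < δ) (hη : Continuous η) (hψ : Continuous ψ)
    (hχ : IsVerticalCutoff δ C₀ R₀ Rs χ) :
    AEStronglyMeasurable (varianceRate α δ θ η ψ χ) μ := by
  have hχc := hχ.contDiffOn_deriv.1.continuousOn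
  have h : AEStronglyMeasurable (fun q : ℝ × (Plane × ℝ) =>
      varianceDensity α δ (θ q.1) (fun x => η q.1 * ψ x) χ q.2)
      (μ.prod (volume.prod (volume.restrict (Ioi 0)))) := by
    simp only [varianceDensity]
    exact (aestronglyMeasurable_weight.mul (((aestronglyMeasurable_extension hθ).pow 2).const_mul
      _)).mul ((Real.continuous_rpow_const (by linarith : 0 ≤ 2 * δ - 1)).comp_aestronglyMeasurable
        ((aestronglyMeasurable_cutoff hη hψ).mul (aestronglyMeasurable_height hχc)))
  exact h.integral_prod_right'

lemma varianceDensity_nonneg {f : Plane → ℝ} (hα : 0 < α) (hα2 : α < 2) (hR₀ : 0 < R₀)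
    (hRs : 0 < Rs) (hχ : IsVerticalCutoff δ C₀ R₀ Rs χ) (hψ0 : ∀ x, 0 ≤ ψ x) (x : Plane) {z : ℝ}
    (hz : 0 < z) : 0 ≤ varianceDensity α δ f ψ χ (x, z) :=
  mul_nonneg (mul_nonneg (weight_pos hα hα2 hz).le (by positivity))
    (Real.rpow_nonneg (mul_nonneg (hψ0 x) (hχ.nonneg hR₀ hRs hz.le)) _)

/-- The power of the cut-off is at most 1 and vanishes above `Rs + R₀`, as `2δ - 1` is positive, so
the truncated bound for the extension controls everything by `∫ f²`. -/
lemma integrable_varianceDensity {f : Plane → ℝ} (hα : 0 < α) (hα2 : α < 2) (hR₀ : 0 < R₀)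
    (hRs : 0 < Rs) (hδ : 1 / 2 < δ) (hf : MemLp f 2 volume)
    (hχ : IsVerticalCutoff δ C₀ R₀ Rs χ) (hψ : Continuous ψ)
    (hψ0 : ∀ x, 0 ≤ ψ x) (hψ1 : ∀ x, ψ x ≤ 1) :
    Integrable (varianceDensity α δ f ψ χ) (volume.prod (volume.restrict (Ioi 0))) ∧
    ∫ p, varianceDensity α δ f ψ χ p ∂(volume.prod (volume.restrict (Ioi 0))) ≤
      1 / 2 * ((∫ z in Ioc 0 (Rs + R₀), weight α z) *
        ((∫ x : Plane, poissonKernel α x 1) ^ 2)) * ∫ y, f y ^ 2 := by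
  obtain ⟨h1, h2⟩ := weighted_extension_sq hα hα2 hf (Rs + R₀)
  have hm : AEStronglyMeasurable (varianceDensity α δ f ψ χ)
      (volume.prod (volume.restrict (Ioi 0))) := by
    refine aestronglyMeasurable_of_continuousOn ?_
    have hs : MapsTo (Prod.snd : Plane × ℝ → ℝ) (univ ×ˢ Ioi 0) (Ioi 0) := fun p hp => hp.2
    have hχc : ContinuousOn χ (Ioi 0) := hχ.contDiffOn_deriv.1.continuousOn
    exact (((continuousOn_weight α).comp continuousOn_snd hs).mul
      (continuousOn_const.mul ((continuousOn_extension hα hf).pow 2))).mul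
      (((hψ.comp continuous_fst).continuousOn.mul (hχc.comp continuousOn_snd hs)).rpow_const
        fun p _ => Or.inr (by linarith))
  have hb : ∀ᵐ p ∂((volume : Measure Plane).prod (volume.restrict (Ioi (0 : ℝ)))),
      ‖varianceDensity α δ f ψ χ p‖ ≤ 1 / 2 * ((Iic (Rs + R₀)).indicator (weight α) p.2 *
        extension α f p.1 p.2 ^ 2) := by
    filter_upwards [ae_height_pos] with ⟨x, z⟩ hz
    have hz' : 0 < z := hz
    rw [Real.norm_of_nonneg (varianceDensity_nonneg hα hα2 hR₀ hRs hχ hψ0 x hz')]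
    have hw := weight_pos hα hα2 hz'
    have hχ0 := hχ.nonneg hR₀ hRs hz'.le
    simp only [varianceDensity]
    rcases le_or_gt z (Rs + R₀) with h | h
    · rw [indicator_of_mem (mem_Iic.2 h)]
      have : (ψ x * χ z) ^ (2 * δ - 1) ≤ 1 := Real.rpow_le_one (mul_nonneg (hψ0 x) hχ0)
        (mul_le_one₀ (hψ1 x) hχ0 (hχ.le_one hRs hz'.le)) (by linarith)
      calc _ ≤ weight α z * (1 / 2 * extension α f x z ^ 2) * 1 := by gcongr
        _ = _ := by ring
    · rw [indicator_of_notMem (by simpa using h), hχ.eq_zero z h.le, mul_zero,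
        Real.zero_rpow (by linarith)]
      simp
  have hI := (h1.const_mul (1 / 2)).mono' hm hb
  refine ⟨hI, ?_⟩
  calc _ ≤ ∫ p, 1 / 2 * ((Iic (Rs + R₀)).indicator (weight α) p.2 *
        extension α f p.1 p.2 ^ 2) ∂(volume.prod (volume.restrict (Ioi 0))) :=
        integral_mono_ae hI (h1.const_mul (1 / 2))
          (hb.mono fun p hp => (le_abs_self _).trans hp)
    _ ≤ _ := by
        rw [integral_const_mul]
        refine (mul_le_mul_of_nonneg_left h2 (by norm_num)).trans (le_of_eq ?_)
        ring

/-- For `0 ≤ r ≤ 1` and an exponent `s ∈ [0, 1]` one has `r ≤ r^s`. This lets the value `η(t)` be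
absorbed into the spatial cut-off at a fixed time. -/
lemma IsRefined.const_mul (h : IsRefined δ C₀ R ψ) (hC₀ : 0 < C₀) (hR : 0 < R)
    (hδ : 1 / 2 < δ) (hδ1 : δ < 1) {r : ℝ} (hr : 0 ≤ r) (hr1 : r ≤ 1) :
    IsRefined δ C₀ R fun x => r * ψ x := by
  have hp : ∀ s : ℝ, 0 ≤ s → s ≤ 1 → ∀ x, r * ψ x ^ s ≤ (r * ψ x) ^ s := fun s hs hs1 x => by
    rw [Real.mul_rpow hr (h.nonneg x)]
    refine mul_le_mul_of_nonneg_right ?_ (Real.rpow_nonneg (h.nonneg x) _)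
    conv_lhs => rw [← Real.rpow_one r]
    exact Real.rpow_le_rpow_of_exponent_ge' hr hr1 hs hs1
  have hd : ∀ i, partialDeriv i (fun y => r * ψ y) = fun y => r * partialDeriv i ψ y := fun i =>
    funext fun y => partialDeriv_const_mul ((h.smooth.differentiable (by simp)) y) r i
  refine ⟨contDiff_const.mul h.smooth, fun x => mul_nonneg hr (h.nonneg x),
    fun x => mul_le_one₀ hr1 (h.nonneg x) (h.le_one x), fun x i => ?_, fun x i j => ?_⟩
  · rw [hd, abs_mul, abs_of_nonneg hr]
    calc r * |partialDeriv i ψ x| ≤ r * (C₀ / R * ψ x ^ δ) := by gcongr; exact h.deriv_le x i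
      _ = C₀ / R * (r * ψ x ^ δ) := by ring
      _ ≤ _ := mul_le_mul_of_nonneg_left (hp δ (by linarith) hδ1.le x) (by positivity)
  · rw [hd, partialDeriv_const_mul (((contDiff_partialDeriv h.smooth j).differentiable
      (by simp)) x), abs_mul, abs_of_nonneg hr]
    calc r * |partialDeriv i (partialDeriv j ψ) x| ≤ r * (C₀ / R ^ 2 * ψ x ^ (2 * δ - 1)) := by
          gcongr; exact h.deriv_deriv_le x i j
      _ = C₀ / R ^ 2 * (r * ψ x ^ (2 * δ - 1)) := by ring
      _ ≤ _ := mul_le_mul_of_nonneg_left (hp (2 * δ - 1) (by linarith) (by linarith) x)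
        (by positivity)

lemma integrableOn_varianceRate (hα : 0 < α) (hα2 : α < 2) (hR₀ : 0 < R₀)
    (hRs : 0 < Rs) (hδ : 1 / 2 < δ)
    (hθ : MemLp (fun p : ℝ × Plane => θ p.1 p.2) 2 ((volume.restrict (Ioo 0 S)).prod volume))
    (hL : ∀ᵐ t ∂(volume.restrict (Ioo 0 S)), MemLp (θ t) 2 volume)
    (hη : IsTimeCutoff δ C₀ T η) (hχ : IsVerticalCutoff δ C₀ R₀ Rs χ)
    (hψ : Continuous ψ) (hψ0 : ∀ x, 0 ≤ ψ x) (hψ1 : ∀ x, ψ x ≤ 1) :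
    IntegrableOn (varianceRate α δ θ η ψ χ) (Ioo 0 S) := by
  have hsq : Integrable (fun t => ∫ y, θ t y ^ 2) (volume.restrict (Ioo 0 S)) :=
    hθ.integrable_sq.integral_prod_left
  refine (hsq.const_mul (1 / 2 * ((∫ z in Ioc 0 (Rs + R₀), weight α z) *
    ((∫ x : Plane, poissonKernel α x 1) ^ 2)))).mono'
    (aestronglyMeasurable_varianceRate hθ.1 hδ hη.smooth.continuous hψ hχ) ?_
  filter_upwards [hL] with t ht
  have h0 : ∀ x, 0 ≤ η t * ψ x := fun x => mul_nonneg (hη.nonneg t) (hψ0 x)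
  rw [Real.norm_of_nonneg]
  · exact (integrable_varianceDensity hα hα2 hR₀ hRs hδ ht hχ (continuous_const.mul hψ) h0
      fun x => mul_le_one₀ (hη.le_one t) (hψ0 x) (hψ1 x)).2
  · refine integral_nonneg_of_ae ?_
    filter_upwards [ae_height_pos] with ⟨x, z⟩ hz
    exact varianceDensity_nonneg hα hα2 hR₀ hRs hχ h0 x hz

lemma abs_cutoffRate_le (hα : 0 < α) (hα2 : α < 2) (hC₀ : 0 < C₀) (hR₀ : 0 < R₀)
    (hRs : 0 < Rs) (hδ : 1 / 2 < δ) (hδ1 : δ < 1) {t : ℝ} (hL : MemLp (θ t) 2 volume)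
    (hη : IsTimeCutoff δ C₀ T η) (hχ : IsVerticalCutoff δ C₀ R₀ Rs χ)
    (hψ : IsRefined δ C₀ R ψ) (hR : 0 < R) (hRR : R ≤ R₀) :
    |cutoffRate α θ η ψ χ t| ≤ 5 * (C₀ / R ^ 2) * varianceRate α δ θ η ψ χ t := by
  have hr := hψ.const_mul hC₀ hR hδ hδ1 (hη.nonneg t) (hη.le_one t)
  rw [cutoffRate, varianceRate, ← integral_const_mul, ← Real.norm_eq_abs]
  refine norm_integral_le_of_norm_le ?_ ?_
  · exact (integrable_varianceDensity hα hα2 hR₀ hRs hδ hL hχ hr.smooth.continuous hr.nonneg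
      hr.le_one).1.const_mul _
  · filter_upwards [ae_height_pos] with ⟨x, z⟩ hz
    exact hr.abs_cutoffDensity_le hα hα2 hC₀ hR₀ hRs hδ hδ1 hχ hR hRR x hz

lemma integrableOn_cutoffRate (hα : 0 < α) (hα2 : α < 2) (hC₀ : 0 < C₀) (hR₀ : 0 < R₀)
    (hRs : 0 < Rs) (hδ : 1 / 2 < δ) (hδ1 : δ < 1)
    (hθ : MemLp (fun p : ℝ × Plane => θ p.1 p.2) 2 ((volume.restrict (Ioo 0 S)).prod volume))
    (hL : ∀ᵐ t ∂(volume.restrict (Ioo 0 S)), MemLp (θ t) 2 volume)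
    (hη : IsTimeCutoff δ C₀ T η) (hχ : IsVerticalCutoff δ C₀ R₀ Rs χ)
    (hψ : IsRefined δ C₀ R ψ) (hR : 0 < R) (hRR : R ≤ R₀) :
    IntegrableOn (cutoffRate α θ η ψ χ) (Ioo 0 S) := by
  refine ((integrableOn_varianceRate hα hα2 hR₀ hRs hδ hθ hL hη hχ hψ.smooth.continuous
    hψ.nonneg hψ.le_one).const_mul (5 * (C₀ / R ^ 2))).mono'
    (aestronglyMeasurable_cutoffRate hθ.1 hη.smooth.continuous hψ.smooth hχ) ?_
  filter_upwards [hL] with t ht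
  exact abs_cutoffRate_le hα hα2 hC₀ hR₀ hRs hδ hδ1 ht hη hχ hψ hR hRR

end Time

end SQG

namespace SQG

/-! ### Macro-scale averages and summed rates -/

section Sums

variable {α δ C₀ R₀ R Rs T : ℝ} {x₀ : Plane} {θ₀ : Plane → ℝ} {θ : ℝ → Plane → ℝ}
  {u : ℝ → Plane → Plane} {η χ : ℝ → ℝ} {ψ ψ' ψ₀ : Plane → ℝ} {c : Plane} {ρ : ℝ}
  {K₁ K₂ : ℕ} {n : ℕ} {ctr : Fin n → Plane} {φ : Fin n → Plane → ℝ}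

lemma IsWeakSolution.ae_memLp (h : IsWeakSolution α θ₀ θ u) (S : ℝ) :
    ∀ᵐ t ∂(volume.restrict (Ioo 0 S)), MemLp (θ t) 2 volume := by
  filter_upwards [ae_restrict_mem measurableSet_Ioo, ae_restrict_of_ae h.velocity_eq] with t ht hv
  exact (hv ht.1).memLp

lemma integrable_dissipationDensity_slice (hα : 0 < α) (hα2 : α < 2) (hC₀ : 0 < C₀) (hR₀ : 0 < R₀)
    (hRs : 0 < Rs) (hδ : 1 / 2 < δ) (hδ1 : δ < 1)
    (hθ : ContDiffOn ℝ ∞ (fun p : ℝ × Plane => θ p.1 p.2) (Ioo 0 (2 * T) ×ˢ ball c ρ))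
    (hη : IsTimeCutoff δ C₀ T η) (hχ : IsVerticalCutoff δ C₀ R₀ Rs χ)
    (hψ : ContDiff ℝ ∞ ψ) (hψ0 : ∀ x, 0 ≤ ψ x) (hs : tsupport ψ ⊆ ball c ρ) {t : ℝ}
    (ht : t ∈ Ioo 0 (2 * T)) (hL : MemLp (θ t) 2 volume) :
    Integrable (dissipationDensity α (θ t) (fun x => η t * ψ x) χ)
      (volume.prod (volume.restrict (Ioi 0))) :=
  (integral_dissipationDensity hα hα2 hL hC₀ hR₀ hRs hδ hδ1 (contDiffOn_slice hθ ht)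
    (contDiff_const.mul hψ) (fun x => mul_nonneg (hη.nonneg t) (hψ0 x))
    ((tsupport_const_mul_subset _ _).trans hs) hχ).1

lemma dissipationDensity_mono {f : Plane → ℝ} (hα : 0 < α) (hα2 : α < 2) (hR₀ : 0 < R₀)
    (hRs : 0 < Rs) (hχ : IsVerticalCutoff δ C₀ R₀ Rs χ) {x : Plane} (h : ψ x ≤ ψ' x) {z : ℝ}
    (hz : 0 < z) : dissipationDensity α f ψ χ (x, z) ≤ dissipationDensity α f ψ' χ (x, z) := by
  have hw := weight_pos hα hα2 hz
  have hχ0 := hχ.nonneg hR₀ hRs hz.le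
  have hg : 0 ≤ extensionGradSq α f x z := add_nonneg (sq_nonneg _) (sq_nonneg _)
  simp only [dissipationDensity]
  gcongr

lemma integral_interval_eq (hT : 0 < T) (g : ℝ → ℝ) :
    ∫ t in (0 : ℝ)..(2 * T), g t = ∫ t in Ioo 0 (2 * T), g t := by
  rw [intervalIntegral.integral_of_le (by linarith), integral_Ioc_eq_integral_Ioo]

/-- Passing from the iterated integrals to the product measure needs integrability of the density,
which the energy identity provides at almost every time. -/
lemma dissipationAvg_eq (hα : 0 < α) (hα2 : α < 2) (hC₀ : 0 < C₀) (hR₀ : 0 < R₀)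
    (hRs : 0 < Rs) (hδ : 1 / 2 < δ) (hδ1 : δ < 1) (hT : 0 < T) (hsol : IsWeakSolution α θ₀ θ u)
    (hθ : ContDiffOn ℝ ∞ (fun p : ℝ × Plane => θ p.1 p.2) (Ioo 0 (2 * T) ×ˢ ball c ρ))
    (hη : IsTimeCutoff δ C₀ T η) (hχ : IsVerticalCutoff δ C₀ R₀ Rs χ)
    (hψ : ContDiff ℝ ∞ ψ) (hψ0 : ∀ x, 0 ≤ ψ x) (hs : tsupport ψ ⊆ ball c ρ) :
    T * R₀ ^ 2 * dissipationAvg α R₀ T θ η ψ χ =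
      ∫ t in Ioo 0 (2 * T), dissipationRate α θ η ψ χ t := by
  have h : ∫ t in Ioo 0 (2 * T), 1 / R₀ ^ 2 * ∫ x, ∫ z in Ioi (0 : ℝ),
      weight α z * extensionGradSq α (θ t) x z * (η t * ψ x * χ z) =
      ∫ t in Ioo 0 (2 * T), 1 / R₀ ^ 2 * dissipationRate α θ η ψ χ t := by
    refine integral_congr_ae ?_
    filter_upwards [ae_restrict_mem measurableSet_Ioo, hsol.ae_memLp (2 * T)] with t ht hL
    rw [dissipationRate, integral_prod _ (integrable_dissipationDensity_slice hα hα2 hC₀ hR₀ hRs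
      hδ hδ1 hθ hη hχ hψ hψ0 hs ht hL)]
    rfl
  rw [dissipationAvg, integral_interval_eq hT, h, integral_const_mul]
  field_simp

lemma extVarianceAvg_eq (hα : 0 < α) (hα2 : α < 2) (hR₀ : 0 < R₀)
    (hRs : 0 < Rs) (hδ : 1 / 2 < δ) (hT : 0 < T) (hsol : IsWeakSolution α θ₀ θ u)
    (hη : IsTimeCutoff δ C₀ T η) (hχ : IsVerticalCutoff δ C₀ R₀ Rs χ)
    (hψ : Continuous ψ) (hψ0 : ∀ x, 0 ≤ ψ x) (hψ1 : ∀ x, ψ x ≤ 1) :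
    T * R₀ ^ 2 * extVarianceAvg α δ R₀ T θ η ψ χ =
      ∫ t in Ioo 0 (2 * T), varianceRate α δ θ η ψ χ t := by
  have h : ∫ t in Ioo 0 (2 * T), 1 / R₀ ^ 2 * ∫ x, ∫ z in Ioi (0 : ℝ),
      weight α z * (1 / 2 * extension α (θ t) x z ^ 2) * (η t * ψ x * χ z) ^ (2 * δ - 1) =
      ∫ t in Ioo 0 (2 * T), 1 / R₀ ^ 2 * varianceRate α δ θ η ψ χ t := by
    refine integral_congr_ae ?_
    filter_upwards [hsol.ae_memLp (2 * T)] with t hL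
    rw [varianceRate, integral_prod _ (integrable_varianceDensity (ψ := fun x => η t * ψ x) hα hα2 hR₀ hRs
      hδ hL hχ (continuous_const.mul hψ) (fun x => mul_nonneg (hη.nonneg t) (hψ0 x))
      fun x => mul_le_one₀ (hη.le_one t) (hψ0 x) (hψ1 x)).1]
    rfl
  rw [extVarianceAvg, integral_interval_eq hT, h, integral_const_mul]
  field_simp

/-- The rate belonging to the average `ϑ₀`. -/
noncomputable def surfaceRate (δ : ℝ) (θ : ℝ → Plane → ℝ) (η : ℝ → ℝ) (ψ : Plane → ℝ)
    (t : ℝ) : ℝ :=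
  ∫ x, 1 / 2 * θ t x ^ 2 * (η t * ψ x) ^ (2 * δ - 1)

lemma varianceAvg_eq (hR₀ : 0 < R₀) (hT : 0 < T) :
    T * R₀ ^ 2 * varianceAvg δ R₀ T θ η ψ = ∫ t in Ioo 0 (2 * T), surfaceRate δ θ η ψ t := by
  have h : varianceAvg δ R₀ T θ η ψ = 1 / T * ∫ t in Ioo 0 (2 * T),
      1 / R₀ ^ 2 * surfaceRate δ θ η ψ t := by
    rw [varianceAvg, integral_interval_eq hT]
    rfl
  rw [h, integral_const_mul]
  field_simp

lemma integrable_surface_density (hδ : 1 / 2 < δ) (hψ : Continuous ψ) (hψ0 : ∀ x, 0 ≤ ψ x)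
    (hψ1 : ∀ x, ψ x ≤ 1) {f : Plane → ℝ} (hf : MemLp f 2 volume) :
    Integrable (fun x => 1 / 2 * f x ^ 2 * ψ x ^ (2 * δ - 1)) volume := by
  refine (hf.integrable_sq.const_mul (1 / 2)).mul_bdd (c := 1)
    (hψ.rpow_const fun x => Or.inr (by linarith)).aestronglyMeasurable (ae_of_all _ fun x => ?_)
  rw [Real.norm_of_nonneg (Real.rpow_nonneg (hψ0 x) _)]
  exact Real.rpow_le_one (hψ0 x) (hψ1 x) (by linarith)

lemma integrableOn_surfaceRate (hδ : 1 / 2 < δ) {S : ℝ}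
    (hθ : MemLp (fun p : ℝ × Plane => θ p.1 p.2) 2 ((volume.restrict (Ioo 0 S)).prod volume))
    (hη : IsTimeCutoff δ C₀ T η) (hψ : Continuous ψ) (hψ0 : ∀ x, 0 ≤ ψ x)
    (hψ1 : ∀ x, ψ x ≤ 1) : IntegrableOn (surfaceRate δ θ η ψ) (Ioo 0 S) := by
  have h0 : ∀ p : ℝ × Plane, 0 ≤ η p.1 * ψ p.2 := fun p => mul_nonneg (hη.nonneg _) (hψ0 _)
  have hc : Continuous fun p : ℝ × Plane => η p.1 * ψ p.2 :=
    (hη.smooth.continuous.comp continuous_fst).mul (hψ.comp continuous_snd)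
  have h : Integrable (fun p : ℝ × Plane =>
      1 / 2 * θ p.1 p.2 ^ 2 * (η p.1 * ψ p.2) ^ (2 * δ - 1))
      ((volume.restrict (Ioo 0 S)).prod volume) := by
    refine (hθ.integrable_sq.const_mul (1 / 2)).mul_bdd (c := 1)
      (hc.rpow_const fun x => Or.inr (by linarith)).aestronglyMeasurable
      (ae_of_all _ fun p => ?_)
    rw [Real.norm_of_nonneg (Real.rpow_nonneg (h0 p) _)]
    exact Real.rpow_le_one (h0 p) (mul_le_one₀ (hη.le_one _) (hψ0 _) (hψ1 _)) (by linarith)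
  exact h.integral_prod_left

lemma le_rpow_of_le_one {a p : ℝ} (ha : 0 ≤ a) (ha1 : a ≤ 1) (hp : 0 ≤ p) (hp1 : p ≤ 1) :
    a ≤ a ^ p := by
  conv_lhs => rw [← Real.rpow_one a]
  exact Real.rpow_le_rpow_of_exponent_ge' ha ha1 hp hp1

/-- The sum is taken under the integral first, so overlaps enter only through the pointwise bound `∑
φᵢ ≤ K₂ ψ₀`. -/
lemma abs_sum_time_error_le (hδ : 1 / 2 < δ) (hδ1 : δ < 1) (hC₀ : 0 < C₀) (hT : 0 < T)
    (hψ₀ : IsMacroCutoff δ C₀ x₀ R₀ ψ₀) (hφ : IsCutoffFamily δ C₀ x₀ R₀ ψ₀ K₂ R n ctr φ)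
    (hη : IsTimeCutoff δ C₀ T η) {t : ℝ} (hL : MemLp (θ t) 2 volume) :
    |∑ i, ∫ x, 1 / 2 * θ t x ^ 2 * (deriv η t * φ i x)| ≤
      C₀ / T * K₂ * surfaceRate δ θ η ψ₀ t := by
  have hi : ∀ i, Integrable (fun x => 1 / 2 * θ t x ^ 2 * (deriv η t * φ i x)) volume := fun i => by
    refine (hL.integrable_sq.const_mul (1 / 2)).mul_bdd (c := |deriv η t|)
      (continuous_const.mul (hφ.refined i).smooth.continuous).aestronglyMeasurable
      (ae_of_all _ fun x => ?_)
    rw [norm_mul, Real.norm_of_nonneg ((hφ.refined i).nonneg x)]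
    exact mul_le_of_le_one_right (abs_nonneg _) ((hφ.refined i).le_one x)
  have h0 : ∀ x, 0 ≤ η t * ψ₀ x := fun x => mul_nonneg (hη.nonneg _) (hψ₀.refined.nonneg x)
  rw [← integral_finsetSum _ fun i _ => hi i, surfaceRate, ← integral_const_mul]
  refine abs_integral_le_of_abs_le ?_ fun x => ?_
  · exact (integrable_surface_density hδ (continuous_const.mul hψ₀.refined.smooth.continuous) h0
      (fun x => mul_le_one₀ (hη.le_one t) (hψ₀.refined.nonneg x) (hψ₀.refined.le_one x))
      hL).const_mul _
  · have hsum : ∑ i, φ i x ≤ K₂ * ψ₀ x := hφ.sum_le (hψ₀.refined.nonneg x) (fun i h => h)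
      fun i => hφ.le_macro i x
    have hsum0 : 0 ≤ ∑ i, φ i x := Finset.sum_nonneg fun i _ => (hφ.refined i).nonneg x
    have hp : ψ₀ x ≤ ψ₀ x ^ (2 * δ - 1) := le_rpow_of_le_one (hψ₀.refined.nonneg x)
      (hψ₀.refined.le_one x) (by linarith) (by linarith)
    rw [← Finset.mul_sum, ← Finset.mul_sum, abs_mul, abs_mul (deriv η t), abs_of_nonneg hsum0,
      abs_of_nonneg (by positivity : (0 : ℝ) ≤ 1 / 2 * θ t x ^ 2),
      Real.mul_rpow (hη.nonneg t) (hψ₀.refined.nonneg x)]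
    have hη' := hη.deriv_le t
    have hηp : 0 ≤ η t ^ (2 * δ - 1) := Real.rpow_nonneg (hη.nonneg t) _
    calc _ ≤ 1 / 2 * θ t x ^ 2 * (C₀ / T * η t ^ (2 * δ - 1) * (K₂ * ψ₀ x ^ (2 * δ - 1))) := by
          gcongr
          exact hsum.trans (by gcongr)
      _ = _ := by ring

/-- Summing the densities pointwise, at most `K₂` are nonzero and each is at most the one for `ψ₀`,
so the number of balls does not enter. -/
lemma abs_sum_cutoffRate_le (hα : 0 < α) (hα2 : α < 2) (hC₀ : 0 < C₀) (hR₀ : 0 < R₀)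
    (hRs : 0 < Rs) (hδ : 1 / 2 < δ) (hδ1 : δ < 1) (hR : 0 < R) (hRR : R ≤ R₀)
    (hψ₀ : IsMacroCutoff δ C₀ x₀ R₀ ψ₀) (hφ : IsCutoffFamily δ C₀ x₀ R₀ ψ₀ K₂ R n ctr φ)
    (hη : IsTimeCutoff δ C₀ T η) (hχ : IsVerticalCutoff δ C₀ R₀ Rs χ) {t : ℝ}
    (hL : MemLp (θ t) 2 volume) :
    |∑ i, cutoffRate α θ η (φ i) χ t| ≤
      5 * (C₀ / R ^ 2) * K₂ * varianceRate α δ θ η ψ₀ χ t := by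
  have hr : ∀ i, IsRefined δ C₀ R fun x => η t * φ i x := fun i =>
    (hφ.refined i).const_mul hC₀ hR hδ hδ1 (hη.nonneg t) (hη.le_one t)
  have hr₀ := hψ₀.refined.const_mul hC₀ hR₀ hδ hδ1 (hη.nonneg t) (hη.le_one t)
  have hi : ∀ i, Integrable (varianceDensity α δ (θ t) (fun x => η t * φ i x) χ)
      (volume.prod (volume.restrict (Ioi 0))) := fun i =>
    (integrable_varianceDensity hα hα2 hR₀ hRs hδ hL hχ (hr i).smooth.continuous (hr i).nonneg
      (hr i).le_one).1
  have h1 : |∑ i, cutoffRate α θ η (φ i) χ t| ≤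
      ∑ i, 5 * (C₀ / R ^ 2) * varianceRate α δ θ η (φ i) χ t :=
    (Finset.abs_sum_le_sum_abs _ _).trans (Finset.sum_le_sum fun i _ =>
      abs_cutoffRate_le hα hα2 hC₀ hR₀ hRs hδ hδ1 hL hη hχ (hφ.refined i) hR hRR)
  refine h1.trans ?_
  rw [← Finset.mul_sum, mul_assoc _ (K₂ : ℝ)]
  refine mul_le_mul_of_nonneg_left ?_ (by positivity)
  simp only [varianceRate]
  rw [← integral_finsetSum _ fun i _ => hi i, ← integral_const_mul]
  refine integral_mono_ae (integrable_finsetSum _ fun i _ => hi i)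
    ((integrable_varianceDensity hα hα2 hR₀ hRs hδ hL hχ hr₀.smooth.continuous hr₀.nonneg
      hr₀.le_one).1.const_mul _) ?_
  filter_upwards [ae_height_pos] with ⟨x, z⟩ hz
  have hz' : 0 < z := hz
  have hw := weight_pos hα hα2 hz'
  have hχ0 := hχ.nonneg hR₀ hRs hz'.le
  refine hφ.sum_le (x := x) (varianceDensity_nonneg hα hα2 hR₀ hRs hχ hr₀.nonneg x hz') (fun i h => ?_)
    fun i => ?_
  · simp only [varianceDensity, h, mul_zero, zero_mul]
    rw [Real.zero_rpow (by linarith), mul_zero]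
  · simp only [varianceDensity]
    refine mul_le_mul_of_nonneg_left ?_ (by positivity)
    refine Real.rpow_le_rpow (mul_nonneg ((hr i).nonneg x) hχ0) ?_ (by linarith)
    exact mul_le_mul_of_nonneg_right
      (mul_le_mul_of_nonneg_left (hφ.le_macro i x) (hη.nonneg t)) hχ0

/-- The density is linear in the spatial cut-off with nonnegative coefficient, so pointwise
comparisons of cut-offs carry over. The bounds for single indices yield integrability in time. -/
lemma sum_dissipationRate_bounds (hα : 0 < α) (hα2 : α < 2) (hC₀ : 0 < C₀) (hR₀ : 0 < R₀)
    (hRs : 0 < Rs) (hδ : 1 / 2 < δ) (hδ1 : δ < 1)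
    (hθ : ContDiffOn ℝ ∞ (fun p : ℝ × Plane => θ p.1 p.2) (Ioo 0 (2 * T) ×ˢ ball x₀ (2 * R₀)))
    (hψ₀ : IsMacroCutoff δ C₀ x₀ R₀ ψ₀) (hc : IsCover K₁ K₂ x₀ R₀ R n ctr)
    (hφ : IsCutoffFamily δ C₀ x₀ R₀ ψ₀ K₂ R n ctr φ)
    (hη : IsTimeCutoff δ C₀ T η) (hχ : IsVerticalCutoff δ C₀ R₀ Rs χ) {t : ℝ}
    (ht : t ∈ Ioo 0 (2 * T)) (hL : MemLp (θ t) 2 volume) :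
    dissipationRate α θ η ψ₀ χ t ≤ ∑ i, dissipationRate α θ η (φ i) χ t ∧
    ∑ i, dissipationRate α θ η (φ i) χ t ≤ K₂ * dissipationRate α θ η ψ₀ χ t ∧
    ∀ i, 0 ≤ dissipationRate α θ η (φ i) χ t ∧
      dissipationRate α θ η (φ i) χ t ≤ dissipationRate α θ η ψ₀ χ t := by
  have hi : ∀ i, Integrable (dissipationDensity α (θ t) (fun x => η t * φ i x) χ)
      (volume.prod (volume.restrict (Ioi 0))) := fun i =>
    integrable_dissipationDensity_slice hα hα2 hC₀ hR₀ hRs hδ hδ1 hθ hη hχ (hφ.refined i).smooth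
      (hφ.refined i).nonneg (hφ.tsupport_subset hψ₀ i) ht hL
  have hi₀ := integrable_dissipationDensity_slice hα hα2 hC₀ hR₀ hRs hδ hδ1 hθ hη hχ
    hψ₀.refined.smooth hψ₀.refined.nonneg hψ₀.support_subset ht hL
  have hηt := hη.nonneg t
  have hg : ∀ x z, 0 < z → 0 ≤ weight α z * extensionGradSq α (θ t) x z * (η t * χ z) :=
    fun x z hz => mul_nonneg (mul_nonneg (weight_pos hα hα2 hz).le
      (add_nonneg (sq_nonneg _) (sq_nonneg _))) (mul_nonneg hηt (hχ.nonneg hR₀ hRs hz.le))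
  have hd : ∀ (ψ : Plane → ℝ) (x : Plane) (z : ℝ),
      dissipationDensity α (θ t) (fun x => η t * ψ x) χ (x, z) =
        weight α z * extensionGradSq α (θ t) x z * (η t * χ z) * ψ x := fun ψ x z => by
    simp only [dissipationDensity]; ring
  have hsum : ∑ i, dissipationRate α θ η (φ i) χ t = ∫ p, ∑ i,
      dissipationDensity α (θ t) (fun x => η t * φ i x) χ p
        ∂(volume.prod (volume.restrict (Ioi 0))) := by
    rw [integral_finsetSum _ fun i _ => hi i]
    rfl
  refine ⟨?_, ?_, fun i => ⟨?_, ?_⟩⟩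
  · rw [hsum]
    refine integral_mono_ae hi₀ (integrable_finsetSum _ fun i _ => hi i) ?_
    filter_upwards [ae_height_pos] with ⟨x, z⟩ hz
    simp only [hd]
    rw [← Finset.mul_sum]
    exact mul_le_mul_of_nonneg_left (hφ.parent_le_sum hR₀ hψ₀ hc x) (hg x z hz)
  · rw [hsum, dissipationRate, ← integral_const_mul]
    refine integral_mono_ae (integrable_finsetSum _ fun i _ => hi i) (hi₀.const_mul _) ?_
    filter_upwards [ae_height_pos] with ⟨x, z⟩ hz
    simp only [hd]
    rw [← Finset.mul_sum, mul_left_comm (K₂ : ℝ)]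
    exact mul_le_mul_of_nonneg_left (hφ.sum_le (hψ₀.refined.nonneg x) (fun i h => h)
      fun i => hφ.le_macro i x) (hg x z hz)
  · refine integral_nonneg_of_ae ?_
    filter_upwards [ae_height_pos] with ⟨x, z⟩ hz
    rw [hd]
    exact mul_nonneg (hg x z hz) ((hφ.refined i).nonneg x)
  · refine integral_mono_ae (hi i) hi₀ ?_
    filter_upwards [ae_height_pos] with ⟨x, z⟩ hz
    exact dissipationDensity_mono hα hα2 hR₀ hRs hχ
      (mul_le_mul_of_nonneg_left (hφ.le_macro i x) hηt) hz

/-- The bounds on the sum of the localized fluxes, in terms of the macro-scale averages. -/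
theorem sum_localFlux_bounds (hα : 0 < α) (hα2 : α < 2) (hC₀ : 0 < C₀) (hR₀ : 0 < R₀)
    (hRs : 0 < Rs) (hδ : 1 / 2 < δ) (hδ1 : δ < 1) (hT : 0 < T) (hsol : IsWeakSolution α θ₀ θ u)
    (hθ : ContDiffOn ℝ ∞ (fun p : ℝ × Plane => θ p.1 p.2) (Ioo 0 (2 * T) ×ˢ ball x₀ (2 * R₀)))
    (hu : ContDiffOn ℝ ∞ (fun p : ℝ × Plane => u p.1 p.2) (Ioo 0 (2 * T) ×ˢ ball x₀ (2 * R₀)))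
    (hη : IsTimeCutoff δ C₀ T η) (hψ₀ : IsMacroCutoff δ C₀ x₀ R₀ ψ₀)
    (hχ : IsVerticalCutoff δ C₀ R₀ Rs χ) (hc : IsCover K₁ K₂ x₀ R₀ R n ctr)
    (hφ : IsCutoffFamily δ C₀ x₀ R₀ ψ₀ K₂ R n ctr φ)
    (hε : 0 < dissipationAvg α R₀ T θ η ψ₀ χ) :
    R₀ ^ 2 * (dissipationAvg α R₀ T θ η ψ₀ χ -
      5 * (C₀ / R ^ 2) * K₂ * extVarianceAvg α δ R₀ T θ η ψ₀ χ -
      C₀ / T * K₂ * varianceAvg δ R₀ T θ η ψ₀) ≤ ∑ i, localFlux T θ u η (φ i) ∧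
    ∑ i, localFlux T θ u η (φ i) ≤ R₀ ^ 2 * (K₂ * dissipationAvg α R₀ T θ η ψ₀ χ +
      5 * (C₀ / R ^ 2) * K₂ * extVarianceAvg α δ R₀ T θ η ψ₀ χ +
      C₀ / T * K₂ * varianceAvg δ R₀ T θ η ψ₀) := by
  have hL := hsol.ae_memLp (2 * T)
  have hθm := hsol.temperature_memLp (2 * T) (by linarith)
  have hr₀ := hψ₀.refined
  have eD := dissipationAvg_eq hα hα2 hC₀ hR₀ hRs hδ hδ1 hT hsol hθ hη hχ hr₀.smooth hr₀.nonneg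
    hψ₀.support_subset
  have eV := extVarianceAvg_eq hα hα2 hR₀ hRs hδ hT hsol hη hχ hr₀.smooth.continuous hr₀.nonneg
    hr₀.le_one
  have eS := varianceAvg_eq (δ := δ) (θ := θ) (η := η) (ψ := ψ₀) hR₀ hT
  -- A non-integrable rate would have integral 0 by convention, contradicting `ε₀* > 0`; positivity
  -- of the average thus supplies integrability in time.
  have iD : IntegrableOn (dissipationRate α θ η ψ₀ χ) (Ioo 0 (2 * T)) := by
    by_contra h
    rw [integral_undef h] at eD
    have : 0 < T * R₀ ^ 2 * dissipationAvg α R₀ T θ η ψ₀ χ := by positivity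
    linarith
  have iV := integrableOn_varianceRate hα hα2 hR₀ hRs hδ hθm hL hη hχ hr₀.smooth.continuous
    hr₀.nonneg hr₀.le_one
  have iS := integrableOn_surfaceRate hδ hθm hη hr₀.smooth.continuous hr₀.nonneg hr₀.le_one
  have hmem : ∀ᵐ t ∂(volume.restrict (Ioo 0 (2 * T))), t ∈ Ioo 0 (2 * T) :=
    ae_restrict_mem measurableSet_Ioo
  have hb := (hmem.and hL).mono fun t ht =>
    sum_dissipationRate_bounds hα hα2 hC₀ hR₀ hRs hδ hδ1 hθ hψ₀ hc hφ hη hχ ht.1 ht.2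
  have iDi : ∀ i, IntegrableOn (dissipationRate α θ η (φ i) χ) (Ioo 0 (2 * T)) := fun i => by
    refine iD.mono' (aestronglyMeasurable_dissipationRate hα hα2 hθm.1 hL hη.smooth.continuous
      (hφ.refined i).smooth.continuous hχ) ?_
    filter_upwards [hb] with t ht
    rw [Real.norm_of_nonneg (ht.2.2 i).1]
    exact (ht.2.2 i).2
  have iVi : ∀ i, IntegrableOn (cutoffRate α θ η (φ i) χ) (Ioo 0 (2 * T)) := fun i =>
    integrableOn_cutoffRate hα hα2 hC₀ hR₀ hRs hδ hδ1 hθm hL hη hχ (hφ.refined i) hc.scale_pos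
      hc.scale_le
  have iSi : ∀ i, IntegrableOn (fun t => ∫ x, 1 / 2 * θ t x ^ 2 * (deriv η t * φ i x))
      (Ioo 0 (2 * T)) := fun i => by
    obtain ⟨h1, h2⟩ := integrable_time_error_density (hφ.refined i).smooth
      (hφ.tsupport_subset hψ₀ i) hT hη hθ
    have h3 : Integrable (fun p : ℝ × Plane => 1 / 2 * θ p.1 p.2 ^ 2 * (deriv η p.1 * φ i p.2))
      (volume.prod volume) := h1.integrable_of_hasCompactSupport h2
    exact h3.integral_prod_left.integrableOn
  have hflux : T * ∑ i, localFlux T θ u η (φ i) =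
      (∫ t in Ioo 0 (2 * T), ∑ i, dissipationRate α θ η (φ i) χ t) -
        (∫ t in Ioo 0 (2 * T), ∑ i, cutoffRate α θ η (φ i) χ t) -
        ∫ t in Ioo 0 (2 * T), ∑ i, ∫ x, 1 / 2 * θ t x ^ 2 * (deriv η t * φ i x) := by
    rw [integral_finsetSum _ fun i _ => iDi i, integral_finsetSum _ fun i _ => iVi i,
      integral_finsetSum _ fun i _ => iSi i, Finset.mul_sum, ← Finset.sum_sub_distrib,
      ← Finset.sum_sub_distrib]
    refine Finset.sum_congr rfl fun i _ => ?_
    rw [← energy_balance hα hα2 hC₀ hR₀ hRs hδ hδ1 hT hsol hθ hu hη hχ (hφ.refined i).smooth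
      (hφ.refined i).nonneg (hφ.tsupport_subset hψ₀ i) (iDi i) (iVi i), localFlux,
      integral_interval_eq hT]
    field_simp
  have bV : |∫ t in Ioo 0 (2 * T), ∑ i, cutoffRate α θ η (φ i) χ t| ≤
      5 * (C₀ / R ^ 2) * K₂ * (T * R₀ ^ 2 * extVarianceAvg α δ R₀ T θ η ψ₀ χ) := by
    rw [eV, ← integral_const_mul, ← Real.norm_eq_abs]
    refine norm_integral_le_of_norm_le (iV.const_mul _) ?_
    filter_upwards [hL] with t hLt
    exact abs_sum_cutoffRate_le hα hα2 hC₀ hR₀ hRs hδ hδ1 hc.scale_pos hc.scale_le hψ₀ hφ hη hχ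
      hLt
  have bS : |∫ t in Ioo 0 (2 * T), ∑ i, ∫ x, 1 / 2 * θ t x ^ 2 * (deriv η t * φ i x)| ≤
      C₀ / T * K₂ * (T * R₀ ^ 2 * varianceAvg δ R₀ T θ η ψ₀) := by
    rw [eS, ← integral_const_mul, ← Real.norm_eq_abs]
    refine norm_integral_le_of_norm_le (iS.const_mul _) ?_
    filter_upwards [hL] with t hLt
    exact abs_sum_time_error_le hδ hδ1 hC₀ hT hψ₀ hφ hη hLt
  have iDs : IntegrableOn (fun t => ∑ i, dissipationRate α θ η (φ i) χ t) (Ioo 0 (2 * T)) :=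
    integrable_finsetSum _ fun i _ => iDi i
  have bD1 : T * R₀ ^ 2 * dissipationAvg α R₀ T θ η ψ₀ χ ≤
      ∫ t in Ioo 0 (2 * T), ∑ i, dissipationRate α θ η (φ i) χ t := by
    rw [eD]
    exact integral_mono_ae iD iDs (hb.mono fun t ht => ht.1)
  have bD2 : ∫ t in Ioo 0 (2 * T), ∑ i, dissipationRate α θ η (φ i) χ t ≤
      K₂ * (T * R₀ ^ 2 * dissipationAvg α R₀ T θ η ψ₀ χ) := by
    rw [eD, ← integral_const_mul]
    exact integral_mono_ae iDs (iD.const_mul _) (hb.mono fun t ht => ht.2.1)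
  obtain ⟨bV1, bV2⟩ := abs_le.1 bV
  obtain ⟨bS1, bS2⟩ := abs_le.1 bS
  constructor
  · refine le_of_mul_le_mul_left ?_ hT
    rw [hflux]
    linarith
  · refine le_of_mul_le_mul_left ?_ hT
    rw [hflux]
    linarith

end Sums

end SQG

namespace SQG

/-! ### The range of scales -/

section Scales

variable {α C₀ v vs e R : ℝ} {K₁ K₂ : ℕ}

lemma cascadeParam_pos (hC₀ : 0 < C₀) (hK₁ : 0 < K₁) (hK₂ : 0 < K₂) :
    0 < cascadeParam α C₀ K₁ K₂ := by
  have : (0 : ℝ) < 8 * C₀ * K₁ * K₂ := by positivity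
  exact lt_min (Real.rpow_pos_of_pos this _) (Real.rpow_pos_of_pos this _)

/-- Used with `B = 8 C₀ K₁ K₂` and `q = α` or `q = 2`, matching the two entries of `σ₀` with those
of `β`. -/
lemma le_of_rpow_le {q B : ℝ} (hq : 0 < q) (hB : 0 < B) (hv : 0 ≤ v) (he : 0 < e) (hR : 0 < R)
    (h : (v / e) ^ (1 / q) ≤ B ^ (-1 / q) * R) : v ≤ R ^ q * e / B := by
  have h0 : 0 ≤ v / e := by positivity
  have h1 : v / e ≤ (B ^ (-1 / q) * R) ^ q := by
    have := Real.rpow_le_rpow (Real.rpow_nonneg h0 _) h hq.le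
    rwa [← Real.rpow_mul h0, one_div_mul_cancel hq.ne', Real.rpow_one] at this
  rw [Real.mul_rpow (Real.rpow_nonneg hB.le _) hR.le, ← Real.rpow_mul hB.le,
    div_mul_cancel₀ _ hq.ne', Real.rpow_neg_one, div_le_iff₀ he] at h1
  exact h1.trans (le_of_eq (by ring))

lemma averages_le_of_lengthScale_le (hα : 0 < α) (hC₀ : 0 < C₀) (hK₁ : 0 < K₁) (hK₂ : 0 < K₂)
    (hv : 0 ≤ v) (hvs : 0 ≤ vs) (he : 0 < e) (hR : 0 < R)
    (h : lengthScale α v vs e ≤ cascadeParam α C₀ K₁ K₂ * R) :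
    v ≤ R ^ α * e / (8 * C₀ * K₁ * K₂) ∧ vs ≤ R ^ 2 * e / (8 * C₀ * K₁ * K₂) := by
  have hB : (0 : ℝ) < 8 * C₀ * K₁ * K₂ := by positivity
  constructor
  · exact le_of_rpow_le hα hB hv he hR (((le_max_left _ _).trans h).trans
      (mul_le_mul_of_nonneg_right (min_le_right _ _) hR.le))
  · have := le_of_rpow_le (q := 2) two_pos hB hvs he hR (((le_max_right _ _).trans h).trans
      (mul_le_mul_of_nonneg_right (min_le_left _ _) hR.le))
    simpa using this

/-- The quotient is `(x t)/(s y)`: the sums lose the factor `16 K₂`, the cardinalities the factor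
`K₁`, and `b/a = (r/R)²`. -/
lemma ratio_bounds {x y Y a b s t r R₀ : ℝ} (hY : 0 < Y) (hs : 0 < s) (ht : 0 < t) (hR₀ : 0 < R₀)
    (hr : 0 < r) (hR : 0 < R) (hK₁ : 0 < K₁) (hK₂ : 0 < K₂)
    (hx : x ∈ Icc Y (16 * K₂ * Y)) (hy : y ∈ Icc Y (16 * K₂ * Y))
    (ha : a = (R₀ / r) ^ 2) (hb : b = (R₀ / R) ^ 2)
    (hsa : s ∈ Icc a (K₁ * a)) (htb : t ∈ Icc b (K₁ * b)) :
    1 / (16 * (K₁ : ℝ) * K₂) * (r / R) ^ 2 ≤ (1 / s * x) / (1 / t * y) ∧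
      (1 / s * x) / (1 / t * y) ≤ 16 * (K₁ : ℝ) * K₂ * (r / R) ^ 2 := by
  have ha0 : 0 < a := by rw [ha]; positivity
  have hb0 : 0 < b := by rw [hb]; positivity
  have hrR : (r / R) ^ 2 = b / a := by rw [ha, hb]; field_simp
  have hx0 : 0 < x := hY.trans_le hx.1
  have hy0 : 0 < y := hY.trans_le hy.1
  have hK₁' : (0 : ℝ) < K₁ := by exact_mod_cast hK₁
  have hK₂' : (0 : ℝ) < K₂ := by exact_mod_cast hK₂
  have e : (1 / s * x) / (1 / t * y) = (x * t) / (s * y) := by field_simp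
  rw [e, hrR]
  constructor
  · calc 1 / (16 * (K₁ : ℝ) * K₂) * (b / a) = (Y * b) / ((K₁ * a) * (16 * K₂ * Y)) := by
          field_simp
      _ ≤ _ := div_le_div₀ (by positivity) (mul_le_mul hx.1 htb.1 hb0.le hx0.le) (by positivity)
          (mul_le_mul hsa.2 hy.2 hy0.le (by positivity))
  · calc (x * t) / (s * y) ≤ ((16 * K₂ * Y) * (K₁ * b)) / (a * Y) :=
          div_le_div₀ (by positivity) (mul_le_mul hx.2 htb.2 ht.le (by positivity))
            (by positivity) (mul_le_mul hsa.1 hy.1 hY.le hs.le)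
      _ = _ := by field_simp

end Scales

/-! ### Total flux at a scale in the inertial range -/

lemma sum_localFlux_mem_Icc {α δ C₀ R₀ R Rs T : ℝ} {x₀ : Plane} {θ₀ : Plane → ℝ}
    {θ : ℝ → Plane → ℝ} {u : ℝ → Plane → Plane} {η χ : ℝ → ℝ} {ψ₀ : Plane → ℝ}
    {K₁ K₂ n : ℕ} {c : Fin n → Plane} {ψ : Fin n → Plane → ℝ}
    (hα : 0 < α) (hα2 : α < 2) (hC₀ : 0 < C₀) (hR₀ : 0 < R₀)
    (hRs : 0 < Rs) (hδ : 1 / 2 < δ) (hδ1 : δ < 1) (hT : 0 < T) (hTR : R₀ ^ α ≤ 2 * T)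
    (hsol : IsWeakSolution α θ₀ θ u)
    (hθ : ContDiffOn ℝ ∞ (fun p : ℝ × Plane => θ p.1 p.2) (Ioo 0 (2 * T) ×ˢ ball x₀ (2 * R₀)))
    (hu : ContDiffOn ℝ ∞ (fun p : ℝ × Plane => u p.1 p.2) (Ioo 0 (2 * T) ×ˢ ball x₀ (2 * R₀)))
    (hη : IsTimeCutoff δ C₀ T η) (hψ₀ : IsMacroCutoff δ C₀ x₀ R₀ ψ₀)
    (hχ : IsVerticalCutoff δ C₀ R₀ Rs χ) (hK₁ : 0 < K₁) (hK₂ : 0 < K₂)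
    (hc : IsCover K₁ K₂ x₀ R₀ R n c) (hψ : IsCutoffFamily δ C₀ x₀ R₀ ψ₀ K₂ R n c ψ)
    (hε : 0 < dissipationAvg α R₀ T θ η ψ₀ χ)
    (h : lengthScale α (varianceAvg δ R₀ T θ η ψ₀) (extVarianceAvg α δ R₀ T θ η ψ₀ χ)
      (dissipationAvg α R₀ T θ η ψ₀ χ) ≤ cascadeParam α C₀ K₁ K₂ * R) :
    ∑ i, localFlux T θ u η (ψ i) ∈ Icc (R₀ ^ 2 * dissipationAvg α R₀ T θ η ψ₀ χ / 8)
      (16 * K₂ * (R₀ ^ 2 * dissipationAvg α R₀ T θ η ψ₀ χ / 8)) := by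
  have hR := hc.scale_pos
  have hr₀ := hψ₀.refined
  have hTR₀ : 0 < T * R₀ ^ 2 := by positivity
  have hv : 0 ≤ varianceAvg δ R₀ T θ η ψ₀ := by
    refine nonneg_of_mul_nonneg_right ?_ hTR₀
    rw [varianceAvg_eq hR₀ hT]
    refine integral_nonneg fun t => integral_nonneg fun x => mul_nonneg (by positivity)
      (Real.rpow_nonneg (mul_nonneg (hη.nonneg t) (hr₀.nonneg x)) _)
  have hvs : 0 ≤ extVarianceAvg α δ R₀ T θ η ψ₀ χ := by
    refine nonneg_of_mul_nonneg_right ?_ hTR₀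
    rw [extVarianceAvg_eq hα hα2 hR₀ hRs hδ hT hsol hη hχ hr₀.smooth.continuous hr₀.nonneg
      hr₀.le_one]
    refine integral_nonneg fun t => integral_nonneg_of_ae ?_
    filter_upwards [ae_height_pos] with ⟨x, z⟩ hz
    exact varianceDensity_nonneg hα hα2 hR₀ hRs hχ
      (fun x => mul_nonneg (hη.nonneg t) (hr₀.nonneg x)) x hz
  obtain ⟨h1, h2⟩ := averages_le_of_lengthScale_le hα hC₀ hK₁ hK₂ hv hvs hε hR h
  obtain ⟨b1, b2⟩ := sum_localFlux_bounds hα hα2 hC₀ hR₀ hRs hδ hδ1 hT hsol hθ hu hη hψ₀ hχ hc hψ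
    hε
  generalize dissipationAvg α R₀ T θ η ψ₀ χ = e at *
  generalize varianceAvg δ R₀ T θ η ψ₀ = v at *
  generalize extVarianceAvg α δ R₀ T θ η ψ₀ χ = vs at *
  have hK₁' : (1 : ℝ) ≤ K₁ := by exact_mod_cast hK₁
  have hK₂' : (1 : ℝ) ≤ K₂ := by exact_mod_cast hK₂
  -- The only place where `2T ≥ R₀^α` is used: it trades `R^α` in the bound on `ϑ₀` for the `1/T`
  -- coming from `η'`.
  have hRα : R ^ α ≤ 2 * T := (Real.rpow_le_rpow hR.le hc.scale_le hα.le).trans hTR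
  have e1 : C₀ / T * K₂ * v ≤ e / 4 := by
    calc C₀ / T * K₂ * v ≤ C₀ / T * K₂ * (2 * T * e / (8 * C₀ * K₁ * K₂)) := by
          refine mul_le_mul_of_nonneg_left (h1.trans ?_) (by positivity)
          gcongr
      _ = e / 4 / K₁ := by field_simp; norm_num
      _ ≤ e / 4 := div_le_self (by positivity) hK₁'
  -- Together with the quarter lost to the time cut-off, the errors amount to at most 7/8 of `e`,
  -- leaving 1/8.
  have e2 : 5 * (C₀ / R ^ 2) * K₂ * vs ≤ 5 * e / 8 := by
    calc 5 * (C₀ / R ^ 2) * K₂ * vs ≤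
          5 * (C₀ / R ^ 2) * K₂ * (R ^ 2 * e / (8 * C₀ * K₁ * K₂)) :=
          mul_le_mul_of_nonneg_left h2 (by positivity)
      _ = 5 * e / 8 / K₁ := by field_simp
      _ ≤ 5 * e / 8 := div_le_self (by positivity) hK₁'
  have hKe : e ≤ K₂ * e := le_mul_of_one_le_left hε.le hK₂'
  have hR₀' : 0 < R₀ ^ 2 := by positivity
  constructor
  · refine le_trans ?_ b1
    rw [mul_div_assoc]
    refine mul_le_mul_of_nonneg_left ?_ hR₀'.le
    linarith
  · refine b2.trans ?_
    -- Above, `K₂ e` plus 7/8 of `e` is at most `2 K₂ e`, which is sixteen times `K₂ e / 8`.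
    rw [show 16 * (K₂ : ℝ) * (R₀ ^ 2 * e / 8) = R₀ ^ 2 * (2 * (K₂ * e)) by ring]
    refine mul_le_mul_of_nonneg_left ?_ hR₀'.le
    linarith

end SQG

theorem corollary3
    (α δ C₀ R₀ Rs T : ℝ) (x₀ : SQG.Plane)
    (hα : 0 < α) (hα2 : α < 2) (hδ : 1 / 2 < δ) (hδ1 : δ < 1) (hC₀ : 0 < C₀)
    (hR₀ : 0 < R₀) (hRs : 0 < Rs) (hT : 0 < T) (hTR : R₀ ^ α ≤ 2 * T)
    -- the solution, smooth on the macro-scale domain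
    (θ₀ : SQG.Plane → ℝ) (θ : ℝ → SQG.Plane → ℝ) (u : ℝ → SQG.Plane → SQG.Plane)
    (hsol : SQG.IsWeakSolution α θ₀ θ u)
    (hθ : ContDiffOn ℝ ∞ (fun p : ℝ × SQG.Plane => θ p.1 p.2)
      (Set.Ioo 0 (2 * T) ×ˢ Metric.ball x₀ (2 * R₀)))
    (hu : ContDiffOn ℝ ∞ (fun p : ℝ × SQG.Plane => u p.1 p.2)
      (Set.Ioo 0 (2 * T) ×ˢ Metric.ball x₀ (2 * R₀)))
    -- the temporal, macro-scale and vertical cut-off functions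
    (η : ℝ → ℝ) (hη : SQG.IsTimeCutoff δ C₀ T η)
    (ψ₀ : SQG.Plane → ℝ) (hψ₀ : SQG.IsMacroCutoff δ C₀ x₀ R₀ ψ₀)
    (χ : ℝ → ℝ) (hχ : SQG.IsVerticalCutoff δ C₀ R₀ Rs χ)
    -- the macro-scale quantities and the condition triggering the cascade
    (K₁ K₂ : ℕ) (hK₁ : 0 < K₁) (hK₂ : 0 < K₂)
    (ε₀ σ₀ β : ℝ)
    (hε₀ : ε₀ = SQG.dissipationAvg α R₀ T θ η ψ₀ χ) (hε₀_pos : 0 < ε₀)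
    (hσ₀ : σ₀ = SQG.lengthScale α (SQG.varianceAvg δ R₀ T θ η ψ₀)
      (SQG.extVarianceAvg α δ R₀ T θ η ψ₀ χ) ε₀)
    (hβ : β = SQG.cascadeParam α C₀ K₁ K₂)
    (hcascade : σ₀ < β * R₀)
    -- two scales in the inertial range, with covers and cut-off functions at these scales
    (r R : ℝ) (hr : σ₀ / β ≤ r) (hR : σ₀ / β ≤ R)
    (n : ℕ) (c : Fin n → SQG.Plane) (ψ : Fin n → SQG.Plane → ℝ)
    (hc : SQG.IsCover K₁ K₂ x₀ R₀ r n c)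
    (hψ : SQG.IsCutoffFamily δ C₀ x₀ R₀ ψ₀ K₂ r n c ψ)
    (m : ℕ) (d : Fin m → SQG.Plane) (ζ : Fin m → SQG.Plane → ℝ)
    (hd : SQG.IsCover K₁ K₂ x₀ R₀ R m d)
    (hω : SQG.IsCutoffFamily δ C₀ x₀ R₀ ψ₀ K₂ R m d ζ) :
    (1 / (16 * (K₁ : ℝ) * K₂) * (r / R) ^ 2
        ≤ SQG.ensembleFlux T θ u η ψ / SQG.ensembleFlux T θ u η ζ ∧
      SQG.ensembleFlux T θ u η ψ / SQG.ensembleFlux T θ u η ζ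
        ≤ 16 * (K₁ : ℝ) * K₂ * (r / R) ^ 2) ∧
    ∀ k : ℤ, r = 2 ^ k * R →
      1 / (16 * (K₁ : ℝ) * K₂) * 2 ^ (2 * k)
          ≤ SQG.ensembleFlux T θ u η ψ / SQG.ensembleFlux T θ u η ζ ∧
        SQG.ensembleFlux T θ u η ψ / SQG.ensembleFlux T θ u η ζ
          ≤ 16 * (K₁ : ℝ) * K₂ * 2 ^ (2 * k) := by

  subst hε₀ hσ₀ hβ
  have hβ := SQG.cascadeParam_pos (α := α) hC₀ hK₁ hK₂
  have hr0 := hc.scale_pos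
  have hR0 := hd.scale_pos
  -- Both sums lie in one interval whose endpoints do not involve the scale, so all scale dependence
  -- comes from the cardinalities.
  have hA := SQG.sum_localFlux_mem_Icc hα hα2 hC₀ hR₀ hRs hδ hδ1 hT hTR hsol hθ hu hη hψ₀ hχ hK₁
    hK₂ hc hψ hε₀_pos (by rwa [div_le_iff₀' hβ] at hr)
  have hB := SQG.sum_localFlux_mem_Icc hα hα2 hC₀ hR₀ hRs hδ hδ1 hT hTR hsol hθ hu hη hψ₀ hχ hK₁
    hK₂ hd hω hε₀_pos (by rwa [div_le_iff₀' hβ] at hR)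
  have main := SQG.ratio_bounds (by positivity) hc.card_pos hd.card_pos hR₀ hr0 hR0 hK₁ hK₂ hA hB
    rfl rfl ⟨hc.le_card, hc.card_le⟩ ⟨hd.le_card, hd.card_le⟩
  refine ⟨main, fun k hk => ?_⟩
  have e : (r / R) ^ 2 = 2 ^ (2 * k) := by
    rw [hk, mul_div_cancel_right₀ _ hR0.ne', mul_comm 2 k, zpow_mul]
    norm_cast
  rw [e] at main
  exact main
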